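/- **Setting.** Let $-\infty\le \ell_-<0<\ell_+\le\infty$, $\Omega_0=(\ell_-,\ell_+)$, $\alpha>0$, $0<\beta<\tfrac12$, $\gamma>0$, and let $V_0\in L^\infty(\Omega_0)$ be real-valued with $V_0\ge 0$ a.e. Let $\varepsilon_0$ satisfy $$\varepsilon_0<\min\{(2\gamma)^{-1/\alpha},|\ell_-|,\ell_+\},\qquad \varepsilon_0<\gamma^{-1/(\alpha+1-\beta)},\qquad \varepsilon_0<\min\{\gamma,\gamma^{-1}\}.$$ For $0<\varepsilon\le\varepsilon_0$ put $d_\varepsilon=\gamma\varepsilon^{\alpha+1}$, $h_\varepsilon=\varepsilon^\alpha$, $b_\varepsilon=\varepsilon^\beta$ and $$S_\varepsilon=\Omega_0\times(-\varepsilon,0),\quad P_\varepsilon=\{|x_1|<\tfrac{d_\varepsilon}2,\ 0<x_2<h_\varepsilon\},\quad R_\varepsilon=\{|x_1|<\tfrac{b_\varepsilon}2,\ h_\varepsilon<x_2<h_\varepsilon+b_\varepsilon\},$$ $\Omega_\varepsilon=\operatorname{int}\overline{S_\varepsilon\cup P_\varepsilon\cup R_\varepsilon}\subset\mathbb R^2$.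 Let $V_\varepsilon(x)=V_0(x_1)$ on $S_\varepsilon$ and $V_\varepsilon=0$ on $P_\varepsilon\cup R_\varepsilon$. Let $\mathcal A_\varepsilon$ be the operator in $\mathcal H_\varepsilon=L^2(\Omega_\varepsilon)$ associated with the form $$\mathfrak a_\varepsilon[u,v]=\int_{\Omega_\varepsilon}\bigl(\nabla u\cdot\overline{\nabla v}+V_\varepsilon u\overline v\bigr)\,dx,\qquad \operatorname{dom}\mathfrak a_\varepsilon=H^1(\Omega_\varepsilon),$$ (that is, $-\Delta+V_\varepsilon$ with Neumann boundary conditions), and let $\mathcal A_0$ be the operator in $\mathcal H_0=L^2(\Omega_0)\oplus\mathbb C$ associated with the form $$\mathfrak a_0[f,g]=\int_{\Omega_0}\bigl(f_1'\overline{g_1'}+V_0f_1\overline{g_1}\bigr)\,dx+\gamma f_1(0)\overline{g_1(0)},\qquad \operatorname{dom}\mathfrak a_0=H^1(\Omega_0)\times\mathbb C,$$ (that is, the direct sum of the one-dimensional Schrödinger operator with a $\delta$-interaction of strength $\gamma$ at $0$ and Neumann conditions at finite end points, and of the zero operator on $\mathbb C$). Put $\mathcal R_\varepsilon=(\mathcal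 A_\varepsilon+I)^{-1}$ and $\mathcal R_0=(\mathcal A_0+I)^{-1}$. Define $J_\varepsilon:\mathcal H_0\to\mathcal H_\varepsilon$ and $\widetilde J_\varepsilon:\mathcal H_\varepsilon\to\mathcal H_0$ by $$J_\varepsilon f=\begin{cases}\varepsilon^{-1/2}f_1(x_1)&\text{on }S_\varepsilon,\\ 0&\text{on }P_\varepsilon,\\ b_\varepsilon^{-1}f_2&\text{on }R_\varepsilon,\end{cases}\qquad \widetilde J_\varepsilon u=\Bigl(x_1\mapsto\varepsilon^{-1/2}\int_{-\varepsilon}^0u(x_1,x_2)\,dx_2,\ \ b_\varepsilon^{-1}\int_{R_\varepsilon}u\,dx\Bigr).$$ **Theorem 2.1.** The resolvents $\mathcal R_\varepsilon$ and $\mathcal R_0$ exist as bounded everywhere defined operators, and $$\|\mathcal R_\varepsilon J_\varepsilon-J_\varepsilon\mathcal R_0\|_{\mathcal H_0\to\mathcal H_\varepsilon}=\|\widetilde J_\varepsilon\mathcal R_\varepsilon-\mathcal R_0\widetilde J_\varepsilon\|_{\mathcal H_\varepsilon\to\mathcal H_0}\le C_1\,\varepsilon^{\min\{\alpha,\,1/2-\beta\}}$$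 for all $\varepsilon\in(0,\varepsilon_0]$, where the constant $C_1>0$ is independent of $\varepsilon$. More precisely, $C_1$ depends only on an upper bound for $\alpha$, $\beta^{-1}$, $\gamma$, $\|V_0\|_{L^\infty(\Omega_0)}$ and $\ell^{-1}$, where $\ell=\min\{|\ell_-|,\ell_+\}$: for every real $K$ there is $C_1=C_1(K)>0$ that works for all data for which these five quantities are at most $K$. -/

import Mathlib

open MeasureTheory Set
open scoped ContDiff ENNReal ComplexConjugate

noncomputable section

namespace RoomPassage

/-! ### Lebesgue and Sobolev spaces on open sets -/

section Sobolev

variable {E : Type*} [NormedAddCommGroup E] [NormedSpace ℝ E] [MeasureSpace E]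

/-- The complex Hilbert space `L²(Ω)` with respect to Lebesgue measure. -/
abbrev L2 (Ω : Set E) : Type _ := Lp ℂ 2 (volume.restrict Ω)

/-- `g` is the weak (distributional) derivative of `u` on the open set `Ω` in the direction `v`. -/
def HasWeakDeriv (Ω : Set E) (v : E) (u g : L2 Ω) : Prop :=
  ∀ φ : E → ℝ, ContDiff ℝ ∞ φ → HasCompactSupport φ → tsupport φ ⊆ Ω →
    ∫ x in Ω, (fderiv ℝ φ x v) • u x = - ∫ x in Ω, φ x • g x

/-- The Sobolev space `H¹(Ω)`: all weak directional derivatives exist and belong to `L²(Ω)`. -/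
def H1 (Ω : Set E) : Set (L2 Ω) :=
  {u | ∀ v : E, ∃ g : L2 Ω, HasWeakDeriv Ω v u g}

open scoped Classical in
/-- The weak derivative of `u` in the direction `v` as an element of `L²(Ω)` (unique when it
exists, for open `Ω`; it is only used for `u ∈ H¹(Ω)`). -/
def weakDeriv (Ω : Set E) (v : E) (u : L2 Ω) : L2 Ω :=
  if h : ∃ g : L2 Ω, HasWeakDeriv Ω v u g then h.choose else 0

end Sobolev

open scoped Classical in
/-- The value at `x ∈ Ω` of the continuous representative of (the class of) `f`; for open `Ω ⊆ ℝ`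
this representative is unique on `Ω`, and it exists for `f ∈ H¹(Ω)`. -/
def pointValue (Ω : Set ℝ) (f : L2 Ω) (x : ℝ) : ℂ :=
  if h : ∃ g : ℝ → ℂ, ContinuousOn g Ω ∧ f =ᵐ[volume.restrict Ω] g then h.choose x else 0

/-! ### Operators associated with sesquilinear forms, and resolvents -/

section Forms

variable {H : Type*} [NormedAddCommGroup H] [InnerProductSpace ℂ H]

/-- The graph of the operator `A` associated with the sesquilinear form `a` (linear in the first
argument) with form domain `D`: `u ∈ dom A` and `A u = w` iff `u ∈ D` and `(w, v) = a[u, v]` for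
all `v ∈ D`. Mathlib's inner product is linear in its second argument. -/
def operatorGraph (D : Set H) (a : H → H → ℂ) : Set (H × H) :=
  {p | p.1 ∈ D ∧ ∀ v ∈ D, inner ℂ v p.2 = a p.1 v}

/-- The bounded operator `R` is `(A + I)⁻¹` for the operator `A` with graph `G`:
`R f = u` iff `u ∈ dom A` and `A u + u = f`. -/
def IsResolvent (G : Set (H × H)) (R : H →L[ℂ] H) : Prop :=
  ∀ f u : H, R f = u ↔ (u, f - u) ∈ G

theorem IsResolvent.unique {G : Set (H × H)} {R R' : H →L[ℂ] H}
    (h : IsResolvent G R) (h' : IsResolvent G R') : R = R' := by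
  ext f
  exact ((h' f (R f)).2 ((h f (R f)).1 rfl)).symm

open scoped Classical in
/-- The resolvent `(A + I)⁻¹` of the operator with graph `G`, when it exists as a bounded
everywhere defined operator. -/
def formResolvent (G : Set (H × H)) : H →L[ℂ] H :=
  if h : ∃ R : H →L[ℂ] H, IsResolvent G R then h.choose else 0

end Forms

/-! ### The geometry -/

/-- The interval `Ω₀ = (ℓ₋, ℓ₊)`, bounded or not. -/
def interval (lm lp : EReal) : Set ℝ := {x | lm < (x : EReal) ∧ (x : EReal) < lp}

/-- The straight strip `Ω₀ × (-ε, 0)`. -/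
def strip (lm lp : EReal) (ε : ℝ) : Set (ℝ × ℝ) := interval lm lp ×ˢ Ioo (-ε) 0

/-- The passage of width `d` and height `h`. -/
def passage (d h : ℝ) : Set (ℝ × ℝ) := {x | |x.1| < d / 2 ∧ 0 < x.2 ∧ x.2 < h}

/-- The room, a square of side length `b` on top of the passage of height `h`. -/
def room (h b : ℝ) : Set (ℝ × ℝ) := {x | |x.1| < b / 2 ∧ h < x.2 ∧ x.2 < h + b}

/-- The waveguide: strip, passage and room glued together. -/
def waveguide (lm lp : EReal) (ε d h b : ℝ) : Set (ℝ × ℝ) :=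
  interior (closure (strip lm lp ε ∪ passage d h ∪ room h b))

theorem isOpen_interval (lm lp : EReal) : IsOpen (interval lm lp) :=
  (isOpen_lt continuous_const continuous_coe_real_ereal).inter
    (isOpen_lt continuous_coe_real_ereal continuous_const)

theorem isOpen_strip (lm lp : EReal) (ε : ℝ) : IsOpen (strip lm lp ε) :=
  (isOpen_interval lm lp).prod isOpen_Ioo

theorem isOpen_passage (d h : ℝ) : IsOpen (passage d h) :=
  (isOpen_lt (continuous_abs.comp continuous_fst) continuous_const).inter
    ((isOpen_lt continuous_const continuous_snd).inter (isOpen_lt continuous_snd continuous_const))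

theorem isOpen_room (h b : ℝ) : IsOpen (room h b) :=
  (isOpen_lt (continuous_abs.comp continuous_fst) continuous_const).inter
    ((isOpen_lt continuous_const continuous_snd).inter (isOpen_lt continuous_snd continuous_const))

theorem union_subset_waveguide (lm lp : EReal) (ε d h b : ℝ) :
    strip lm lp ε ∪ passage d h ∪ room h b ⊆ waveguide lm lp ε d h b :=
  interior_maximal subset_closure
    (((isOpen_strip lm lp ε).union (isOpen_passage d h)).union (isOpen_room h b))

theorem strip_subset (lm lp : EReal) (ε d h b : ℝ) :
    strip lm lp ε ⊆ waveguide lm lp ε d h b := fun _ hx =>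
  union_subset_waveguide lm lp ε d h b (Or.inl (Or.inl hx))

theorem room_subset (lm lp : EReal) (ε d h b : ℝ) :
    room h b ⊆ waveguide lm lp ε d h b := fun _ hx =>
  union_subset_waveguide lm lp ε d h b (Or.inr hx)

theorem volume_room_lt_top (h b : ℝ) : volume (room h b) < ⊤ := by
  have hsub : room h b ⊆ Icc (-(b / 2)) (b / 2) ×ˢ Icc h (h + b) := by
    rintro x ⟨h1, h2, h3⟩
    have := abs_lt.1 h1
    exact ⟨⟨this.1.le, this.2.le⟩, ⟨h2.le, h3.le⟩⟩
  exact (measure_mono hsub).trans_lt (isCompact_Icc.prod isCompact_Icc).measure_lt_top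

/-! ### The forms and the operators -/

open scoped Classical in
/-- The potential on the waveguide: `V₀(x₁)` on the strip, zero on passage and room. -/
def potential (lm lp : EReal) (ε : ℝ) (V₀ : ℝ → ℝ) (x : ℝ × ℝ) : ℝ :=
  if x ∈ strip lm lp ε then V₀ x.1 else 0

/-- The form `∫_Ω (∇u · conj ∇v + V u conj v)` on a planar domain; its domain is `H¹(Ω)`. -/
def planarForm (Ω : Set (ℝ × ℝ)) (V : ℝ × ℝ → ℝ) (u v : L2 Ω) : ℂ :=
  ∫ x in Ω, (weakDeriv Ω (1, 0) u x * conj (weakDeriv Ω (1, 0) v x)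
    + weakDeriv Ω (0, 1) u x * conj (weakDeriv Ω (0, 1) v x)
    + (V x : ℂ) * u x * conj (v x))

/-- The graph of `-Δ_Neumann + V` on a planar domain. -/
def neumannGraph (Ω : Set (ℝ × ℝ)) (V : ℝ × ℝ → ℝ) : Set (L2 Ω × L2 Ω) :=
  operatorGraph (H1 Ω) (planarForm Ω V)

/-- The limit Hilbert space `L²(Ω₀) ⊕ ℂ` with its Hilbert sum inner product. -/
abbrev LimitSpace (Ω₀ : Set ℝ) : Type := WithLp 2 (L2 Ω₀ × ℂ)

/-- The form domain `H¹(Ω₀) × ℂ`. -/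
def limitDomain (Ω₀ : Set ℝ) : Set (LimitSpace Ω₀) := {f | f.fst ∈ H1 Ω₀}

/-- The form `∫ (f₁' conj g₁' + V₀ f₁ conj g₁) + γ f₁(0) conj g₁(0)` on `H¹(Ω₀) × ℂ`. -/
def limitForm (Ω₀ : Set ℝ) (V₀ : ℝ → ℝ) (γ : ℝ) (f g : LimitSpace Ω₀) : ℂ :=
  (∫ x in Ω₀, (weakDeriv Ω₀ 1 f.fst x * conj (weakDeriv Ω₀ 1 g.fst x)
    + (V₀ x : ℂ) * f.fst x * conj (g.fst x)))
    + (γ : ℂ) * pointValue Ω₀ f.fst 0 * conj (pointValue Ω₀ g.fst 0)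

/-- The graph of the limit operator: the Schrödinger operator with a `δ`-interaction of strength
`γ` at `0`, plus the zero operator on `ℂ`. -/
def limitGraph (Ω₀ : Set ℝ) (V₀ : ℝ → ℝ) (γ : ℝ) : Set (LimitSpace Ω₀ × LimitSpace Ω₀) :=
  operatorGraph (limitDomain Ω₀) (limitForm Ω₀ V₀ γ)

/-! ### The identification operators -/

section Identification

theorem restrict_strip (lm lp : EReal) (ε : ℝ) :
    (volume : Measure (ℝ × ℝ)).restrict (strip lm lp ε) =
      ((volume : Measure ℝ).restrict (interval lm lp)).prod (volume.restrict (Ioo (-ε) 0)) := by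
  rw [strip, Measure.volume_eq_prod, Measure.prod_restrict]

theorem restrict_strip_le (lm lp : EReal) (ε d h b : ℝ) :
    (volume : Measure (ℝ × ℝ)).restrict (strip lm lp ε) ≤
      volume.restrict (waveguide lm lp ε d h b) :=
  Measure.restrict_mono (strip_subset lm lp ε d h b) le_rfl

theorem restrict_room_le (lm lp : EReal) (ε d h b : ℝ) :
    (volume : Measure (ℝ × ℝ)).restrict (room h b) ≤
      volume.restrict (waveguide lm lp ε d h b) :=
  Measure.restrict_mono (room_subset lm lp ε d h b) le_rfl

theorem eLpNorm_comp_fst {μ ν : Measure ℝ} [SFinite μ] [IsFiniteMeasure ν] {f : ℝ → ℂ}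
    (hf : AEStronglyMeasurable f μ) :
    eLpNorm (fun x : ℝ × ℝ => f x.1) 2 (μ.prod ν) = (ν univ) ^ (1 / 2 : ℝ) * eLpNorm f 2 μ := by
  have h1 : eLpNorm (f ∘ Prod.fst) 2 (μ.prod ν) =
      eLpNorm f 2 (Measure.map Prod.fst (μ.prod ν)) := by
    refine (eLpNorm_map_measure ?_ measurable_fst.aemeasurable).symm
    rw [Measure.map_fst_prod]
    exact hf.smul_measure _
  change eLpNorm (f ∘ Prod.fst) 2 (μ.prod ν) = _
  rw [h1, Measure.map_fst_prod, eLpNorm_smul_measure_of_ne_top (by simp)]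
  simp

theorem eLpNorm_section_integral_le {μ ν : Measure ℝ} [SFinite μ] [IsFiniteMeasure ν]
    {u : ℝ × ℝ → ℂ} (hu : AEStronglyMeasurable u (μ.prod ν)) :
    eLpNorm (fun x => ∫ y, u (x, y) ∂ν) 2 μ ≤
      (ν univ) ^ (1 / 2 : ℝ) * eLpNorm u 2 (μ.prod ν) := by
  have hsq : ∀ᵐ x ∂μ, ‖∫ y, u (x, y) ∂ν‖ₑ ^ (2 : ℝ) ≤ ν univ * ∫⁻ y, ‖u (x, y)‖ₑ ^ (2 : ℝ) ∂ν := by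
    filter_upwards [hu.prodMk_left] with x hx
    have h1 : ‖∫ y, u (x, y) ∂ν‖ₑ ≤ eLpNorm (fun y => u (x, y)) 1 ν := by
      rw [eLpNorm_one_eq_lintegral_enorm]
      exact enorm_integral_le_lintegral_enorm _
    have h2 := eLpNorm_le_eLpNorm_mul_rpow_measure_univ (p := 1) (q := 2) (by norm_num) hx
    have h3 := ENNReal.rpow_le_rpow (h1.trans h2) (z := 2) (by norm_num)
    refine h3.trans (le_of_eq ?_)
    rw [ENNReal.mul_rpow_of_nonneg _ _ (by norm_num), ← ENNReal.rpow_mul,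
      eLpNorm_eq_lintegral_rpow_enorm_toReal (by norm_num) (by norm_num), ← ENNReal.rpow_mul]
    norm_num
    rw [mul_comm]
  rw [eLpNorm_eq_lintegral_rpow_enorm_toReal (by norm_num) (by norm_num),
    eLpNorm_eq_lintegral_rpow_enorm_toReal (by norm_num) (by norm_num),
    ENNReal.toReal_ofNat, ← ENNReal.mul_rpow_of_nonneg _ _ (by norm_num)]
  refine ENNReal.rpow_le_rpow ?_ (by norm_num)
  rw [lintegral_prod _ (hu.enorm.pow_const _),
    ← lintegral_const_mul' _ _ (measure_ne_top _ _)]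
  exact lintegral_mono_ae hsq

variable (lm lp : EReal) (ε d h b : ℝ)

/-- The function `(x₁, x₂) ↦ ε^{-1/2} f(x₁)` on the strip, extended by zero. -/
def liftFun (f : ℝ → ℂ) : ℝ × ℝ → ℂ :=
  (strip lm lp ε).indicator fun x => ((ε ^ (-(1 / 2) : ℝ) : ℝ) : ℂ) * f x.1

theorem eLpNorm_liftFun {f : ℝ → ℂ} (hf : MemLp f 2 (volume.restrict (interval lm lp))) :
    eLpNorm (liftFun lm lp ε f) 2 (volume.restrict (waveguide lm lp ε d h b)) =
      ‖((ε ^ (-(1 / 2) : ℝ) : ℝ) : ℂ)‖ₑ * ((volume (Ioo (-ε) 0)) ^ (1 / 2 : ℝ) *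
        eLpNorm f 2 (volume.restrict (interval lm lp))) := by
  rw [liftFun, eLpNorm_indicator_eq_eLpNorm_restrict (isOpen_strip lm lp ε).measurableSet,
    Measure.restrict_restrict_of_subset (strip_subset lm lp ε d h b), restrict_strip]
  change eLpNorm (((ε ^ (-(1 / 2) : ℝ) : ℝ) : ℂ) • fun x : ℝ × ℝ => f x.1) 2 _ = _
  rw [eLpNorm_const_smul, eLpNorm_comp_fst hf.1, Measure.restrict_apply_univ]

theorem memLp_liftFun {f : ℝ → ℂ} (hf : MemLp f 2 (volume.restrict (interval lm lp))) :
    MemLp (liftFun lm lp ε f) 2 (volume.restrict (waveguide lm lp ε d h b)) := by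
  rw [liftFun, memLp_indicator_iff_restrict (isOpen_strip lm lp ε).measurableSet,
    Measure.restrict_restrict_of_subset (strip_subset lm lp ε d h b), restrict_strip]
  exact (hf.comp_fst _).const_mul _

theorem liftFun_congr {f g : ℝ → ℂ} (hfg : f =ᵐ[volume.restrict (interval lm lp)] g) :
    liftFun lm lp ε f =ᵐ[volume.restrict (waveguide lm lp ε d h b)] liftFun lm lp ε g := by
  have h1 : ∀ᵐ x ∂((volume : Measure (ℝ × ℝ)).restrict (strip lm lp ε)), f x.1 = g x.1 := by
    rw [restrict_strip]
    exact Measure.quasiMeasurePreserving_fst.ae hfg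
  rw [ae_restrict_iff' (isOpen_strip lm lp ε).measurableSet] at h1
  filter_upwards [ae_restrict_of_ae h1] with x hx
  by_cases hxs : x ∈ strip lm lp ε
  · simp [liftFun, hxs, hx hxs]
  · simp [liftFun, hxs]

/-- The strip component of the identification operator, `L²(Ω₀) → L²(Ω_ε)`. -/
def liftStrip : L2 (interval lm lp) →L[ℂ] L2 (waveguide lm lp ε d h b) :=
  LinearMap.mkContinuous
    { toFun := fun f => (memLp_liftFun lm lp ε d h b (Lp.memLp f)).toLp _
      map_add' := fun f g => by
        rw [← MemLp.toLp_add, MemLp.toLp_eq_toLp_iff]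
        refine (liftFun_congr lm lp ε d h b (Lp.coeFn_add f g)).trans (ae_of_all _ fun x => ?_)
        by_cases hxs : x ∈ strip lm lp ε <;> simp [liftFun, hxs, mul_add]
      map_smul' := fun c f => by
        rw [RingHom.id_apply, ← MemLp.toLp_const_smul, MemLp.toLp_eq_toLp_iff]
        refine (liftFun_congr lm lp ε d h b (Lp.coeFn_smul c f)).trans (ae_of_all _ fun x => ?_)
        by_cases hxs : x ∈ strip lm lp ε <;> simp [liftFun, hxs, mul_left_comm] }
    ((‖((ε ^ (-(1 / 2) : ℝ) : ℝ) : ℂ)‖ₑ * (volume (Ioo (-ε) 0)) ^ (1 / 2 : ℝ)).toReal)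
    fun f => by
      rw [LinearMap.coe_mk, AddHom.coe_mk, Lp.norm_toLp, eLpNorm_liftFun _ _ _ _ _ _ (Lp.memLp f),
        ← mul_assoc, ENNReal.toReal_mul, Lp.norm_def]

/-- The room component of the identification operator: `c ↦ b⁻¹ c` on the room, zero elsewhere. -/
def liftRoom : ℂ →L[ℂ] L2 (waveguide lm lp ε d h b) :=
  ContinuousLinearMap.toSpanSingleton ℂ
    (indicatorConstLp 2 (isOpen_room h b).measurableSet
      (((Measure.restrict_apply_le _ _).trans_lt (volume_room_lt_top h b)).ne) ((b⁻¹ : ℝ) : ℂ))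

/-- The identification operator `J : L²(Ω₀) ⊕ ℂ → L²(Ω_ε)`: it maps `(f₁, f₂)` to
`ε^{-1/2} f₁(x₁)` on the strip, `0` on the passage and `b⁻¹ f₂` on the room. -/
def J : LimitSpace (interval lm lp) →L[ℂ] L2 (waveguide lm lp ε d h b) :=
  liftStrip lm lp ε d h b ∘L WithLp.fstL 2 ℂ (L2 (interval lm lp)) ℂ +
    liftRoom lm lp ε d h b ∘L WithLp.sndL 2 ℂ (L2 (interval lm lp)) ℂ

theorem J_apply_ae (f : LimitSpace (interval lm lp)) :
    J lm lp ε d h b f =ᵐ[volume.restrict (waveguide lm lp ε d h b)] fun x =>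
      (strip lm lp ε).indicator (fun x => ((ε ^ (-(1 / 2) : ℝ) : ℝ) : ℂ) * f.fst x.1) x +
        (room h b).indicator (fun _ => ((b⁻¹ : ℝ) : ℂ) * f.snd) x := by
  have h1 : liftStrip lm lp ε d h b f.fst =ᵐ[volume.restrict (waveguide lm lp ε d h b)]
      liftFun lm lp ε f.fst :=
    MemLp.coeFn_toLp (memLp_liftFun lm lp ε d h b (Lp.memLp f.fst))
  have hm : MeasurableSet (room h b) := (isOpen_room h b).measurableSet
  have hf : (volume.restrict (waveguide lm lp ε d h b)) (room h b) ≠ ⊤ :=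
    ((Measure.restrict_apply_le _ _).trans_lt (volume_room_lt_top h b)).ne
  have h2 : liftRoom lm lp ε d h b f.snd =ᵐ[volume.restrict (waveguide lm lp ε d h b)]
      (room h b).indicator fun _ => ((b⁻¹ : ℝ) : ℂ) * f.snd := by
    refine (Lp.coeFn_smul f.snd (indicatorConstLp 2 hm hf ((b⁻¹ : ℝ) : ℂ))).trans ?_
    filter_upwards [indicatorConstLp_coeFn (p := 2) (hs := hm) (hμs := hf)
      (c := ((b⁻¹ : ℝ) : ℂ))] with x hx
    rw [Pi.smul_apply, hx]
    by_cases hxr : x ∈ room h b <;> simp [hxr, mul_comm]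
  have h3 := Lp.coeFn_add (liftStrip lm lp ε d h b f.fst) (liftRoom lm lp ε d h b f.snd)
  filter_upwards [h1, h2, h3] with x hx1 hx2 hx3
  change (liftStrip lm lp ε d h b f.fst + liftRoom lm lp ε d h b f.snd :
    L2 (waveguide lm lp ε d h b)) x = _
  rw [hx3, Pi.add_apply, hx1, hx2, liftFun]

/-- The function `x₁ ↦ ε^{-1/2} ∫_{-ε}^0 u(x₁, x₂) dx₂`. -/
def sectionFun (u : ℝ × ℝ → ℂ) (x : ℝ) : ℂ :=
  ((ε ^ (-(1 / 2) : ℝ) : ℝ) : ℂ) * ∫ y in Ioo (-ε) 0, u (x, y)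

theorem memLp_strip (u : L2 (waveguide lm lp ε d h b)) :
    MemLp u 2 (((volume : Measure ℝ).restrict (interval lm lp)).prod
      (volume.restrict (Ioo (-ε) 0))) := by
  rw [← restrict_strip]
  exact (Lp.memLp u).mono_measure (restrict_strip_le lm lp ε d h b)

theorem eLpNorm_sectionFun_le (u : L2 (waveguide lm lp ε d h b)) :
    eLpNorm (sectionFun ε u) 2 (volume.restrict (interval lm lp)) ≤
      ‖((ε ^ (-(1 / 2) : ℝ) : ℝ) : ℂ)‖ₑ * (volume (Ioo (-ε) 0)) ^ (1 / 2 : ℝ) *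
        eLpNorm u 2 (volume.restrict (waveguide lm lp ε d h b)) := by
  change eLpNorm (((ε ^ (-(1 / 2) : ℝ) : ℝ) : ℂ) • fun x => ∫ y in Ioo (-ε) 0, u (x, y)) 2 _ ≤ _
  rw [eLpNorm_const_smul, mul_assoc]
  gcongr
  refine (eLpNorm_section_integral_le (memLp_strip lm lp ε d h b u).1).trans ?_
  rw [Measure.restrict_apply_univ, ← restrict_strip]
  gcongr
  exact strip_subset lm lp ε d h b

theorem memLp_sectionFun (u : L2 (waveguide lm lp ε d h b)) :
    MemLp (sectionFun ε u) 2 (volume.restrict (interval lm lp)) := by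
  refine ⟨(memLp_strip lm lp ε d h b u).1.integral_prod_right'.const_mul _, ?_⟩
  refine (eLpNorm_sectionFun_le lm lp ε d h b u).trans_lt ?_
  refine ENNReal.mul_lt_top (ENNReal.mul_lt_top enorm_lt_top ?_) (Lp.eLpNorm_lt_top u)
  exact ENNReal.rpow_lt_top_of_nonneg (by norm_num) (by simp)

theorem sectionFun_congr {u v : ℝ × ℝ → ℂ}
    (huv : u =ᵐ[volume.restrict (waveguide lm lp ε d h b)] v) :
    sectionFun ε u =ᵐ[volume.restrict (interval lm lp)] sectionFun ε v := by
  have h1 : u =ᵐ[volume.restrict (strip lm lp ε)] v :=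
    ae_mono (restrict_strip_le lm lp ε d h b) huv
  rw [restrict_strip] at h1
  filter_upwards [Measure.ae_ae_of_ae_prod h1] with x hx
  rw [sectionFun, sectionFun, integral_congr_ae hx]

theorem ae_integrable_section (u : L2 (waveguide lm lp ε d h b)) :
    ∀ᵐ x ∂(volume.restrict (interval lm lp)),
      Integrable (fun y => u (x, y)) (volume.restrict (Ioo (-ε) 0)) := by
  have hu := memLp_strip lm lp ε d h b u
  filter_upwards [hu.1.prodMk_left, ((memLp_two_iff_integrable_sq_norm hu.1).1 hu).prod_right_ae]
    with x hx1 hx2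
  exact ((memLp_two_iff_integrable_sq_norm hx1).2 hx2).integrable (by norm_num)

/-- The `L²(Ω₀)`-component of the operator `J̃`. -/
def averageStrip : L2 (waveguide lm lp ε d h b) →L[ℂ] L2 (interval lm lp) :=
  LinearMap.mkContinuous
    { toFun := fun u => (memLp_sectionFun lm lp ε d h b u).toLp _
      map_add' := fun u v => by
        rw [← MemLp.toLp_add, MemLp.toLp_eq_toLp_iff]
        refine (sectionFun_congr lm lp ε d h b (Lp.coeFn_add u v)).trans ?_
        filter_upwards [ae_integrable_section lm lp ε d h b u,
          ae_integrable_section lm lp ε d h b v] with x hx1 hx2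
        simp only [sectionFun, Pi.add_apply]
        rw [integral_add hx1 hx2, mul_add]
      map_smul' := fun c u => by
        rw [RingHom.id_apply, ← MemLp.toLp_const_smul, MemLp.toLp_eq_toLp_iff]
        refine (sectionFun_congr lm lp ε d h b (Lp.coeFn_smul c u)).trans (ae_of_all _ fun x => ?_)
        simp only [sectionFun, Pi.smul_apply, smul_eq_mul]
        rw [integral_const_mul, mul_left_comm] }
    ((‖((ε ^ (-(1 / 2) : ℝ) : ℝ) : ℂ)‖ₑ * (volume (Ioo (-ε) 0)) ^ (1 / 2 : ℝ)).toReal)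
    fun u => by
      rw [LinearMap.coe_mk, AddHom.coe_mk, Lp.norm_toLp, Lp.norm_def, ← ENNReal.toReal_mul]
      refine ENNReal.toReal_mono ?_ (eLpNorm_sectionFun_le lm lp ε d h b u)
      refine (ENNReal.mul_lt_top (ENNReal.mul_lt_top enorm_lt_top ?_) (Lp.eLpNorm_lt_top u)).ne
      exact ENNReal.rpow_lt_top_of_nonneg (by norm_num) (by simp)

instance isFiniteMeasure_room : IsFiniteMeasure ((volume : Measure (ℝ × ℝ)).restrict (room h b)) :=
  ⟨by rw [Measure.restrict_apply_univ]; exact volume_room_lt_top h b⟩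

theorem memLp_room (u : L2 (waveguide lm lp ε d h b)) :
    MemLp u 2 ((volume : Measure (ℝ × ℝ)).restrict (room h b)) :=
  (Lp.memLp u).mono_measure (restrict_room_le lm lp ε d h b)

/-- The `ℂ`-component of the operator `J̃`: `u ↦ b⁻¹ ∫_room u`. -/
def averageRoom : L2 (waveguide lm lp ε d h b) →L[ℂ] ℂ :=
  LinearMap.mkContinuous
    { toFun := fun u => ((b⁻¹ : ℝ) : ℂ) * ∫ x in room h b, u x
      map_add' := fun u v => by
        rw [integral_congr_ae (ae_mono (restrict_room_le lm lp ε d h b) (Lp.coeFn_add u v)),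
          ← mul_add]
        congr 1
        exact integral_add ((memLp_room lm lp ε d h b u).integrable (by norm_num))
          ((memLp_room lm lp ε d h b v).integrable (by norm_num))
      map_smul' := fun c u => by
        rw [integral_congr_ae (ae_mono (restrict_room_le lm lp ε d h b) (Lp.coeFn_smul c u))]
        simp only [Pi.smul_apply, smul_eq_mul, RingHom.id_apply]
        rw [integral_const_mul, mul_left_comm] }
    (‖((b⁻¹ : ℝ) : ℂ)‖ * ((volume (room h b)) ^ (1 / 2 : ℝ)).toReal)
    fun u => by
      rw [LinearMap.coe_mk, AddHom.coe_mk, norm_mul, mul_assoc]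
      gcongr
      rw [Lp.norm_def, ← ENNReal.toReal_mul, ← toReal_enorm]
      have hfin : (volume (room h b)) ^ (1 / 2 : ℝ) < ⊤ :=
        ENNReal.rpow_lt_top_of_nonneg (by norm_num) (volume_room_lt_top h b).ne
      refine ENNReal.toReal_mono (ENNReal.mul_lt_top hfin (Lp.eLpNorm_lt_top u)).ne ?_
      have h1 : ‖∫ x in room h b, u x‖ₑ ≤ eLpNorm u 1 (volume.restrict (room h b)) := by
        rw [eLpNorm_one_eq_lintegral_enorm]
        exact enorm_integral_le_lintegral_enorm _
      have h2 := eLpNorm_le_eLpNorm_mul_rpow_measure_univ (p := 1) (q := 2) (by norm_num)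
        (memLp_room lm lp ε d h b u).1
      refine (h1.trans h2).trans ?_
      rw [Measure.restrict_apply_univ, mul_comm]
      norm_num
      gcongr
      exact room_subset lm lp ε d h b

/-- The operator `J̃ : L²(Ω_ε) → L²(Ω₀) ⊕ ℂ`: it maps `u` to the pair of
`x₁ ↦ ε^{-1/2} ∫_{-ε}^0 u(x₁, x₂) dx₂` and `b⁻¹ ∫_room u`. -/
def JTilde : L2 (waveguide lm lp ε d h b) →L[ℂ] LimitSpace (interval lm lp) :=
  (WithLp.prodContinuousLinearEquiv 2 ℂ (L2 (interval lm lp)) ℂ).symm.toContinuousLinearMap ∘L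
    ((averageStrip lm lp ε d h b).prod (averageRoom lm lp ε d h b))

theorem JTilde_fst_ae (u : L2 (waveguide lm lp ε d h b)) :
    (JTilde lm lp ε d h b u).fst =ᵐ[volume.restrict (interval lm lp)] fun x =>
      ((ε ^ (-(1 / 2) : ℝ) : ℝ) : ℂ) * ∫ y in Ioo (-ε) 0, u (x, y) :=
  MemLp.coeFn_toLp (memLp_sectionFun lm lp ε d h b u)

theorem JTilde_snd (u : L2 (waveguide lm lp ε d h b)) :
    (JTilde lm lp ε d h b u).snd = ((b⁻¹ : ℝ) : ℂ) * ∫ x in room h b, u x := rfl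

end Identification

end RoomPassage

end

open RoomPassage

/-!
Fix `f` and `w`, put `u = 𝓡_ε w` and `g = 𝓡_0 f`, and test the equation of `u` with `J_ε g`,
extended across the passage by interpolating linearly in `x₂` between its values on the strip and
in the room. By self-adjointness the pairing of `w` with `(𝓡_ε J_ε - J_ε 𝓡_0) f` then becomes
`g₁(0) · conj (γ m + h⁻¹ ε^{-1/2} ∫_P ∂₂u)`, where `m` is the value at `0` of the averaged trace of
`u` on the strip, plus terms on the passage; these are small because its area is small and `g₁` is
Lipschitz near `0`. Integrating `∂₂u` over the passage gives `d` times the difference of the mean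
values of `u` at its two ends. Since `d = γ ε h`, the mean at the lower end cancels the term `γ m`,
while the mean at the upper end is of the size of the mean of `u` over the room, which is at most
`b⁻¹ ‖u‖`. Comparing means of `u` on concentric squares of dyadically growing size costs only a
logarithm of `d`, which `ε^{-β}` absorbs. The second difference is the adjoint of the first up to
sign.
-/

namespace RoomPassage

section TestFunction

variable {X : Type*} [NormedAddCommGroup X] [NormedSpace ℝ X]

/-- A test function on `U`: a smooth real function with compact support contained in `U`. These are
the functions against which weak derivatives are tested. -/
structure IsTestFunction (U : Set X) (φ : X → ℝ) : Prop where
  contDiff : ContDiff ℝ ∞ φ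
  hasCompactSupport : HasCompactSupport φ
  tsupport_subset : tsupport φ ⊆ U

namespace IsTestFunction

variable {U U' : Set X} {φ : X → ℝ}

theorem eq_zero (h : IsTestFunction U φ) {x : X} (hx : x ∉ U) : φ x = 0 :=
  image_eq_zero_of_notMem_tsupport fun hx' => hx (h.tsupport_subset hx')

theorem mono (h : IsTestFunction U φ) (hU : U ⊆ U') : IsTestFunction U' φ :=
  ⟨h.contDiff, h.hasCompactSupport, h.tsupport_subset.trans hU⟩

theorem of_support_subset {K : Set X} (hK : IsCompact K) (hKU : K ⊆ U) (hφ : ContDiff ℝ ∞ φ)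
    (h : Function.support φ ⊆ K) : IsTestFunction U φ :=
  ⟨hφ, HasCompactSupport.of_support_subset_isCompact hK h,
    (closure_minimal h hK.isClosed).trans hKU⟩

theorem fderiv_apply (h : IsTestFunction U φ) (v : X) :
    IsTestFunction U fun x => fderiv ℝ φ x v :=
  ⟨(h.contDiff.fderiv_right le_rfl).clm_apply contDiff_const, h.hasCompactSupport.fderiv_apply ℝ v,
    (tsupport_fderiv_apply_subset ℝ v).trans h.tsupport_subset⟩

theorem const_mul (h : IsTestFunction U φ) (c : ℝ) : IsTestFunction U fun x => c * φ x :=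
  of_support_subset h.hasCompactSupport h.tsupport_subset (contDiff_const.mul h.contDiff)
    fun _ hx => subset_tsupport φ (right_ne_zero_of_mul hx)

theorem sub {ψ : X → ℝ} (h : IsTestFunction U φ) (h' : IsTestFunction U ψ) :
    IsTestFunction U fun x => φ x - ψ x := by
  refine of_support_subset (h.hasCompactSupport.union h'.hasCompactSupport)
    (union_subset h.tsupport_subset h'.tsupport_subset) (h.contDiff.sub h'.contDiff) fun x hx => ?_
  by_contra hn
  rw [mem_union, not_or] at hn
  exact hx (by simp [image_eq_zero_of_notMem_tsupport hn.1, image_eq_zero_of_notMem_tsupport hn.2])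

theorem setIntegral_smul [MeasurableSpace X] {μ : Measure X} {V : Type*} [NormedAddCommGroup V]
    [NormedSpace ℝ V] (h : IsTestFunction U φ) (F : X → V) :
    ∫ x in U, φ x • F x ∂μ = ∫ x, φ x • F x ∂μ :=
  setIntegral_eq_integral_of_forall_compl_eq_zero fun x hx => by rw [h.eq_zero hx, zero_smul]

theorem integrable [MeasurableSpace X] [BorelSpace X] {μ : Measure X}
    [IsFiniteMeasureOnCompacts μ] (h : IsTestFunction U φ) : Integrable φ μ :=
  h.contDiff.continuous.integrable_of_hasCompactSupport h.hasCompactSupport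

theorem integrable_smul [MeasurableSpace X] [BorelSpace X] {μ : Measure X} {V : Type*}
    [NormedAddCommGroup V] [NormedSpace ℝ V] (h : IsTestFunction U φ) {F : X → V}
    (hF : LocallyIntegrableOn F U μ) : Integrable (fun x => φ x • F x) μ := by
  have hφF : IntegrableOn (fun x => φ x • F x) (tsupport φ) μ :=
    (hF.integrableOn_compact_subset h.tsupport_subset h.hasCompactSupport).continuousOn_smul
      h.contDiff.continuous.continuousOn h.hasCompactSupport
  refine (integrableOn_iff_integrable_of_support_subset fun x hx => ?_).1 hφF
  exact subset_tsupport φ (left_ne_zero_of_smul hx)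

end IsTestFunction

theorem IsTestFunction.deriv {U : Set ℝ} {φ : ℝ → ℝ} (h : IsTestFunction U φ) :
    IsTestFunction U (deriv φ) := by
  simpa only [fderiv_apply_one_eq_deriv] using h.fderiv_apply 1

theorem exists_isTestFunction_integral_eq_one [FiniteDimensional ℝ X] [MeasurableSpace X]
    [BorelSpace X] {μ : Measure X} [IsFiniteMeasureOnCompacts μ] [μ.IsOpenPosMeasure] {U : Set X}
    (hU : IsOpen U) (hne : U.Nonempty) : ∃ ψ : X → ℝ, IsTestFunction U ψ ∧ ∫ x, ψ x ∂μ = 1 := by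
  obtain ⟨x₀, hx₀⟩ := hne
  obtain ⟨f, hfs, hfc, hf, hfr, hfx⟩ := exists_contDiff_tsupport_subset (n := ⊤) (hU.mem_nhds hx₀)
  have hpos : 0 < ∫ x, f x ∂μ :=
    hf.continuous.integral_pos_of_hasCompactSupport_nonneg_nonzero hfc
      (fun x => (hfr ⟨x, rfl⟩).1) (x := x₀) (by simp [hfx])
  refine ⟨fun x => (∫ x, f x ∂μ)⁻¹ * f x, IsTestFunction.const_mul ⟨hf, hfc, hfs⟩ _, ?_⟩
  rw [integral_const_mul, inv_mul_cancel₀ hpos.ne']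

end TestFunction

section WeakDerivativeOnTheLine

variable {V : Type*} [NormedAddCommGroup V] [NormedSpace ℝ V] {I : Set ℝ}

theorem exists_Ioo_of_isCompact_subset {K : Set ℝ} (hI : IsOpen I) (hne : I.Nonempty)
    (hK : IsCompact K) (hKI : K ⊆ I) : ∃ a ∈ I, ∃ b ∈ I, a < b ∧ K ⊆ Ioo a b := by
  obtain ⟨x₀, hx₀⟩ := hne
  have hsub : insert x₀ K ⊆ I := insert_subset hx₀ hKI
  obtain ⟨m, hm⟩ := (hK.insert x₀).exists_isLeast (insert_nonempty x₀ K)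
  obtain ⟨M, hM⟩ := (hK.insert x₀).exists_isGreatest (insert_nonempty x₀ K)
  have hleft : ∀ᶠ a in nhdsWithin m (Iio m), a ∈ I :=
    mem_nhdsWithin_of_mem_nhds (hI.mem_nhds (hsub hm.1))
  have hright : ∀ᶠ b in nhdsWithin M (Ioi M), b ∈ I :=
    mem_nhdsWithin_of_mem_nhds (hI.mem_nhds (hsub hM.1))
  obtain ⟨a, haI, ham⟩ := (hleft.and self_mem_nhdsWithin).exists
  obtain ⟨b, hbI, hMb⟩ := (hright.and self_mem_nhdsWithin).exists
  exact ⟨a, haI, b, hbI, ham.trans_le ((hm.2 hM.1).trans hMb.le), fun x hx =>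
    ⟨ham.trans_le (hm.2 (mem_insert_of_mem _ hx)), (hM.2 (mem_insert_of_mem _ hx)).trans_lt hMb⟩⟩

theorem exists_isTestFunction_deriv_eq (hI : IsOpen I) (hord : I.OrdConnected)
    (hne : I.Nonempty) {χ : ℝ → ℝ} (hχ : IsTestFunction I χ) (h0 : ∫ x, χ x = 0) :
    ∃ ξ : ℝ → ℝ, IsTestFunction I ξ ∧ deriv ξ = χ := by
  obtain ⟨a, ha, b, hb, hab, hsub⟩ := exists_Ioo_of_isCompact_subset hI hne
    hχ.hasCompactSupport hχ.tsupport_subset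
  have hχ_zero : ∀ t ∉ Ioo a b, χ t = 0 := fun t ht =>
    image_eq_zero_of_notMem_tsupport fun h => ht (hsub h)
  have hcont := hχ.contDiff.continuous
  have hderiv : ∀ x, HasDerivAt (fun x => ∫ t in a..x, χ t) (χ x) x := fun x =>
    intervalIntegral.integral_hasDerivAt_right (hcont.intervalIntegrable _ _)
      (hcont.stronglyMeasurableAtFilter _ _) hcont.continuousAt
  have hderiv_eq : deriv (fun x => ∫ t in a..x, χ t) = χ := funext fun x => (hderiv x).deriv
  have hzero_of_forall : ∀ {x y}, (∀ t ∈ uIcc x y, t ∉ Ioo a b) → ∫ t in x..y, χ t = 0 :=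
    fun h => intervalIntegral.integral_zero_ae (ae_of_all _ fun t ht =>
      hχ_zero t (h t (uIoc_subset_uIcc ht)))
  have hab0 : ∫ t in a..b, χ t = 0 := by
    rw [intervalIntegral.integral_of_le hab.le, ← h0]
    exact setIntegral_eq_integral_of_forall_compl_eq_zero fun x hx =>
      hχ_zero x fun h => hx (Ioo_subset_Ioc_self h)
  have hsupp : Function.support (fun x => ∫ t in a..x, χ t) ⊆ Icc a b := by
    refine fun x hx => by_contra fun hxab => hx ?_
    rcases lt_or_ge x a with hxa | hax
    · exact hzero_of_forall fun t ht hab' =>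
        absurd (uIcc_of_ge hxa.le ▸ ht).2 (not_le.2 hab'.1)
    · have hbx : b < x := not_le.1 fun hxb => hxab ⟨hax, hxb⟩
      change ∫ t in a..x, χ t = 0
      rw [← intervalIntegral.integral_add_adjacent_intervals (hcont.intervalIntegrable a b)
        (hcont.intervalIntegrable b x), hab0, zero_add]
      exact hzero_of_forall fun t ht hab' =>
        absurd (uIcc_of_le hbx.le ▸ ht).1 (not_le.2 hab'.2)
  refine ⟨_, .of_support_subset isCompact_Icc (hord.out ha hb) ?_ hsupp, hderiv_eq⟩
  exact contDiff_infty_iff_deriv.2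
    ⟨fun x => (hderiv x).differentiableAt, hderiv_eq.symm ▸ hχ.contDiff⟩

/-- `G` is the weak derivative of the function `F` on `I ⊆ ℝ`. Unlike `HasWeakDeriv`, this speaks of
functions rather than elements of `L²`, so that it applies to sections of planar functions. -/
def IsWeakDeriv (I : Set ℝ) (F G : ℝ → V) : Prop :=
  ∀ φ : ℝ → ℝ, IsTestFunction I φ → ∫ x in I, deriv φ x • F x = - ∫ x in I, φ x • G x

theorem IsWeakDeriv.sub {F F' G G' : ℝ → V} (h : IsWeakDeriv I F G) (h' : IsWeakDeriv I F' G')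
    (hF : LocallyIntegrableOn F I) (hF' : LocallyIntegrableOn F' I)
    (hG : LocallyIntegrableOn G I) (hG' : LocallyIntegrableOn G' I) :
    IsWeakDeriv I (F - F') (G - G') := by
  intro φ hφ
  simp only [Pi.sub_apply, smul_sub]
  rw [integral_sub (hφ.deriv.integrable_smul hF).integrableOn
      (hφ.deriv.integrable_smul hF').integrableOn, integral_sub (hφ.integrable_smul hG).integrableOn
      (hφ.integrable_smul hG').integrableOn, h φ hφ, h' φ hφ]
  abel

theorem IsWeakDeriv.ae_eq_const [CompleteSpace V] (hI : IsOpen I) (hord : I.OrdConnected)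
    {F : ℝ → V} (hF : LocallyIntegrableOn F I) (h : IsWeakDeriv I F 0) :
    ∃ c : V, ∀ᵐ x ∂(volume.restrict I), F x = c := by
  rcases I.eq_empty_or_nonempty with rfl | hne
  · exact ⟨0, by simp⟩
  obtain ⟨ψ, hψ, hψ1⟩ := exists_isTestFunction_integral_eq_one (μ := volume) hI hne
  have hFc : LocallyIntegrableOn (fun x => F x - ∫ x, ψ x • F x) I :=
    hF.sub ((locallyIntegrable_const _).locallyIntegrableOn _)
  have horth : ∀ χ : ℝ → ℝ, IsTestFunction I χ → ∫ x, χ x • (F x - ∫ x, ψ x • F x) = 0 := by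
    intro χ hχ
    obtain ⟨ξ, hξ, hξd⟩ := exists_isTestFunction_deriv_eq hI hord hne
      (hχ.sub (hψ.const_mul (∫ t, χ t)))
      (by rw [integral_sub hχ.integrable (hψ.integrable.const_mul _), integral_const_mul, hψ1,
        mul_one, sub_self])
    have hξF := h ξ hξ
    rw [hξ.deriv.setIntegral_smul, hξd] at hξF
    simp only [sub_smul, mul_smul, Pi.zero_apply, smul_zero, integral_zero, neg_zero] at hξF
    rw [integral_sub (hχ.integrable_smul hF) ((hψ.integrable_smul hF).fun_smul _),
      integral_smul] at hξF
    simp only [smul_sub]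
    rwa [integral_sub (hχ.integrable_smul hF) (hχ.integrable.smul_const _), integral_smul_const]
  refine ⟨∫ x, ψ x • F x, (ae_restrict_iff' hI.measurableSet).2 ?_⟩
  filter_upwards [hI.ae_eq_zero_of_integral_contDiff_smul_eq_zero hFc
    fun χ hχ hχc hχs => horth χ ⟨hχ, hχc, hχs⟩] with x hx hxI
  exact sub_eq_zero.1 (hx hxI)

omit [NormedSpace ℝ V] in
theorem intervalIntegrable_of_locallyIntegrableOn (hord : I.OrdConnected) {G : ℝ → V}
    (hG : LocallyIntegrableOn G I) {x y : ℝ} (hx : x ∈ I) (hy : y ∈ I) :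
    IntervalIntegrable G volume x y :=
  (hG.integrableOn_compact_subset (hord.uIcc_subset hx hy) isCompact_uIcc).intervalIntegrable

theorem integral_smul_primitive_eq [CompleteSpace V] {φ : ℝ → ℝ} {G : ℝ → V} {a b : ℝ} (hab : a ≤ b)
    (hφ : IntervalIntegrable φ volume a b) (hG : IntervalIntegrable G volume a b) :
    ∫ x in a..b, φ x • ∫ t in a..x, G t = ∫ t in a..b, (∫ x in t..b, φ x) • G t := by
  let k : ℝ × ℝ → V := {p : ℝ × ℝ | p.2 ≤ p.1}.indicator fun p => φ p.1 • G p.2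
  have hk : Integrable k ((volume.restrict (Ioc a b)).prod (volume.restrict (Ioc a b))) :=
    (hφ.1.smul_prod hG.1).indicator (measurableSet_le measurable_snd measurable_fst)
  have hleft : ∀ x ∈ Ioc a b, φ x • ∫ t in a..x, G t = ∫ t in Ioc a b, k (x, t) := by
    intro x hx
    change _ = ∫ t in Ioc a b, (Iic x).indicator (fun t => φ x • G t) t
    rw [setIntegral_indicator measurableSet_Iic, Ioc_inter_Iic, min_eq_right hx.2, integral_smul,
      intervalIntegral.integral_of_le hx.1.le]
  have hright : ∀ t ∈ Ioc a b, ∫ x in Ioc a b, k (x, t) = (∫ x in t..b, φ x) • G t := by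
    intro t ht
    change ∫ x in Ioc a b, (Ici t).indicator (fun x => φ x • G t) x = _
    rw [setIntegral_indicator measurableSet_Ici, intervalIntegral.integral_of_le ht.2,
      ← integral_smul_const, ← integral_Icc_eq_integral_Ioc]
    congr 2
    ext x
    exact ⟨fun hx => ⟨hx.2, hx.1.2⟩, fun hx => ⟨⟨ht.1.trans_le hx.1, hx.2⟩, hx.1⟩⟩
  rw [intervalIntegral.integral_of_le hab, intervalIntegral.integral_of_le hab,
    setIntegral_congr_fun measurableSet_Ioc hleft,
    integral_integral_swap (f := fun x t => k (x, t)) hk,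
    setIntegral_congr_fun measurableSet_Ioc hright]

theorem isWeakDeriv_primitive [CompleteSpace V] (hI : IsOpen I) (hord : I.OrdConnected) {G : ℝ → V}
    (hG : LocallyIntegrableOn G I) {x₀ : ℝ} (hx₀ : x₀ ∈ I) :
    IsWeakDeriv I (fun x => ∫ t in x₀..x, G t) G := by
  intro φ hφ
  obtain ⟨a, ha, b, hb, hab, hsub⟩ := exists_Ioo_of_isCompact_subset hI ⟨x₀, hx₀⟩
    hφ.hasCompactSupport hφ.tsupport_subset
  have hφab : IsTestFunction (Ioo a b) φ := ⟨hφ.contDiff, hφ.hasCompactSupport, hsub⟩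
  have hφd : Continuous (deriv φ) := hφ.deriv.contDiff.continuous
  have hGI : ∀ x ∈ I, ∀ y ∈ I, IntervalIntegrable G volume x y := fun x hx y hy =>
    intervalIntegrable_of_locallyIntegrableOn hord hG hx hy
  have hftc : ∀ t, ∫ x in t..b, deriv φ x = - φ t := fun t => by
    rw [intervalIntegral.integral_deriv_eq_sub
      (fun x _ => hφ.contDiff.differentiable (by simp) x) (hφd.intervalIntegrable _ _),
      hφab.eq_zero (by simp), zero_sub]
  have hIab : ∀ {ψ : ℝ → ℝ}, IsTestFunction (Ioo a b) ψ → ∀ F : ℝ → V,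
      ∫ x in I, ψ x • F x = ∫ x in a..b, ψ x • F x := fun hψ F => by
    rw [(hψ.mono (Ioo_subset_Icc_self.trans (hord.out ha hb))).setIntegral_smul,
      intervalIntegral.integral_of_le hab.le, (hψ.mono Ioo_subset_Ioc_self).setIntegral_smul]
  have hsplit : EqOn (fun x => deriv φ x • ∫ t in x₀..x, G t)
      (fun x => deriv φ x • (∫ t in x₀..a, G t) + deriv φ x • ∫ t in a..x, G t) (uIcc a b) := by
    intro x hx
    have hxI : x ∈ I := hord.uIcc_subset ha hb hx
    simp only
    rw [← intervalIntegral.integral_add_adjacent_intervals (hGI x₀ hx₀ a ha) (hGI a ha x hxI),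
      smul_add]
  have hcont : ContinuousOn (fun x => ∫ t in a..x, G t) (uIcc a b) :=
    intervalIntegral.continuousOn_primitive_interval' (hGI a ha b hb) left_mem_uIcc
  have hadd := intervalIntegral.integral_add (μ := volume) (a := a) (b := b)
    (f := fun x => deriv φ x • ∫ t in x₀..a, G t) (g := fun x => deriv φ x • ∫ t in a..x, G t)
    ((hφd.smul continuous_const).intervalIntegrable _ _)
    (hφd.continuousOn.smul hcont).intervalIntegrable
  rw [hIab hφab.deriv, hIab hφab, intervalIntegral.integral_congr hsplit, hadd,
    intervalIntegral.integral_smul_const, hftc, hφab.eq_zero (by simp), neg_zero, zero_smul,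
    zero_add, integral_smul_primitive_eq hab.le (hφd.intervalIntegrable _ _) (hGI a ha b hb)]
  simp only [hftc, neg_smul, intervalIntegral.integral_neg]

theorem continuousOn_primitive (hI : IsOpen I) (hord : I.OrdConnected) {G : ℝ → V}
    (hG : LocallyIntegrableOn G I) {x₀ : ℝ} (hx₀ : x₀ ∈ I) :
    ContinuousOn (fun x => ∫ t in x₀..x, G t) I := by
  intro x hx
  obtain ⟨a, ha, b, hb, hab, hsub⟩ := exists_Ioo_of_isCompact_subset (K := {x₀, x}) hI ⟨x₀, hx₀⟩
    (isCompact_singleton.insert x₀) (insert_subset hx₀ (singleton_subset_iff.2 hx))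
  have hx₀' : x₀ ∈ Ioo a b := hsub (by simp)
  have hx' : x ∈ Ioo a b := hsub (by simp)
  have hcont : ContinuousOn (fun x => ∫ t in x₀..x, G t) (Icc a b) := by
    rw [← uIcc_of_le hab.le]
    exact intervalIntegral.continuousOn_primitive_interval'
      (intervalIntegrable_of_locallyIntegrableOn hord hG ha hb)
      (uIcc_of_le hab.le ▸ Ioo_subset_Icc_self hx₀')
  exact (hcont.continuousAt (Icc_mem_nhds hx'.1 hx'.2)).continuousWithinAt

/-- `f` is a primitive of `G` on `I`: the fundamental theorem of calculus holds for the pair. For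
locally integrable `G` this makes `f` the continuous representative of an `H¹` function with
weak derivative `G`. -/
def IsPrimitiveOn (I : Set ℝ) (f G : ℝ → V) : Prop :=
  ∀ x ∈ I, ∀ y ∈ I, f y - f x = ∫ t in x..y, G t

theorem IsWeakDeriv.exists_isPrimitiveOn [CompleteSpace V] (hI : IsOpen I) (hord : I.OrdConnected)
    {F G : ℝ → V} (hF : LocallyIntegrableOn F I) (hG : LocallyIntegrableOn G I)
    (h : IsWeakDeriv I F G) :
    ∃ f : ℝ → V, ContinuousOn f I ∧ F =ᵐ[volume.restrict I] f ∧ IsPrimitiveOn I f G := by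
  rcases I.eq_empty_or_nonempty with rfl | ⟨x₀, hx₀⟩
  · exact ⟨F, by simp, by simp, by simp [IsPrimitiveOn]⟩
  have hcont := continuousOn_primitive hI hord hG hx₀
  have hP : LocallyIntegrableOn (fun x => ∫ t in x₀..x, G t) I :=
    hcont.locallyIntegrableOn hI.measurableSet
  have hdiff := h.sub (isWeakDeriv_primitive hI hord hG hx₀) hF hP hG hG
  rw [sub_self] at hdiff
  obtain ⟨c, hc⟩ := hdiff.ae_eq_const hI hord (hF.sub hP)
  refine ⟨fun x => c + ∫ t in x₀..x, G t, continuousOn_const.add hcont, ?_, fun x hx y hy => ?_⟩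
  · filter_upwards [hc] with x hx
    rw [← hx, Pi.sub_apply, sub_add_cancel]
  · rw [add_sub_add_left_eq_sub, intervalIntegral.integral_interval_sub_left
      (intervalIntegrable_of_locallyIntegrableOn hord hG hx₀ hy)
      (intervalIntegrable_of_locallyIntegrableOn hord hG hx₀ hx)]

end WeakDerivativeOnTheLine

section LineEstimates

variable {V : Type*} [NormedAddCommGroup V]

theorem integral_norm_le_sqrt_mul {X : Type*} [MeasurableSpace X] {μ : Measure X}
    [IsFiniteMeasure μ] {F : X → V} (hF : MemLp F 2 μ) :
    ∫ x, ‖F x‖ ∂μ ≤ √(μ.real univ) * (eLpNorm F 2 μ).toReal := by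
  have hle := eLpNorm_le_eLpNorm_mul_rpow_measure_univ (p := 1) (q := 2) (by norm_num) hF.1
  have hexp : 1 / (1 : ℝ≥0∞).toReal - 1 / (2 : ℝ≥0∞).toReal = 1 / 2 := by norm_num
  rw [hexp, eLpNorm_one_eq_lintegral_enorm,
    ← ofReal_integral_norm_eq_lintegral_enorm (hF.integrable one_le_two)] at hle
  have hfin : eLpNorm F 2 μ * μ univ ^ (1 / 2 : ℝ) ≠ ⊤ := ENNReal.mul_ne_top hF.eLpNorm_ne_top
    (ENNReal.rpow_ne_top_of_nonneg (by norm_num) (measure_ne_top μ univ))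
  rw [Real.sqrt_eq_rpow, measureReal_def, ENNReal.toReal_rpow, mul_comm, ← ENNReal.toReal_mul]
  exact (ENNReal.ofReal_le_iff_le_toReal hfin).1 hle

theorem locallyIntegrableOn_of_memLp {X : Type*} [TopologicalSpace X] [MeasurableSpace X]
    [OpensMeasurableSpace X] {μ : Measure X} [IsLocallyFiniteMeasure μ] {I : Set X} {p : ℝ≥0∞}
    {F : X → V} (hp : 1 ≤ p) (hF : MemLp F p (μ.restrict I)) : LocallyIntegrableOn F I μ :=
  locallyIntegrableOn_of_locallyIntegrable_restrict (hF.locallyIntegrable hp)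

variable [NormedSpace ℝ V] {I : Set ℝ} {F f G : ℝ → V}

theorem IsPrimitiveOn.norm_sub_le (h : IsPrimitiveOn I f G) (hord : I.OrdConnected)
    (hfin : volume I ≠ ⊤) (hG : MemLp G 2 (volume.restrict I)) {x y : ℝ} (hx : x ∈ I)
    (hy : y ∈ I) :
    ‖f y - f x‖ ≤ √(volume.real I) * (eLpNorm G 2 (volume.restrict I)).toReal := by
  have : IsFiniteMeasure (volume.restrict I) := isFiniteMeasure_restrict.2 hfin
  calc
    ‖f y - f x‖ = ‖∫ t in x..y, G t‖ := by rw [h x hx y hy]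
    _ ≤ ∫ t in uIoc x y, ‖G t‖ := intervalIntegral.norm_integral_le_integral_norm_uIoc
    _ ≤ ∫ t in I, ‖G t‖ :=
      setIntegral_mono_set (hG.integrable one_le_two).norm (ae_of_all _ fun _ => norm_nonneg _)
        (uIoc_subset_uIcc.trans (hord.uIcc_subset hx hy)).eventuallyLE
    _ ≤ √(volume.real I) * (eLpNorm G 2 (volume.restrict I)).toReal := by
      simpa only [measureReal_restrict_apply_univ] using integral_norm_le_sqrt_mul hG

theorem IsPrimitiveOn.norm_setAverage_sub_le [CompleteSpace V] (h : IsPrimitiveOn I f G)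
    (hord : I.OrdConnected) (hfin : volume I ≠ ⊤) (hF : MemLp F 2 (volume.restrict I))
    (hG : MemLp G 2 (volume.restrict I)) (hFf : F =ᵐ[volume.restrict I] f) {y : ℝ} (hy : y ∈ I)
    {s : Set ℝ} (hs : MeasurableSet s) (hsI : s ⊆ I) (h0 : volume s ≠ 0) :
    ‖(⨍ x in s, F x) - f y‖ ≤ √(volume.real I) * (eLpNorm G 2 (volume.restrict I)).toReal := by
  have : IsFiniteMeasure (volume.restrict I) := isFiniteMeasure_restrict.2 hfin
  rw [← mem_closedBall_iff_norm]
  refine (convex_closedBall _ _).set_average_mem Metric.isClosed_closedBall h0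
    (measure_ne_top_of_subset hsI hfin) ?_ (IntegrableOn.mono_set (hF.integrable one_le_two) hsI)
  filter_upwards [ae_restrict_of_ae_restrict_of_subset hsI hFf, ae_restrict_mem hs] with x hx hxs
  rw [hx, mem_closedBall_iff_norm]
  exact h.norm_sub_le hord hfin hG hy (hsI hxs)

end LineEstimates

section Sections

theorem IsTestFunction.prodMul {X Y : Type*} [NormedAddCommGroup X] [NormedSpace ℝ X]
    [NormedAddCommGroup Y] [NormedSpace ℝ Y] {U : Set X} {W : Set Y} {φ : X → ℝ} {ψ : Y → ℝ}
    (hφ : IsTestFunction U φ) (hψ : IsTestFunction W ψ) :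
    IsTestFunction (U ×ˢ W) fun p : X × Y => φ p.1 * ψ p.2 :=
  .of_support_subset (hφ.hasCompactSupport.prod hψ.hasCompactSupport)
    (prod_mono hφ.tsupport_subset hψ.tsupport_subset)
    ((hφ.contDiff.comp contDiff_fst).mul (hψ.contDiff.comp contDiff_snd)) fun _ hp =>
      ⟨subset_tsupport _ (left_ne_zero_of_mul hp), subset_tsupport _ (right_ne_zero_of_mul hp)⟩

theorem hasFDerivAt_prodMul {φ ψ : ℝ → ℝ} {p : ℝ × ℝ} (hφ : DifferentiableAt ℝ φ p.1)
    (hψ : DifferentiableAt ℝ ψ p.2) :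
    HasFDerivAt (fun p : ℝ × ℝ => φ p.1 * ψ p.2)
      (φ p.1 • (deriv ψ p.2 • ContinuousLinearMap.snd ℝ ℝ ℝ) +
        ψ p.2 • (deriv φ p.1 • ContinuousLinearMap.fst ℝ ℝ ℝ)) p :=
  (hφ.hasDerivAt.comp_hasFDerivAt p hasFDerivAt_fst).mul
    (hψ.hasDerivAt.comp_hasFDerivAt p hasFDerivAt_snd)

theorem fderiv_prodMul_fst {φ ψ : ℝ → ℝ} {p : ℝ × ℝ} (hφ : DifferentiableAt ℝ φ p.1)
    (hψ : DifferentiableAt ℝ ψ p.2) :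
    fderiv ℝ (fun p : ℝ × ℝ => φ p.1 * ψ p.2) p (1, 0) = deriv φ p.1 * ψ p.2 := by
  rw [(hasFDerivAt_prodMul hφ hψ).fderiv]
  simp [mul_comm]

theorem fderiv_prodMul_snd {φ ψ : ℝ → ℝ} {p : ℝ × ℝ} (hφ : DifferentiableAt ℝ φ p.1)
    (hψ : DifferentiableAt ℝ ψ p.2) :
    fderiv ℝ (fun p : ℝ × ℝ => φ p.1 * ψ p.2) p (0, 1) = φ p.1 * deriv ψ p.2 := by
  rw [(hasFDerivAt_prodMul hφ hψ).fderiv]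
  simp

theorem IsTestFunction.differentiableAt {X : Type*} [NormedAddCommGroup X] [NormedSpace ℝ X]
    {U : Set X} {φ : X → ℝ} (hφ : IsTestFunction U φ) (x : X) : DifferentiableAt ℝ φ x :=
  hφ.contDiff.differentiable (by simp) x

theorem integrable_testFunction_fst_smul {U I J : Set ℝ} [IsFiniteMeasure (volume.restrict J)]
    {φ : ℝ → ℝ} (hφ : IsTestFunction U φ) {w : ℝ × ℝ → ℂ}
    (hw : MemLp w 2 ((volume.restrict I).prod (volume.restrict J))) :
    Integrable (fun p : ℝ × ℝ => φ p.1 • w p) ((volume.restrict I).prod (volume.restrict J)) := by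
  have hφ2 : MemLp φ 2 (volume.restrict I) :=
    (hφ.contDiff.continuous.memLp_of_hasCompactSupport hφ.hasCompactSupport).mono_measure
      Measure.restrict_le_self
  exact memLp_one_iff_integrable.1 (MemLp.smul hw (hφ2.comp_fst (volume.restrict J)))

/-- For fixed `φ` the function `y ↦ ∫ (φ' u(·, y) + φ g(·, y))` is orthogonal to every test function
on `J`, hence vanishes almost everywhere. -/
theorem isWeakDeriv_integral_section {I J : Set ℝ} (hJ : IsOpen J)
    [IsFiniteMeasure (volume.restrict J)] {u g : ℝ × ℝ → ℂ}
    (hu : MemLp u 2 ((volume.restrict I).prod (volume.restrict J)))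
    (hg : MemLp g 2 ((volume.restrict I).prod (volume.restrict J)))
    (h : ∀ φ ψ : ℝ → ℝ, IsTestFunction I φ → IsTestFunction J ψ →
      ∫ p, (deriv φ p.1 * ψ p.2) • u p ∂((volume.restrict I).prod (volume.restrict J)) =
        - ∫ p, (φ p.1 * ψ p.2) • g p ∂((volume.restrict I).prod (volume.restrict J))) :
    IsWeakDeriv I (fun x => ∫ y in J, u (x, y)) (fun x => ∫ y in J, g (x, y)) := by
  intro φ hφ
  have hφu := integrable_testFunction_fst_smul hφ.deriv hu
  have hφg := integrable_testFunction_fst_smul hφ hg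
  let w : ℝ × ℝ → ℂ := fun p => deriv φ p.1 • u p + φ p.1 • g p
  have hw : Integrable w ((volume.restrict I).prod (volume.restrict J)) := hφu.add hφg
  have horth : ∀ ψ : ℝ → ℝ, IsTestFunction J ψ → ∫ y, ψ y • ∫ x in I, w (x, y) = 0 := by
    intro ψ hψ
    have hψb : ∃ C, ∀ y, ‖ψ y‖ ≤ C :=
      hψ.hasCompactSupport.exists_bound_of_continuous hψ.contDiff.continuous
    obtain ⟨C, hC⟩ := hψb
    have hψm : ∀ μ : Measure (ℝ × ℝ), AEStronglyMeasurable (fun p : ℝ × ℝ => ψ p.2) μ := fun μ =>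
      (hψ.contDiff.continuous.comp continuous_snd).aestronglyMeasurable
    have hmul : ∀ {v : ℝ × ℝ → ℂ}, Integrable v ((volume.restrict I).prod (volume.restrict J)) →
        Integrable (fun p => ψ p.2 • v p) ((volume.restrict I).prod (volume.restrict J)) :=
      fun hv => hv.bdd_smul C (hψm _) (ae_of_all _ fun p => hC p.2)
    have hsum := h φ ψ hφ hψ
    simp only [mul_comm _ (ψ _), mul_smul] at hsum
    rw [← hψ.setIntegral_smul]
    simp only [← integral_smul]
    rw [← integral_prod_symm (fun p => ψ p.2 • w p) (hmul hw)]
    simp only [w, smul_add]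
    rw [integral_add (hmul hφu) (hmul hφg), hsum, neg_add_cancel]
  have hzero : ∀ᵐ y ∂(volume.restrict J), ∫ x in I, w (x, y) = 0 :=
    (ae_restrict_iff' hJ.measurableSet).2 (hJ.ae_eq_zero_of_integral_contDiff_smul_eq_zero
      (IntegrableOn.locallyIntegrableOn hw.integral_prod_right)
      fun ψ hψ hψc hψs => horth ψ ⟨hψ, hψc, hψs⟩)
  have hsum : ∫ p, w p ∂((volume.restrict I).prod (volume.restrict J)) = 0 := by
    rw [integral_prod_symm w hw, integral_congr_ae hzero, integral_zero]
  rw [integral_add hφu hφg, integral_prod _ hφu, integral_prod _ hφg] at hsum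
  simpa only [integral_smul] using eq_neg_of_add_eq_zero_left hsum

variable {Ω : Set (ℝ × ℝ)} {u g : L2 Ω} {I J : Set ℝ}

theorem memLp_prod_of_subset (hIJ : I ×ˢ J ⊆ Ω) (u : L2 Ω) :
    MemLp u 2 ((volume.restrict I).prod (volume.restrict J)) := by
  rw [Measure.prod_restrict, ← Measure.volume_eq_prod]
  exact (Lp.memLp u).mono_measure (Measure.restrict_mono hIJ le_rfl)

theorem integrable_prod_of_subset [IsFiniteMeasure (volume.restrict I)]
    [IsFiniteMeasure (volume.restrict J)] (hIJ : I ×ˢ J ⊆ Ω) (u : L2 Ω) :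
    Integrable u ((volume.restrict I).prod (volume.restrict J)) :=
  (memLp_prod_of_subset hIJ u).integrable one_le_two

theorem memLp_swap_of_subset (hIJ : I ×ˢ J ⊆ Ω) (u : L2 Ω) :
    MemLp (fun p => u p.swap) 2 ((volume.restrict J).prod (volume.restrict I)) :=
  (memLp_prod_of_subset hIJ u).comp_measurePreserving Measure.measurePreserving_swap

theorem IsTestFunction.setIntegral_smul_eq_prod (hIJ : I ×ˢ J ⊆ Ω) {Φ : ℝ × ℝ → ℝ}
    (hΦ : IsTestFunction (I ×ˢ J) Φ) (u : ℝ × ℝ → ℂ) :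
    ∫ p in Ω, Φ p • u p = ∫ p, Φ p • u p ∂((volume.restrict I).prod (volume.restrict J)) := by
  rw [(hΦ.mono hIJ).setIntegral_smul, Measure.prod_restrict, ← Measure.volume_eq_prod,
    hΦ.setIntegral_smul]

theorem HasWeakDeriv.isWeakDeriv_integral_snd (h : HasWeakDeriv Ω (1, 0) u g) (hJ : IsOpen J)
    [IsFiniteMeasure (volume.restrict J)] (hIJ : I ×ˢ J ⊆ Ω) :
    IsWeakDeriv I (fun x => ∫ y in J, u (x, y)) (fun x => ∫ y in J, g (x, y)) := by
  refine isWeakDeriv_integral_section hJ (memLp_prod_of_subset hIJ u)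
    (memLp_prod_of_subset hIJ g) fun φ ψ hφ hψ => ?_
  have hΦ := (hφ.prodMul hψ).mono hIJ
  have hweak := h _ hΦ.contDiff hΦ.hasCompactSupport hΦ.tsupport_subset
  simp only [fderiv_prodMul_fst (hφ.differentiableAt _) (hψ.differentiableAt _)] at hweak
  rwa [(hφ.deriv.prodMul hψ).setIntegral_smul_eq_prod hIJ,
    (hφ.prodMul hψ).setIntegral_smul_eq_prod hIJ] at hweak

theorem HasWeakDeriv.isWeakDeriv_integral_fst (h : HasWeakDeriv Ω (0, 1) u g) (hI : IsOpen I)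
    [IsFiniteMeasure (volume.restrict I)] (hIJ : I ×ˢ J ⊆ Ω) :
    IsWeakDeriv J (fun y => ∫ x in I, u (x, y)) (fun y => ∫ x in I, g (x, y)) := by
  refine isWeakDeriv_integral_section hI (memLp_swap_of_subset hIJ u)
    (memLp_swap_of_subset hIJ g) fun φ ψ hφ hψ => ?_
  have hΦ := (hψ.prodMul hφ).mono hIJ
  have hweak := h _ hΦ.contDiff hΦ.hasCompactSupport hΦ.tsupport_subset
  simp only [fderiv_prodMul_snd (hψ.differentiableAt _) (hφ.differentiableAt _)] at hweak
  rw [(hψ.prodMul hφ.deriv).setIntegral_smul_eq_prod hIJ,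
    (hψ.prodMul hφ).setIntegral_smul_eq_prod hIJ, ← integral_prod_swap,
    ← integral_prod_swap (fun p : ℝ × ℝ => (ψ p.1 * φ p.2) • g p)] at hweak
  simpa only [Prod.fst_swap, Prod.snd_swap, mul_comm (ψ _)] using hweak

theorem memLp_integral_section {μ ν : Measure ℝ} [SFinite μ] [IsFiniteMeasure ν] {w : ℝ × ℝ → ℂ}
    (hw : MemLp w 2 (μ.prod ν)) : MemLp (fun x => ∫ y, w (x, y) ∂ν) 2 μ :=
  ⟨hw.1.integral_prod_right', (eLpNorm_section_integral_le hw.1).trans_lt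
    (ENNReal.mul_lt_top (ENNReal.rpow_lt_top_of_nonneg (by norm_num) (measure_ne_top _ _)) hw.2)⟩

theorem toReal_eLpNorm_integral_section_le {μ ν : Measure ℝ} [SFinite μ] [IsFiniteMeasure ν]
    {w : ℝ × ℝ → ℂ} (hw : MemLp w 2 (μ.prod ν)) :
    (eLpNorm (fun x => ∫ y, w (x, y) ∂ν) 2 μ).toReal ≤
      √(ν.real univ) * (eLpNorm w 2 (μ.prod ν)).toReal := by
  rw [Real.sqrt_eq_rpow, measureReal_def, ENNReal.toReal_rpow, ← ENNReal.toReal_mul]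
  exact ENNReal.toReal_mono (ENNReal.mul_ne_top
    (ENNReal.rpow_ne_top_of_nonneg (by norm_num) (measure_ne_top _ _)) hw.eLpNorm_ne_top)
    (eLpNorm_section_integral_le hw.1)

theorem toReal_eLpNorm_restrict_le {X : Type*} [MeasureSpace X] {A B : Set X} {w : X → ℂ}
    (hw : MemLp w 2 (volume.restrict B)) (hAB : A ⊆ B) :
    (eLpNorm w 2 (volume.restrict A)).toReal ≤ (eLpNorm w 2 (volume.restrict B)).toReal :=
  ENNReal.toReal_mono hw.eLpNorm_ne_top
    (eLpNorm_mono_measure _ (Measure.restrict_mono hAB le_rfl))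

theorem toReal_eLpNorm_prod_le (hIJ : I ×ˢ J ⊆ Ω) (g : L2 Ω) :
    (eLpNorm g 2 ((volume.restrict I).prod (volume.restrict J))).toReal ≤ ‖g‖ := by
  rw [Measure.prod_restrict, ← Measure.volume_eq_prod, Lp.norm_def]
  exact toReal_eLpNorm_restrict_le (Lp.memLp g) hIJ

theorem toReal_eLpNorm_integral_snd_le [IsFiniteMeasure (volume.restrict J)] (hIJ : I ×ˢ J ⊆ Ω)
    (g : L2 Ω) :
    (eLpNorm (fun x => ∫ y in J, g (x, y)) 2 (volume.restrict I)).toReal ≤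
      √(volume.real J) * ‖g‖ := by
  have h := toReal_eLpNorm_integral_section_le (memLp_prod_of_subset hIJ g)
  rw [measureReal_restrict_apply_univ] at h
  exact h.trans (mul_le_mul_of_nonneg_left (toReal_eLpNorm_prod_le hIJ g) (Real.sqrt_nonneg _))

theorem toReal_eLpNorm_integral_fst_le [IsFiniteMeasure (volume.restrict I)] (hIJ : I ×ˢ J ⊆ Ω)
    (g : L2 Ω) :
    (eLpNorm (fun y => ∫ x in I, g (x, y)) 2 (volume.restrict J)).toReal ≤
      √(volume.real I) * ‖g‖ := by
  have h := toReal_eLpNorm_integral_section_le (memLp_swap_of_subset hIJ g)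
  have hswap := eLpNorm_comp_measurePreserving (p := 2) (memLp_prod_of_subset hIJ g).1
    (Measure.measurePreserving_swap (μ := volume.restrict J) (ν := volume.restrict I))
  rw [measureReal_restrict_apply_univ] at h
  refine h.trans (mul_le_mul_of_nonneg_left ?_ (Real.sqrt_nonneg _))
  exact (congrArg ENNReal.toReal hswap).trans_le (toReal_eLpNorm_prod_le hIJ g)

end Sections

section Averages

theorem norm_setAverage_le {X V : Type*} [NormedAddCommGroup V] [NormedSpace ℝ V]
    [MeasurableSpace X] {μ : Measure X} {s : Set X} [IsFiniteMeasure (μ.restrict s)] {F : X → V}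
    (hF : MemLp F 2 (μ.restrict s)) :
    ‖⨍ x in s, F x ∂μ‖ ≤ (√(μ.real s))⁻¹ * (eLpNorm F 2 (μ.restrict s)).toReal := by
  have hint := integral_norm_le_sqrt_mul hF
  rw [measureReal_restrict_apply_univ] at hint
  rw [setAverage_eq, norm_smul, norm_inv, Real.norm_of_nonneg measureReal_nonneg]
  calc
    (μ.real s)⁻¹ * ‖∫ x in s, F x ∂μ‖
      ≤ (μ.real s)⁻¹ * (√(μ.real s) * (eLpNorm F 2 (μ.restrict s)).toReal) := by
        gcongr
        exact (norm_integral_le_integral_norm _).trans hint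
    _ = (√(μ.real s))⁻¹ * (eLpNorm F 2 (μ.restrict s)).toReal := by
        rw [← mul_assoc, inv_mul_eq_div, Real.sqrt_div_self]

variable {I J s : Set ℝ} [IsFiniteMeasure (volume.restrict I)] [IsFiniteMeasure (volume.restrict J)]

omit [IsFiniteMeasure (volume.restrict I)] [IsFiniteMeasure (volume.restrict J)] in
theorem setIntegral_prod_snd {u : ℝ × ℝ → ℂ}
    (hu : Integrable u ((volume.restrict I).prod (volume.restrict J))) :
    ∫ p in I ×ˢ J, u p = ∫ y in J, ∫ x in I, u (x, y) := by
  rw [Measure.volume_eq_prod, ← Measure.prod_restrict, integral_prod_symm _ hu]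

omit [IsFiniteMeasure (volume.restrict I)] [IsFiniteMeasure (volume.restrict J)] in
theorem setAverage_prod_fst {u : ℝ × ℝ → ℂ}
    (hu : Integrable u ((volume.restrict I).prod (volume.restrict J))) :
    ⨍ p in I ×ˢ J, u p = (volume.real J)⁻¹ • ⨍ x in I, ∫ y in J, u (x, y) := by
  rw [setAverage_eq, setAverage_eq, Measure.volume_eq_prod, measureReal_prod_prod,
    ← Measure.prod_restrict, integral_prod _ hu, mul_inv_rev, smul_smul]

omit [IsFiniteMeasure (volume.restrict I)] [IsFiniteMeasure (volume.restrict J)] in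
theorem setAverage_prod_snd {u : ℝ × ℝ → ℂ}
    (hu : Integrable u ((volume.restrict I).prod (volume.restrict J))) :
    ⨍ p in I ×ˢ J, u p = (volume.real I)⁻¹ • ⨍ y in J, ∫ x in I, u (x, y) := by
  rw [setAverage_eq, setAverage_eq, setIntegral_prod_snd hu, Measure.volume_eq_prod,
    measureReal_prod_prod, mul_inv, smul_smul]

theorem inv_mul_sqrt_mul_sqrt (x N : ℝ) {y : ℝ} (hy : 0 ≤ y) :
    y⁻¹ * (√x * (√y * N)) = √(x / y) * N := by
  rw [Real.sqrt_div' x hy, div_eq_mul_inv, ← Real.sqrt_div_self (x := y)]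
  ring

variable {Ω : Set (ℝ × ℝ)} {u g : L2 Ω} {f : ℝ → ℂ}

theorem norm_setAverage_prod_sub_fst_le (hIJ : I ×ˢ J ⊆ Ω) (hord : I.OrdConnected)
    (hf : IsPrimitiveOn I f fun x => ∫ y in J, g (x, y))
    (huf : (fun x => ∫ y in J, u (x, y)) =ᵐ[volume.restrict I] f) {x : ℝ} (hx : x ∈ I)
    (hs : MeasurableSet s) (hsI : s ⊆ I) (h0 : volume s ≠ 0) :
    ‖(⨍ p in s ×ˢ J, u p) - (volume.real J)⁻¹ • f x‖ ≤
      √(volume.real I / volume.real J) * ‖g‖ := by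
  have : IsFiniteMeasure (volume.restrict s) :=
    isFiniteMeasure_of_le _ (Measure.restrict_mono hsI le_rfl)
  have hline := hf.norm_setAverage_sub_le hord (isFiniteMeasure_restrict.1 inferInstance)
    (memLp_integral_section (memLp_prod_of_subset hIJ u))
    (memLp_integral_section (memLp_prod_of_subset hIJ g)) huf hx hs hsI h0
  rw [setAverage_prod_fst (integrable_prod_of_subset ((prod_mono hsI le_rfl).trans hIJ) u),
    ← smul_sub, norm_smul, norm_inv, Real.norm_of_nonneg measureReal_nonneg,
    ← inv_mul_sqrt_mul_sqrt _ _ measureReal_nonneg]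
  gcongr
  exact hline.trans (mul_le_mul_of_nonneg_left (toReal_eLpNorm_integral_snd_le hIJ g)
    (Real.sqrt_nonneg _))

theorem norm_setAverage_prod_sub_snd_le (hIJ : I ×ˢ J ⊆ Ω) (hord : J.OrdConnected)
    (hf : IsPrimitiveOn J f fun y => ∫ x in I, g (x, y))
    (huf : (fun y => ∫ x in I, u (x, y)) =ᵐ[volume.restrict J] f) {y : ℝ} (hy : y ∈ J)
    (hs : MeasurableSet s) (hsJ : s ⊆ J) (h0 : volume s ≠ 0) :
    ‖(⨍ p in I ×ˢ s, u p) - (volume.real I)⁻¹ • f y‖ ≤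
      √(volume.real J / volume.real I) * ‖g‖ := by
  have : IsFiniteMeasure (volume.restrict s) :=
    isFiniteMeasure_of_le _ (Measure.restrict_mono hsJ le_rfl)
  have hline := hf.norm_setAverage_sub_le hord (isFiniteMeasure_restrict.1 inferInstance)
    (memLp_integral_section (memLp_swap_of_subset hIJ u))
    (memLp_integral_section (memLp_swap_of_subset hIJ g)) huf hy hs hsJ h0
  rw [setAverage_prod_snd (integrable_prod_of_subset ((prod_mono le_rfl hsJ).trans hIJ) u),
    ← smul_sub, norm_smul, norm_inv, Real.norm_of_nonneg measureReal_nonneg,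
    ← inv_mul_sqrt_mul_sqrt _ _ measureReal_nonneg]
  gcongr
  exact hline.trans (mul_le_mul_of_nonneg_left (toReal_eLpNorm_integral_fst_le hIJ g)
    (Real.sqrt_nonneg _))

omit [IsFiniteMeasure (volume.restrict I)] in
theorem HasWeakDeriv.exists_isPrimitiveOn_integral_snd (h : HasWeakDeriv Ω (1, 0) u g)
    (hI : IsOpen I) (hord : I.OrdConnected) (hJ : IsOpen J) (hIJ : I ×ˢ J ⊆ Ω) :
    ∃ f : ℝ → ℂ, (fun x => ∫ y in J, u (x, y)) =ᵐ[volume.restrict I] f ∧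
      IsPrimitiveOn I f fun x => ∫ y in J, g (x, y) := by
  obtain ⟨f, -, huf, hf⟩ := (h.isWeakDeriv_integral_snd hJ hIJ).exists_isPrimitiveOn hI hord
    (locallyIntegrableOn_of_memLp one_le_two (memLp_integral_section (memLp_prod_of_subset hIJ u)))
    (locallyIntegrableOn_of_memLp one_le_two (memLp_integral_section (memLp_prod_of_subset hIJ g)))
  exact ⟨f, huf, hf⟩

omit [IsFiniteMeasure (volume.restrict J)] in
theorem HasWeakDeriv.exists_isPrimitiveOn_integral_fst (h : HasWeakDeriv Ω (0, 1) u g)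
    (hI : IsOpen I) (hJ : IsOpen J) (hord : J.OrdConnected) (hIJ : I ×ˢ J ⊆ Ω) :
    ∃ f : ℝ → ℂ, (fun y => ∫ x in I, u (x, y)) =ᵐ[volume.restrict J] f ∧
      IsPrimitiveOn J f fun y => ∫ x in I, g (x, y) := by
  obtain ⟨f, -, huf, hf⟩ := (h.isWeakDeriv_integral_fst hI hIJ).exists_isPrimitiveOn hJ hord
    (locallyIntegrableOn_of_memLp one_le_two (memLp_integral_section (memLp_swap_of_subset hIJ u)))
    (locallyIntegrableOn_of_memLp one_le_two (memLp_integral_section (memLp_swap_of_subset hIJ g)))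
  exact ⟨f, huf, hf⟩

theorem norm_setAverage_sub_setAverage_fst_le (h : HasWeakDeriv Ω (1, 0) u g) (hI : IsOpen I)
    (hord : I.OrdConnected) (hJ : IsOpen J) (hIJ : I ×ˢ J ⊆ Ω) (hs : MeasurableSet s)
    (hsI : s ⊆ I) (h0 : volume s ≠ 0) :
    ‖(⨍ p in s ×ˢ J, u p) - ⨍ p in I ×ˢ J, u p‖ ≤
      2 * (√(volume.real I / volume.real J) * ‖g‖) := by
  obtain ⟨f, huf, hf⟩ := h.exists_isPrimitiveOn_integral_snd hI hord hJ hIJ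
  obtain ⟨x, hx⟩ := nonempty_of_measure_ne_zero h0
  have hsmall := norm_setAverage_prod_sub_fst_le hIJ hord hf huf (hsI hx) hs hsI h0
  have hlarge := norm_setAverage_prod_sub_fst_le hIJ hord hf huf (hsI hx) hI.measurableSet le_rfl
    fun hI0 => h0 (measure_mono_null hsI hI0)
  rw [norm_sub_rev] at hlarge
  linarith [norm_sub_le_norm_sub_add_norm_sub (⨍ p in s ×ˢ J, u p) ((volume.real J)⁻¹ • f x)
    (⨍ p in I ×ˢ J, u p)]

theorem norm_setAverage_sub_setAverage_snd_le (h : HasWeakDeriv Ω (0, 1) u g) (hI : IsOpen I)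
    (hJ : IsOpen J) (hord : J.OrdConnected) (hIJ : I ×ˢ J ⊆ Ω) (hs : MeasurableSet s)
    (hsJ : s ⊆ J) (h0 : volume s ≠ 0) :
    ‖(⨍ p in I ×ˢ s, u p) - ⨍ p in I ×ˢ J, u p‖ ≤
      2 * (√(volume.real J / volume.real I) * ‖g‖) := by
  obtain ⟨f, huf, hf⟩ := h.exists_isPrimitiveOn_integral_fst hI hJ hord hIJ
  obtain ⟨y, hy⟩ := nonempty_of_measure_ne_zero h0
  have hsmall := norm_setAverage_prod_sub_snd_le hIJ hord hf huf (hsJ hy) hs hsJ h0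
  have hlarge := norm_setAverage_prod_sub_snd_le hIJ hord hf huf (hsJ hy) hJ.measurableSet le_rfl
    fun hJ0 => h0 (measure_mono_null hsJ hJ0)
  rw [norm_sub_rev] at hlarge
  linarith [norm_sub_le_norm_sub_add_norm_sub (⨍ p in I ×ˢ s, u p) ((volume.real I)⁻¹ • f y)
    (⨍ p in I ×ˢ J, u p)]

end Averages

section Squares

theorem passage_eq_prod (d h : ℝ) : passage d h = Ioo (-(d / 2)) (d / 2) ×ˢ Ioo 0 h := by
  ext x
  simp [passage, abs_lt]

theorem room_eq_prod (h b : ℝ) : room h b = Ioo (-(b / 2)) (b / 2) ×ˢ Ioo h (h + b) := by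
  ext x
  simp [room, abs_lt]

theorem volume_Ioo_ne_zero {a b : ℝ} (hab : a < b) : volume (Ioo a b) ≠ 0 :=
  (Measure.measure_Ioo_pos volume).2 hab |>.ne'

theorem volume_real_Ioo_neg_half {s : ℝ} (hs : 0 ≤ s) :
    volume.real (Ioo (-(s / 2)) (s / 2)) = s := by
  rw [Real.volume_real_Ioo_of_le (by linarith)]
  ring

theorem volume_real_room (c : ℝ) {s : ℝ} (hs : 0 ≤ s) : volume.real (room c s) = s ^ 2 := by
  rw [room_eq_prod, Measure.volume_eq_prod, measureReal_prod_prod, volume_real_Ioo_neg_half hs,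
    Real.volume_real_Ioo_of_le (by linarith)]
  ring

theorem room_subset_room {c c' s S : ℝ} (hsS : s ≤ S) (hc : c' ≤ c) (hcS : c + s ≤ c' + S) :
    room c s ⊆ room c' S := by
  rw [room_eq_prod, room_eq_prod]
  exact prod_mono (Ioo_subset_Ioo (by linarith) (by linarith)) (Ioo_subset_Ioo hc hcS)

variable {Ω : Set (ℝ × ℝ)} {u g₁ g₂ : L2 Ω} {N : ℝ}

theorem norm_setAverage_room_le (u : L2 Ω) {c s : ℝ} (hs : 0 ≤ s) (hsub : room c s ⊆ Ω) :
    ‖⨍ p in room c s, u p‖ ≤ s⁻¹ * ‖u‖ := by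
  have h := norm_setAverage_le ((Lp.memLp u).mono_measure (Measure.restrict_mono hsub le_rfl))
  rw [volume_real_room c hs, Real.sqrt_sq hs] at h
  refine h.trans (mul_le_mul_of_nonneg_left ?_ (inv_nonneg.2 hs))
  rw [Lp.norm_def]
  exact toReal_eLpNorm_restrict_le (Lp.memLp u) hsub

theorem norm_setAverage_room_sub_le (h₁ : HasWeakDeriv Ω (1, 0) u g₁)
    (h₂ : HasWeakDeriv Ω (0, 1) u g₂) (hN₁ : ‖g₁‖ ≤ N) (hN₂ : ‖g₂‖ ≤ N) {s S c c' : ℝ} (hs : 0 < s)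
    (hsS : s ≤ S) (hS : S ≤ 2 * s) (hc : c' ≤ c) (hcS : c + s ≤ c' + S) (hsub : room c' S ⊆ Ω) :
    ‖(⨍ p in room c s, u p) - ⨍ p in room c' S, u p‖ ≤ 5 * N := by
  have hS0 : 0 < S := hs.trans_le hsS
  rw [room_eq_prod] at hsub ⊢
  rw [room_eq_prod]
  have hwide := norm_setAverage_sub_setAverage_fst_le h₁ (s := Ioo (-(s / 2)) (s / 2)) isOpen_Ioo
    ordConnected_Ioo isOpen_Ioo ((prod_mono le_rfl (Ioo_subset_Ioo hc hcS)).trans hsub)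
    measurableSet_Ioo (Ioo_subset_Ioo (by linarith) (by linarith))
    (volume_Ioo_ne_zero (by linarith))
  have htall := norm_setAverage_sub_setAverage_snd_le h₂ isOpen_Ioo isOpen_Ioo ordConnected_Ioo
    hsub measurableSet_Ioo (Ioo_subset_Ioo hc hcS) (volume_Ioo_ne_zero (by linarith))
  have hsqrt : √(S / s) ≤ 3 / 2 := by
    rw [Real.sqrt_le_left (by norm_num), div_le_iff₀ hs]
    linarith
  rw [volume_real_Ioo_neg_half hS0.le, Real.volume_real_Ioo_of_le (by linarith),
    add_sub_cancel_left] at hwide htall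
  rw [div_self hS0.ne', Real.sqrt_one, one_mul] at htall
  have hwide' : √(S / s) * ‖g₁‖ ≤ 3 / 2 * N :=
    mul_le_mul hsqrt hN₁ (norm_nonneg _) (by norm_num)
  linarith [norm_sub_le_norm_sub_add_norm_sub
    (⨍ p in Ioo (-(s / 2)) (s / 2) ×ˢ Ioo c (c + s), u p)
    (⨍ p in Ioo (-(S / 2)) (S / 2) ×ˢ Ioo c (c + s), u p)
    (⨍ p in Ioo (-(S / 2)) (S / 2) ×ˢ Ioo c' (c' + S), u p)]

/-- Doubling the side costs a bounded multiple of the gradient norm, because the squared gradient is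
scale invariant in dimension two; this produces the logarithm `n` of the ratio of the sides. -/
theorem norm_setAverage_room_dyadic_sub_le (h₁ : HasWeakDeriv Ω (1, 0) u g₁)
    (h₂ : HasWeakDeriv Ω (0, 1) u g₂) (hN₁ : ‖g₁‖ ≤ N) (hN₂ : ‖g₂‖ ≤ N) {c : ℝ → ℝ}
    (hc : Antitone c) (hctop : Monotone fun s => c s + s) (n : ℕ) {s S : ℝ} (hs : 0 < s)
    (hsS : s ≤ S) (hS : S ≤ 2 ^ n * s) (hsub : room (c S) S ⊆ Ω) :
    ‖(⨍ p in room (c s) s, u p) - ⨍ p in room (c S) S, u p‖ ≤ 5 * n * N := by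
  induction n generalizing S with
  | zero =>
    obtain rfl : s = S := le_antisymm hsS (by simpa using hS)
    simp
  | succ n ih =>
    set T := max s (S / 2)
    have hTS : T ≤ S := max_le hsS (by linarith)
    have hsT : s ≤ T := le_max_left _ _
    have hTn : T ≤ 2 ^ n * s :=
      max_le (le_mul_of_one_le_left hs.le (one_le_pow₀ one_le_two))
        (by rw [pow_succ] at hS; linarith)
    have hsmall := ih hsT hTn ((room_subset_room hTS (hc hTS) (hctop hTS)).trans hsub)
    have hlarge := norm_setAverage_room_sub_le h₁ h₂ hN₁ hN₂ (hs.trans_le hsT) hTS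
      (by linarith [le_max_right s (S / 2)]) (hc hTS) (hctop hTS) hsub
    push_cast
    linarith [norm_sub_le_norm_sub_add_norm_sub (⨍ p in room (c s) s, u p)
      (⨍ p in room (c T) T, u p) (⨍ p in room (c S) S, u p)]

end Squares

section Flux

variable {Ω : Set (ℝ × ℝ)} {u g g₁ g₂ : L2 Ω} {N : ℝ}

theorem IsPrimitiveOn.mono {V : Type*} [NormedAddCommGroup V] [NormedSpace ℝ V] {I I' : Set ℝ}
    {f G : ℝ → V} (h : IsPrimitiveOn I f G) (hI : I' ⊆ I) : IsPrimitiveOn I' f G :=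
  fun x hx y hy => h x (hI hx) y (hI hy)

theorem norm_setAverage_room_sub_smul_le {d lo hi : ℝ} (hd : 0 < d)
    (hsub : Ioo (-(d / 2)) (d / 2) ×ˢ Ioo lo hi ⊆ Ω) {f : ℝ → ℂ}
    (hf : IsPrimitiveOn (Ioo lo hi) f fun y => ∫ x in Ioo (-(d / 2)) (d / 2), g (x, y))
    (huf : (fun y => ∫ x in Ioo (-(d / 2)) (d / 2), u (x, y)) =ᵐ[volume.restrict (Ioo lo hi)] f)
    {y c : ℝ} (hlo : lo ≤ y - d) (hhi : y + d ≤ hi) (hyc : y - d ≤ c) (hcy : c ≤ y) :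
    ‖(⨍ p in room c d, u p) - d⁻¹ • f y‖ ≤ 2 * ‖g‖ := by
  have hJ : Ioo (y - d) (y + d) ⊆ Ioo lo hi := Ioo_subset_Ioo hlo hhi
  have h := norm_setAverage_prod_sub_snd_le ((prod_mono le_rfl hJ).trans hsub) ordConnected_Ioo
    (hf.mono hJ) (ae_restrict_of_ae_restrict_of_subset hJ huf) (y := y)
    ⟨by linarith, by linarith⟩ measurableSet_Ioo
    (Ioo_subset_Ioo hyc (by linarith) : Ioo c (c + d) ⊆ _) (volume_Ioo_ne_zero (by linarith))
  rw [← room_eq_prod, volume_real_Ioo_neg_half hd.le, Real.volume_real_Ioo_of_le (by linarith)] at h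
  have hsqrt : √((y + d - (y - d)) / d) ≤ 2 := by
    rw [Real.sqrt_le_left two_pos.le, div_le_iff₀ hd]
    linarith
  exact h.trans (mul_le_mul_of_nonneg_right hsqrt (norm_nonneg _))

theorem norm_flux_sub_le (hw : HasWeakDeriv Ω (0, 1) u g) {d h lo hi : ℝ} (hd : 0 < d)
    (hdh : d ≤ h) (hlo : lo ≤ -d) (hhi : h + d ≤ hi)
    (hsub : Ioo (-(d / 2)) (d / 2) ×ˢ Ioo lo hi ⊆ Ω) :
    ‖d⁻¹ • (∫ p in passage d h, g p) - ((⨍ p in room h d, u p) - ⨍ p in room (-d) d, u p)‖ ≤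
      4 * ‖g‖ := by
  obtain ⟨f, huf, hf⟩ := hw.exists_isPrimitiveOn_integral_fst isOpen_Ioo isOpen_Ioo
    ordConnected_Ioo hsub
  have hsub0 : Ioo (0 : ℝ) h ⊆ Ioo lo hi := Ioo_subset_Ioo (by linarith) (by linarith)
  have hflux : ∫ p in passage d h, g p = f h - f 0 := by
    rw [passage_eq_prod, setIntegral_prod_snd
      (integrable_prod_of_subset ((prod_mono le_rfl hsub0).trans hsub) g),
      hf 0 ⟨by linarith, by linarith⟩ h ⟨by linarith, by linarith⟩,
      intervalIntegral.integral_of_le (hd.le.trans hdh), integral_Ioc_eq_integral_Ioo]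
  have htop := norm_setAverage_room_sub_smul_le hd hsub hf huf (y := h) (c := h) (by linarith) hhi
    (by linarith) le_rfl
  have hbottom := norm_setAverage_room_sub_smul_le hd hsub hf huf (y := 0) (c := -d) (by linarith)
    (by linarith) (by linarith) (by linarith)
  rw [norm_sub_rev] at htop
  rw [hflux, smul_sub, sub_sub_sub_comm, sub_eq_add_neg, neg_sub]
  linarith [norm_add_le (d⁻¹ • f h - ⨍ p in room h d, u p)
    ((⨍ p in room (-d) d, u p) - d⁻¹ • f 0)]

theorem norm_setAverage_room_sub_strip_le {ε : ℝ} (hε : 0 < ε)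
    (hsub : room (-ε) ε ⊆ Ω) {f : ℝ → ℂ}
    (hf : IsPrimitiveOn (Ioo (-(ε / 2)) (ε / 2)) f fun x => ∫ y in Ioo (-ε) 0, g (x, y))
    (huf : (fun x => ∫ y in Ioo (-ε) 0, u (x, y)) =ᵐ[volume.restrict (Ioo (-(ε / 2)) (ε / 2))] f) :
    ‖(⨍ p in room (-ε) ε, u p) - ε⁻¹ • f 0‖ ≤ ‖g‖ := by
  rw [room_eq_prod, neg_add_cancel] at hsub ⊢
  have h := norm_setAverage_prod_sub_fst_le hsub ordConnected_Ioo hf huf (x := 0)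
    ⟨by linarith, by linarith⟩ measurableSet_Ioo le_rfl (volume_Ioo_ne_zero (by linarith))
  rwa [volume_real_Ioo_neg_half hε.le, Real.volume_real_Ioo_of_le (by linarith), zero_sub, neg_neg,
    div_self hε.ne', Real.sqrt_one, one_mul] at h

theorem norm_flux_add_le (h₁ : HasWeakDeriv Ω (1, 0) u g₁) (h₂ : HasWeakDeriv Ω (0, 1) u g₂)
    (hN : ‖u‖ ≤ N) (hN₁ : ‖g₁‖ ≤ N) (hN₂ : ‖g₂‖ ≤ N) {d h b ε : ℝ} (hd : 0 < d) (hdh : d ≤ h)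
    (hdε : d ≤ ε) (hdb : d ≤ b) {n : ℕ} (hbn : b ≤ 2 ^ n * d) (hεn : ε ≤ 2 ^ n * d)
    (htall : Ioo (-(d / 2)) (d / 2) ×ˢ Ioo (-ε) (h + b) ⊆ Ω) (hroom : room h b ⊆ Ω)
    (hsq : room (-ε) ε ⊆ Ω) {f : ℝ → ℂ}
    (hf : IsPrimitiveOn (Ioo (-(ε / 2)) (ε / 2)) f fun x => ∫ y in Ioo (-ε) 0, g₁ (x, y))
    (huf : (fun x => ∫ y in Ioo (-ε) 0, u (x, y)) =ᵐ[volume.restrict (Ioo (-(ε / 2)) (ε / 2))] f) :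
    ‖d⁻¹ • (∫ p in passage d h, g₂ p) + ε⁻¹ • f 0‖ ≤ (5 + 10 * n + b⁻¹) * N := by
  have hb : 0 < b := hd.trans_le hdb
  have hflux := norm_flux_sub_le h₂ hd hdh (neg_le_neg hdε) (by linarith) htall
  have hup := norm_setAverage_room_dyadic_sub_le h₁ h₂ hN₁ hN₂ (c := fun _ => h) antitone_const
    (fun _ _ hsS => by simpa using hsS) n hd hdb hbn hroom
  have hdown := norm_setAverage_room_dyadic_sub_le h₁ h₂ hN₁ hN₂ (c := fun s => -s)
    (fun _ _ hsS => neg_le_neg hsS) (fun _ _ _ => by simp) n hd hdε hεn hsq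
  have hlarge : ‖⨍ p in room h b, u p‖ ≤ b⁻¹ * N :=
    (norm_setAverage_room_le u hb.le hroom).trans
      (mul_le_mul_of_nonneg_left hN (inv_nonneg.2 hb.le))
  have hstrip := norm_setAverage_room_sub_strip_le (hd.trans_le hdε) hsq hf huf
  have htelescope : ∀ A T B R Q c : ℂ,
      A + c = (A - (T - B)) + (T - R) + R - (B - Q) - (Q - c) := by
    intros
    ring
  rw [htelescope _ (⨍ p in room h d, u p) (⨍ p in room (-d) d, u p) (⨍ p in room h b, u p)
    (⨍ p in room (-ε) ε, u p)]
  refine (norm_sub_le_of_le (norm_sub_le_of_le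
    (norm_add_le_of_le (norm_add_le_of_le hflux hup) hlarge) hdown) hstrip).trans ?_
  linarith

end Flux

/-! ### Resolvents of operators associated with closed forms -/

section Resolvent

variable {H K : Type*} [NormedAddCommGroup H] [InnerProductSpace ℂ H] [NormedAddCommGroup K]
  [InnerProductSpace ℂ K]

theorem IsResolvent.formResolvent_eq {G : Set (H × H)} {R : H →L[ℂ] H} (h : IsResolvent G R) :
    formResolvent G = R := by
  have hex : ∃ R : H →L[ℂ] H, IsResolvent G R := ⟨R, h⟩
  rw [formResolvent, dif_pos hex]
  exact hex.choose_spec.unique h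

/-- A closed linear relation `S`, to be thought of as the graph of a closed operator `B`, which
factorizes the form `a` with domain `D`: `D = dom B` and `a[u, v] = (B u, B v)`. -/
structure IsFormFactorization (D : Set H) (a : H → H → ℂ) (S : Submodule ℂ (H × K)) : Prop where
  isClosed : IsClosed (S : Set (H × K))
  domain_eq : D = Prod.fst '' (S : Set (H × K))
  form_eq : ∀ p ∈ S, ∀ q ∈ S, a p.1 q.1 = inner ℂ q.2 p.2

/-- The relation `S` with the Hilbert sum inner product of `H ⊕ K`, that is, the form domain with
its energy inner product. -/
def energySpace (S : Submodule ℂ (H × K)) : Submodule ℂ (WithLp 2 (H × K)) :=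
  S.comap (WithLp.prodContinuousLinearEquiv 2 ℂ H K : WithLp 2 (H × K) →ₗ[ℂ] H × K)

/-- The contractive inclusion of the form domain with its energy inner product. -/
def energyInclusion (S : Submodule ℂ (H × K)) : energySpace S →L[ℂ] H :=
  WithLp.fstL 2 ℂ H K ∘L (energySpace S).subtypeL

variable {S : Submodule ℂ (H × K)}

theorem completeSpace_energySpace [CompleteSpace H] [CompleteSpace K]
    (hS : IsClosed (S : Set (H × K))) : CompleteSpace (energySpace S) :=
  (hS.preimage (WithLp.prodContinuousLinearEquiv 2 ℂ H K).continuous).completeSpace_coe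

variable [CompleteSpace H] [CompleteSpace (energySpace S)] {D : Set H} {a : H → H → ℂ}

theorem inner_sub_adjoint_energyInclusion (f : H) {q : H × K} (hq : q ∈ S) :
    inner ℂ q.1 (f - energyInclusion S ((energyInclusion S).adjoint f)) =
      inner ℂ q.2 ((energyInclusion S).adjoint f : WithLp 2 (H × K)).snd := by
  have h := (energyInclusion S).adjoint_inner_right ⟨WithLp.toLp 2 q, hq⟩ f
  rw [Submodule.coe_inner, WithLp.prod_inner_apply] at h
  rw [inner_sub_right, sub_eq_iff_eq_add']
  exact h.symm

theorem IsFormFactorization.isResolvent (h : IsFormFactorization D a S) :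
    IsResolvent (operatorGraph D a) (energyInclusion S ∘L (energyInclusion S).adjoint) := by
  intro f u
  constructor
  · rintro rfl
    let p := (energyInclusion S).adjoint f
    refine ⟨h.domain_eq.ge ⟨_, p.2, rfl⟩, fun v hv => ?_⟩
    obtain ⟨q, hq, rfl⟩ := h.domain_eq.le hv
    exact (inner_sub_adjoint_energyInclusion f hq).trans (h.form_eq _ p.2 q hq).symm
  · rintro ⟨hu, hv⟩
    obtain ⟨p, hp, rfl⟩ := h.domain_eq.le hu
    suffices (energyInclusion S).adjoint f = ⟨WithLp.toLp 2 p, hp⟩ from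
      congrArg (energyInclusion S) this
    refine ext_inner_left ℂ fun q => ?_
    have hweak := hv _ (h.domain_eq.ge ⟨_, q.2, rfl⟩)
    rw [h.form_eq p hp _ q.2, inner_sub_right, sub_eq_iff_eq_add'] at hweak
    rw [ContinuousLinearMap.adjoint_inner_right, Submodule.coe_inner, WithLp.prod_inner_apply]
    exact hweak

end Resolvent

section

variable {H K : Type*} [NormedAddCommGroup H] [InnerProductSpace ℂ H] [NormedAddCommGroup K]
  [InnerProductSpace ℂ K] {S : Submodule ℂ (H × K)} {D : Set H} {a : H → H → ℂ}

theorem IsFormFactorization.isResolvent_formResolvent [CompleteSpace H] [CompleteSpace K]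
    (h : IsFormFactorization D a S) :
    IsResolvent (operatorGraph D a) (formResolvent (operatorGraph D a)) := by
  have := completeSpace_energySpace h.isClosed
  rw [h.isResolvent.formResolvent_eq]
  exact h.isResolvent

theorem IsFormFactorization.isSelfAdjoint_formResolvent [CompleteSpace H] [CompleteSpace K]
    (h : IsFormFactorization D a S) :
    IsSelfAdjoint (formResolvent (operatorGraph D a)) := by
  have := completeSpace_energySpace h.isClosed
  rw [h.isResolvent.formResolvent_eq, ContinuousLinearMap.isSelfAdjoint_iff',
    ContinuousLinearMap.adjoint_comp, ContinuousLinearMap.adjoint_adjoint]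

theorem IsFormFactorization.congr {a' : H → H → ℂ} (h : IsFormFactorization D a S)
    (ha : ∀ u ∈ D, ∀ v ∈ D, a' u v = a u v) : IsFormFactorization D a' S :=
  ⟨h.isClosed, h.domain_eq, fun p hp q hq =>
    (ha _ (h.domain_eq.ge ⟨p, hp, rfl⟩) _ (h.domain_eq.ge ⟨q, hq, rfl⟩)).trans
      (h.form_eq p hp q hq)⟩

theorem IsFormFactorization.add {K' : Type*} [NormedAddCommGroup K'] [InnerProductSpace ℂ K']
    {D' : Set H} {a' : H → H → ℂ} {S' : Submodule ℂ (H × K')} (h : IsFormFactorization D a S)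
    (h' : IsFormFactorization D' a' S') :
    IsFormFactorization (D ∩ D') (fun u v => a u v + a' u v)
      (S.comap ((ContinuousLinearMap.id ℂ H).prodMap (WithLp.fstL 2 ℂ K K')).toLinearMap ⊓
        S'.comap ((ContinuousLinearMap.id ℂ H).prodMap (WithLp.sndL 2 ℂ K K')).toLinearMap) where
  isClosed := (h.isClosed.preimage (ContinuousLinearMap.continuous _)).inter
    (h'.isClosed.preimage (ContinuousLinearMap.continuous _))
  domain_eq := by
    rw [h.domain_eq, h'.domain_eq]
    ext u
    constructor
    · rintro ⟨⟨⟨_, k⟩, hk, rfl⟩, ⟨⟨w, k'⟩, hk', hw⟩⟩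
      obtain rfl : w = _ := hw
      exact ⟨(w, WithLp.toLp 2 (k, k')), ⟨hk, hk'⟩, rfl⟩
    · rintro ⟨p, ⟨hp, hp'⟩, rfl⟩
      exact ⟨⟨_, hp, rfl⟩, ⟨_, hp', rfl⟩⟩
  form_eq p hp q hq := by
    rw [WithLp.prod_inner_apply]
    exact congrArg₂ (· + ·) (h.form_eq _ hp.1 _ hq.1) (h'.form_eq _ hp.2 _ hq.2)

theorem IsFormFactorization.add_bounded {K' : Type*} [NormedAddCommGroup K']
    [InnerProductSpace ℂ K'] {b : H → H → ℂ} (h : IsFormFactorization D a S)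
    (T : H × K →L[ℂ] K') (hb : ∀ p ∈ S, ∀ q ∈ S, b p.1 q.1 = inner ℂ (T q) (T p)) :
    IsFormFactorization D (fun u v => a u v + b u v)
      (S.comap ((ContinuousLinearMap.id ℂ H).prodMap (WithLp.fstL 2 ℂ K K')).toLinearMap ⊓
        (WithLp.sndL 2 ℂ K K' ∘L ContinuousLinearMap.snd ℂ H _ -
          T ∘L (ContinuousLinearMap.id ℂ H).prodMap (WithLp.fstL 2 ℂ K K')).toLinearMap.ker) where
  isClosed := (h.isClosed.preimage (ContinuousLinearMap.continuous _)).inter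
    (ContinuousLinearMap.isClosed_ker _)
  domain_eq := by
    rw [h.domain_eq]
    ext u
    constructor
    · rintro ⟨⟨u, k⟩, hk, rfl⟩
      exact ⟨(u, WithLp.toLp 2 (k, T (u, k))), ⟨hk, sub_self (T (u, k))⟩, rfl⟩
    · rintro ⟨p, hp, rfl⟩
      exact ⟨_, hp.1, rfl⟩
  form_eq p hp q hq := by
    have hval {p : H × WithLp 2 (K × K')} (hp : p ∈ (WithLp.sndL 2 ℂ K K' ∘L
        ContinuousLinearMap.snd ℂ H _ - T ∘L (ContinuousLinearMap.id ℂ H).prodMap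
          (WithLp.fstL 2 ℂ K K')).toLinearMap.ker) : p.2.snd = T (p.1, p.2.fst) :=
      sub_eq_zero.1 hp
    rw [WithLp.prod_inner_apply]
    refine congrArg₂ (· + ·) (h.form_eq _ hp.1 _ hq.1) ?_
    exact (hb _ hp.1 _ hq.1).trans (congrArg₂ (inner ℂ) (hval hq.2) (hval hp.2)).symm

theorem IsFormFactorization.comap {H' : Type*} [NormedAddCommGroup H'] [InnerProductSpace ℂ H']
    (h : IsFormFactorization D a S) (A : H' →L[ℂ] H) :
    IsFormFactorization (A ⁻¹' D) (fun u v => a (A u) (A v))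
      (S.comap (A.prodMap (ContinuousLinearMap.id ℂ K)).toLinearMap) where
  isClosed := h.isClosed.preimage (ContinuousLinearMap.continuous _)
  domain_eq := by
    rw [h.domain_eq]
    ext u
    constructor
    · rintro ⟨⟨_, k⟩, hk, rfl⟩
      exact ⟨(u, k), hk, rfl⟩
    · rintro ⟨p, hp, rfl⟩
      exact ⟨_, hp, rfl⟩
  form_eq p hp q hq := h.form_eq _ hp _ hq

end

section

variable {H : Type*} [NormedAddCommGroup H] [InnerProductSpace ℂ H]

theorem re_inner_self (u : H) : (inner ℂ u u).re = ‖u‖ ^ 2 :=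
  (norm_sq_eq_re_inner (𝕜 := ℂ) u).symm

theorem norm_le_of_norm_sq_le_re_inner_sub {u f : H} {t : ℝ}
    (h : t ^ 2 ≤ (inner ℂ u (f - u)).re) : ‖u‖ ≤ ‖f‖ ∧ t ≤ ‖f‖ := by
  have hcs : (inner ℂ u f).re ≤ ‖u‖ * ‖f‖ :=
    re_inner_le_norm (𝕜 := ℂ) u f
  rw [inner_sub_right, Complex.sub_re, re_inner_self] at h
  have hu : ‖u‖ ≤ ‖f‖ := by
    by_contra! hlt
    nlinarith [sq_nonneg t, norm_nonneg f]
  exact ⟨hu, abs_le_of_sq_le_sq' (by nlinarith [norm_nonneg u]) (norm_nonneg f) |>.2⟩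

end

section WeakDerivative

/-- The functional `u ↦ ∫ χ u` on `L²`, for a real weight `χ ∈ L²`. -/
noncomputable def integralSMul {X : Type*} [MeasurableSpace X] {μ : Measure X} {χ : X → ℝ}
    (hχ : MemLp χ 2 μ) : Lp ℂ 2 μ →L[ℂ] ℂ :=
  innerSL ℂ (hχ.ofReal (K := ℂ)).toLp

theorem integralSMul_apply {X : Type*} [MeasurableSpace X] {μ : Measure X} {χ : X → ℝ}
    (hχ : MemLp χ 2 μ) (u : Lp ℂ 2 μ) : integralSMul hχ u = ∫ x, χ x • u x ∂μ := by
  rw [integralSMul, innerSL_apply_apply, L2.inner_def]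
  refine integral_congr_ae ?_
  filter_upwards [(hχ.ofReal (K := ℂ)).coeFn_toLp] with x hx
  rw [hx, RCLike.inner_apply, RCLike.conj_ofReal, mul_comm, Complex.real_smul]
  rfl

variable {E : Type*} [NormedAddCommGroup E] [NormedSpace ℝ E] [MeasureSpace E] {Ω : Set E}
  {v w : E} {u g g' : L2 Ω}

theorem hasWeakDeriv_iff : HasWeakDeriv Ω v u g ↔ ∀ φ : E → ℝ, IsTestFunction Ω φ →
    ∫ x in Ω, fderiv ℝ φ x v • u x = -∫ x in Ω, φ x • g x :=
  ⟨fun h φ hφ => h φ hφ.contDiff hφ.hasCompactSupport hφ.tsupport_subset,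
    fun h φ hφ hc hs => h φ ⟨hφ, hc, hs⟩⟩

theorem hasWeakDeriv_weakDeriv (h : ∃ g : L2 Ω, HasWeakDeriv Ω v u g) :
    HasWeakDeriv Ω v u (weakDeriv Ω v u) := by
  rw [weakDeriv, dif_pos h]
  exact h.choose_spec

theorem HasWeakDeriv.dir_smul (h : HasWeakDeriv Ω v u g) (c : ℝ) :
    HasWeakDeriv Ω (c • v) u ((c : ℂ) • g) := by
  intro φ hφ hc hs
  have hg : ∫ x in Ω, φ x • ((c : ℂ) • g) x = c • ∫ x in Ω, φ x • g x := by
    rw [← integral_smul]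
    refine integral_congr_ae ?_
    filter_upwards [Lp.coeFn_smul (c : ℂ) g] with x hx
    rw [hx, Pi.smul_apply, smul_comm, Complex.coe_smul]
  simp only [map_smul, smul_assoc]
  rw [integral_smul, h φ hφ hc hs, hg, smul_neg]

variable [BorelSpace E]

theorem IsTestFunction.memLp {μ : Measure E} [IsFiniteMeasureOnCompacts μ] {φ : E → ℝ}
    (h : IsTestFunction Ω φ) (s : Set E) : MemLp φ 2 (μ.restrict s) :=
  (h.contDiff.continuous.memLp_of_hasCompactSupport h.hasCompactSupport).mono_measure
    Measure.restrict_le_self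

variable [IsFiniteMeasureOnCompacts (volume : Measure E)]

theorem HasWeakDeriv.dir_add {k : L2 Ω} (h : HasWeakDeriv Ω v u g) (h' : HasWeakDeriv Ω w u k) :
    HasWeakDeriv Ω (v + w) u (g + k) := by
  rw [hasWeakDeriv_iff] at h h' ⊢
  intro φ hφ
  have hint {χ : E → ℝ} (hχ : IsTestFunction Ω χ) (f : L2 Ω) :
      Integrable (fun x => χ x • f x) (volume.restrict Ω) :=
    memLp_one_iff_integrable.1 ((Lp.memLp f).smul (hχ.memLp Ω))
  have hsum : ∫ x in Ω, φ x • (g + k) x = (∫ x in Ω, φ x • g x) + ∫ x in Ω, φ x • k x := by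
    rw [← integral_add (hint hφ g) (hint hφ k)]
    refine integral_congr_ae ?_
    filter_upwards [Lp.coeFn_add g k] with x hx
    rw [hx, Pi.add_apply, smul_add]
  simp only [map_add, add_smul]
  rw [integral_add (hint (hφ.fderiv_apply v) u) (hint (hφ.fderiv_apply w) u), h φ hφ, h' φ hφ,
    hsum, neg_add]

/-- The closed linear relation of all pairs `(u, g)` such that `g` is the weak derivative of `u` in
the direction `v`. -/
noncomputable def weakDerivGraph (Ω : Set E) (v : E) : Submodule ℂ (L2 Ω × L2 Ω) :=
  ⨅ φ : {φ : E → ℝ // IsTestFunction Ω φ},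
    (integralSMul ((φ.2.fderiv_apply v).memLp Ω) ∘L ContinuousLinearMap.fst ℂ (L2 Ω) (L2 Ω) +
      integralSMul (φ.2.memLp Ω) ∘L ContinuousLinearMap.snd ℂ (L2 Ω) (L2 Ω)).toLinearMap.ker

theorem mem_weakDerivGraph_iff {p : L2 Ω × L2 Ω} :
    p ∈ weakDerivGraph Ω v ↔ HasWeakDeriv Ω v p.1 p.2 := by
  simp [weakDerivGraph, hasWeakDeriv_iff, integralSMul_apply, add_eq_zero_iff_eq_neg]

theorem isClosed_weakDerivGraph : IsClosed (weakDerivGraph Ω v : Set (L2 Ω × L2 Ω)) := by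
  rw [weakDerivGraph, Submodule.coe_iInf]
  exact isClosed_iInter fun φ => ContinuousLinearMap.isClosed_ker _

variable [FiniteDimensional ℝ E]

theorem HasWeakDeriv.unique (hΩ : IsOpen Ω) (h : HasWeakDeriv Ω v u g)
    (h' : HasWeakDeriv Ω v u g') : g = g' := by
  have hloc (f : L2 Ω) : LocallyIntegrableOn f Ω :=
    locallyIntegrableOn_of_memLp one_le_two (Lp.memLp f)
  have hzero := hΩ.ae_eq_zero_of_integral_contDiff_smul_eq_zero ((hloc g).sub (hloc g'))
    fun φ hφ hc hs => by
      have hφΩ : IsTestFunction Ω φ := ⟨hφ, hc, hs⟩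
      have heq := neg_injective ((h φ hφ hc hs).symm.trans (h' φ hφ hc hs))
      rw [hφΩ.setIntegral_smul, hφΩ.setIntegral_smul] at heq
      simp only [Pi.sub_apply, smul_sub]
      rw [integral_sub (hφΩ.integrable_smul (hloc g)) (hφΩ.integrable_smul (hloc g')), heq,
        sub_self]
  refine Lp.ext ((ae_restrict_iff' hΩ.measurableSet).2 ?_)
  filter_upwards [hzero] with x hx hxΩ using sub_eq_zero.1 (hx hxΩ)

theorem HasWeakDeriv.weakDeriv_eq (hΩ : IsOpen Ω) (h : HasWeakDeriv Ω v u g) :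
    weakDeriv Ω v u = g :=
  (hasWeakDeriv_weakDeriv ⟨g, h⟩).unique hΩ h

theorem isFormFactorization_weakDerivGraph (hΩ : IsOpen Ω) (v : E) :
    IsFormFactorization {u | ∃ g : L2 Ω, HasWeakDeriv Ω v u g}
      (fun u w => inner ℂ (weakDeriv Ω v w) (weakDeriv Ω v u)) (weakDerivGraph Ω v) where
  isClosed := isClosed_weakDerivGraph
  domain_eq := Set.ext fun u =>
    ⟨fun ⟨g, hg⟩ => ⟨(u, g), mem_weakDerivGraph_iff.2 hg, rfl⟩,
      fun ⟨p, hp, hpu⟩ => hpu ▸ ⟨p.2, mem_weakDerivGraph_iff.1 hp⟩⟩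
  form_eq p hp q hq := by
    rw [(mem_weakDerivGraph_iff.1 hp).weakDeriv_eq hΩ,
      (mem_weakDerivGraph_iff.1 hq).weakDeriv_eq hΩ]

end WeakDerivative

theorem mem_H1_planar_iff {Ω : Set (ℝ × ℝ)} {u : L2 Ω} :
    u ∈ H1 Ω ↔ ∃ g₁ g₂ : L2 Ω, HasWeakDeriv Ω (1, 0) u g₁ ∧ HasWeakDeriv Ω (0, 1) u g₂ := by
  refine ⟨fun h => ?_, fun ⟨g₁, g₂, h₁, h₂⟩ v => ⟨(v.1 : ℂ) • g₁ + (v.2 : ℂ) • g₂, ?_⟩⟩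
  · obtain ⟨g₁, h₁⟩ := h (1, 0)
    obtain ⟨g₂, h₂⟩ := h (0, 1)
    exact ⟨g₁, g₂, h₁, h₂⟩
  · simpa using (h₁.dir_smul v.1).dir_add (h₂.dir_smul v.2)

theorem mem_H1_line_iff {Ω : Set ℝ} {u : L2 Ω} :
    u ∈ H1 Ω ↔ ∃ g : L2 Ω, HasWeakDeriv Ω 1 u g :=
  ⟨fun h => h 1, fun ⟨g, h⟩ v => ⟨(v : ℂ) • g, by simpa using h.dir_smul v⟩⟩

theorem hasWeakDeriv_line_iff {Ω : Set ℝ} {u g : L2 Ω} :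
    HasWeakDeriv Ω 1 u g ↔ IsWeakDeriv Ω u g := by
  simp only [hasWeakDeriv_iff, IsWeakDeriv, fderiv_apply_one_eq_deriv]

section Multiplication

variable {X : Type*} [MeasurableSpace X] {μ : Measure X} {V : X → ℝ}

/-- Multiplication by a bounded real function as a bounded operator on `L²`. -/
noncomputable def mulLp (hV : MemLp V ⊤ μ) : Lp ℂ 2 μ →L[ℂ] Lp ℂ 2 μ :=
  (ContinuousLinearMap.mul ℂ ℂ).holderL μ ⊤ 2 2 (hV.ofReal (K := ℂ)).toLp

theorem coeFn_mulLp (hV : MemLp V ⊤ μ) (u : Lp ℂ 2 μ) :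
    mulLp hV u =ᵐ[μ] fun x => (V x : ℂ) * u x := by
  refine (ContinuousLinearMap.coeFn_holder (r := 2) (ContinuousLinearMap.mul ℂ ℂ)
    (hV.ofReal (K := ℂ)).toLp u).trans ?_
  filter_upwards [(hV.ofReal (K := ℂ)).coeFn_toLp] with x hx
  rw [hx, ContinuousLinearMap.mul_apply']
  rfl

theorem norm_mulLp_apply_le (hV : MemLp V ⊤ μ) (u : Lp ℂ 2 μ) :
    ‖mulLp hV u‖ ≤ (eLpNorm V ⊤ μ).toReal * ‖u‖ := by
  refine Lp.norm_le_mul_norm_of_ae_le_mul ?_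
  filter_upwards [coeFn_mulLp hV u, ae_le_eLpNormEssSup (f := V) (μ := μ)] with x hx hVx
  rw [← eLpNorm_exponent_top] at hVx
  rw [hx, norm_mul, Complex.norm_real, ← toReal_enorm]
  exact mul_le_mul_of_nonneg_right (ENNReal.toReal_mono hV.2.ne hVx) (norm_nonneg _)

theorem inner_mulLp_left (hV : MemLp V ⊤ μ) (u v : Lp ℂ 2 μ) :
    inner ℂ (mulLp hV v) u = inner ℂ v (mulLp hV u) := by
  rw [L2.inner_def, L2.inner_def]
  refine integral_congr_ae ?_
  filter_upwards [coeFn_mulLp hV u, coeFn_mulLp hV v] with x hu hv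
  rw [hu, hv, RCLike.inner_apply, RCLike.inner_apply, map_mul, Complex.conj_ofReal]
  ring

theorem memLp_top_sqrt (hV : MemLp V ⊤ μ) : MemLp (fun x => √(V x)) ⊤ μ := by
  refine memLp_top_of_bound (Real.continuous_sqrt.comp_aestronglyMeasurable hV.1)
    (√(eLpNorm V ⊤ μ).toReal) ?_
  filter_upwards [ae_le_eLpNormEssSup (f := V) (μ := μ)] with x hx
  rw [← eLpNorm_exponent_top] at hx
  rw [Real.norm_of_nonneg (Real.sqrt_nonneg _)]
  refine Real.sqrt_le_sqrt ((le_abs_self _).trans ?_)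
  rw [← Real.norm_eq_abs, ← toReal_enorm]
  exact ENNReal.toReal_mono hV.2.ne hx

theorem inner_mulLp_sqrt (hV : MemLp V ⊤ μ) (hV0 : 0 ≤ᵐ[μ] V) (u v : Lp ℂ 2 μ) :
    inner ℂ (mulLp (memLp_top_sqrt hV) v) (mulLp (memLp_top_sqrt hV) u) =
      inner ℂ v (mulLp hV u) := by
  rw [inner_mulLp_left]
  congr 1
  refine Lp.ext ?_
  filter_upwards [coeFn_mulLp (memLp_top_sqrt hV) (mulLp (memLp_top_sqrt hV) u),
    coeFn_mulLp (memLp_top_sqrt hV) u, coeFn_mulLp hV u, hV0] with x h₁ h₂ h₃ h₀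
  rw [h₁, h₂, h₃, ← mul_assoc, ← Complex.ofReal_mul, Real.mul_self_sqrt h₀]

theorem integral_mul_conj (u v : Lp ℂ 2 μ) : ∫ x, u x * conj (v x) ∂μ = inner ℂ v u :=
  (L2.inner_def v u).symm

theorem integrable_mul_conj (u v : Lp ℂ 2 μ) : Integrable (fun x => u x * conj (v x)) μ :=
  L2.integrable_inner (𝕜 := ℂ) v u

theorem mulLp_mul_conj_ae_eq (hV : MemLp V ⊤ μ) (u v : Lp ℂ 2 μ) :
    (fun x => mulLp hV u x * conj (v x)) =ᵐ[μ] fun x => (V x : ℂ) * u x * conj (v x) := by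
  filter_upwards [coeFn_mulLp hV u] with x hx
  rw [hx]

end Multiplication

section NeumannOperator

variable {Ω : Set (ℝ × ℝ)} {V : ℝ × ℝ → ℝ} {u g₁ g₂ v k₁ k₂ : L2 Ω}

theorem planarForm_eq (hΩ : IsOpen Ω) (hV : MemLp V ⊤ (volume.restrict Ω))
    (hu₁ : HasWeakDeriv Ω (1, 0) u g₁) (hu₂ : HasWeakDeriv Ω (0, 1) u g₂)
    (hv₁ : HasWeakDeriv Ω (1, 0) v k₁) (hv₂ : HasWeakDeriv Ω (0, 1) v k₂) :
    planarForm Ω V u v = inner ℂ k₁ g₁ + inner ℂ k₂ g₂ + inner ℂ v (mulLp hV u) := by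
  have hae := mulLp_mul_conj_ae_eq hV u v
  rw [planarForm, hu₁.weakDeriv_eq hΩ, hu₂.weakDeriv_eq hΩ, hv₁.weakDeriv_eq hΩ,
    hv₂.weakDeriv_eq hΩ, integral_add ((integrable_mul_conj g₁ k₁).fun_add
      (integrable_mul_conj g₂ k₂)) ((integrable_mul_conj (mulLp hV u) v).congr hae),
    integral_add (integrable_mul_conj g₁ k₁) (integrable_mul_conj g₂ k₂), ← integral_congr_ae hae,
    integral_mul_conj, integral_mul_conj, integral_mul_conj]

theorem inner_eq_of_mem_neumannGraph (hΩ : IsOpen Ω) (hV : MemLp V ⊤ (volume.restrict Ω)) {f : L2 Ω}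
    (hu : (u, f) ∈ neumannGraph Ω V) (hu₁ : HasWeakDeriv Ω (1, 0) u g₁)
    (hu₂ : HasWeakDeriv Ω (0, 1) u g₂) (hv₁ : HasWeakDeriv Ω (1, 0) v k₁)
    (hv₂ : HasWeakDeriv Ω (0, 1) v k₂) :
    inner ℂ v f = inner ℂ k₁ g₁ + inner ℂ k₂ g₂ + inner ℂ v (mulLp hV u) :=
  (hu.2 v (mem_H1_planar_iff.2 ⟨k₁, k₂, hv₁, hv₂⟩)).trans (planarForm_eq hΩ hV hu₁ hu₂ hv₁ hv₂)

theorem norm_le_of_mem_neumannGraph (hΩ : IsOpen Ω) (hV : MemLp V ⊤ (volume.restrict Ω))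
    (hV0 : 0 ≤ᵐ[volume.restrict Ω] V) {f : L2 Ω} (hu : (u, f - u) ∈ neumannGraph Ω V)
    (hu₁ : HasWeakDeriv Ω (1, 0) u g₁) (hu₂ : HasWeakDeriv Ω (0, 1) u g₂) :
    ‖u‖ ≤ ‖f‖ ∧ ‖g₁‖ ≤ ‖f‖ ∧ ‖g₂‖ ≤ ‖f‖ := by
  have heq := congrArg Complex.re (inner_eq_of_mem_neumannGraph hΩ hV hu hu₁ hu₂ hu₁ hu₂)
  rw [← inner_mulLp_sqrt hV hV0, Complex.add_re, Complex.add_re, re_inner_self,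
    re_inner_self, re_inner_self] at heq
  have h₁ := norm_le_of_norm_sq_le_re_inner_sub (u := u) (f := f) (t := ‖g₁‖)
    (by rw [heq]; linarith [sq_nonneg ‖g₂‖, sq_nonneg ‖mulLp (memLp_top_sqrt hV) u‖])
  have h₂ := norm_le_of_norm_sq_le_re_inner_sub (u := u) (f := f) (t := ‖g₂‖)
    (by rw [heq]; linarith [sq_nonneg ‖g₁‖, sq_nonneg ‖mulLp (memLp_top_sqrt hV) u‖])
  exact ⟨h₁.1, h₁.2, h₂.2⟩

theorem exists_isFormFactorization_planarForm (hΩ : IsOpen Ω)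
    (hV : MemLp V ⊤ (volume.restrict Ω)) (hV0 : 0 ≤ᵐ[volume.restrict Ω] V) :
    ∃ S : Submodule ℂ (L2 Ω × WithLp 2 (WithLp 2 (L2 Ω × L2 Ω) × L2 Ω)),
      IsFormFactorization (H1 Ω) (planarForm Ω V) S := by
  have hgrad := (isFormFactorization_weakDerivGraph hΩ (1, 0)).add
    (isFormFactorization_weakDerivGraph hΩ (0, 1))
  have hform := hgrad.add_bounded (b := fun u v => inner ℂ v (mulLp hV u))
    (mulLp (memLp_top_sqrt hV) ∘L ContinuousLinearMap.fst ℂ _ _)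
    fun p _ q _ => (inner_mulLp_sqrt hV hV0 p.1 q.1).symm
  have hdom : H1 Ω = {u | ∃ g, HasWeakDeriv Ω (1, 0) u g} ∩ {u | ∃ g, HasWeakDeriv Ω (0, 1) u g} :=
    Set.ext fun u => mem_H1_planar_iff.trans exists_and_exists_comm.symm
  rw [← hdom] at hform
  refine ⟨_, hform.congr fun u hu v hv => ?_⟩
  exact planarForm_eq hΩ hV (hasWeakDeriv_weakDeriv (hu _)) (hasWeakDeriv_weakDeriv (hu _))
    (hasWeakDeriv_weakDeriv (hv _)) (hasWeakDeriv_weakDeriv (hv _))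

theorem isResolvent_neumannGraph (hΩ : IsOpen Ω) (hV : MemLp V ⊤ (volume.restrict Ω))
    (hV0 : 0 ≤ᵐ[volume.restrict Ω] V) :
    IsResolvent (neumannGraph Ω V) (formResolvent (neumannGraph Ω V)) :=
  have ⟨_, hS⟩ := exists_isFormFactorization_planarForm hΩ hV hV0
  hS.isResolvent_formResolvent

theorem isSelfAdjoint_formResolvent_neumannGraph (hΩ : IsOpen Ω)
    (hV : MemLp V ⊤ (volume.restrict Ω)) (hV0 : 0 ≤ᵐ[volume.restrict Ω] V) :
    IsSelfAdjoint (formResolvent (neumannGraph Ω V)) :=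
  have ⟨_, hS⟩ := exists_isFormFactorization_planarForm hΩ hV hV0
  hS.isSelfAdjoint_formResolvent

end NeumannOperator

section PointValue

variable {Ω I : Set ℝ} {f : ℝ → ℂ} {u g : L2 Ω}

theorem toReal_eLpNorm_restrict_le_norm {X : Type*} [MeasureSpace X] {A B : Set X} (hAB : A ⊆ B)
    (w : L2 B) : (eLpNorm w 2 (volume.restrict A)).toReal ≤ ‖w‖ := by
  rw [Lp.norm_def]
  exact toReal_eLpNorm_restrict_le (Lp.memLp w) hAB

theorem IsPrimitiveOn.norm_le (h : IsPrimitiveOn I f g) (hord : I.OrdConnected)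
    (hfin : volume I ≠ ⊤) (h0 : volume I ≠ 0) (hI : MeasurableSet I) (hIΩ : I ⊆ Ω)
    (huf : u =ᵐ[volume.restrict I] f) {y : ℝ} (hy : y ∈ I) :
    ‖f y‖ ≤ (√(volume.real I))⁻¹ * ‖u‖ + √(volume.real I) * ‖g‖ := by
  have hmem (w : L2 Ω) : MemLp w 2 (volume.restrict I) :=
    (Lp.memLp w).mono_measure (Measure.restrict_mono hIΩ le_rfl)
  have : IsFiniteMeasure (volume.restrict I) := isFiniteMeasure_restrict.2 hfin
  have havg : ‖⨍ x in I, u x‖ ≤ (√(volume.real I))⁻¹ * ‖u‖ :=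
    (norm_setAverage_le (hmem u)).trans <|
      mul_le_mul_of_nonneg_left (toReal_eLpNorm_restrict_le_norm hIΩ u) (by positivity)
  have hosc : ‖(⨍ x in I, u x) - f y‖ ≤ √(volume.real I) * ‖g‖ :=
    (h.norm_setAverage_sub_le hord hfin (hmem u) (hmem g) huf hy hI subset_rfl h0).trans <|
      mul_le_mul_of_nonneg_left (toReal_eLpNorm_restrict_le_norm hIΩ g) (Real.sqrt_nonneg _)
  calc
    ‖f y‖ = ‖(⨍ x in I, u x) - ((⨍ x in I, u x) - f y)‖ := by rw [sub_sub_cancel]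
    _ ≤ _ := (_root_.norm_sub_le _ _).trans (add_le_add havg hosc)

theorem pointValue_eq (hΩ : IsOpen Ω) (hf : ContinuousOn f Ω) (huf : u =ᵐ[volume.restrict Ω] f)
    {x : ℝ} (hx : x ∈ Ω) : pointValue Ω u x = f x := by
  have hex : ∃ g : ℝ → ℂ, ContinuousOn g Ω ∧ u =ᵐ[volume.restrict Ω] g := ⟨f, hf, huf⟩
  rw [pointValue, dif_pos hex]
  exact Measure.eqOn_open_of_ae_eq (hex.choose_spec.2.symm.trans huf) hΩ hex.choose_spec.1 hf hx

theorem HasWeakDeriv.pointValue_spec (hΩ : IsOpen Ω) (hord : Ω.OrdConnected)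
    (h : HasWeakDeriv Ω 1 u g) :
    ContinuousOn (pointValue Ω u) Ω ∧ u =ᵐ[volume.restrict Ω] pointValue Ω u ∧
      IsPrimitiveOn Ω (pointValue Ω u) g := by
  have hloc (w : L2 Ω) : LocallyIntegrableOn w Ω :=
    locallyIntegrableOn_of_memLp one_le_two (Lp.memLp w)
  obtain ⟨f, hf, huf, hprim⟩ :=
    (hasWeakDeriv_line_iff.1 h).exists_isPrimitiveOn hΩ hord (hloc u) (hloc g)
  have heq : EqOn f (pointValue Ω u) Ω := fun x hx => (pointValue_eq hΩ hf huf hx).symm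
  refine ⟨hf.congr heq.symm, ?_, fun x hx y hy => ?_⟩
  · exact huf.trans (heq.aeEq_restrict hΩ.measurableSet)
  · rw [← heq hx, ← heq hy, hprim x hx y hy]

theorem HasWeakDeriv.norm_pointValue_le (hΩ : IsOpen Ω) (hord : Ω.OrdConnected)
    (h : HasWeakDeriv Ω 1 u g) {a b : ℝ} (hab : a < b) (hI : Ioo a b ⊆ Ω) {x : ℝ}
    (hx : x ∈ Ioo a b) :
    ‖pointValue Ω u x‖ ≤ (√(b - a))⁻¹ * ‖u‖ + √(b - a) * ‖g‖ := by
  obtain ⟨-, hae, hprim⟩ := h.pointValue_spec hΩ hord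
  rw [← Real.volume_real_Ioo_of_le hab.le]
  exact (hprim.mono hI).norm_le ordConnected_Ioo measure_Ioo_lt_top.ne (volume_Ioo_ne_zero hab)
    measurableSet_Ioo hI (ae_restrict_of_ae_restrict_of_subset hI hae) hx

/-- Evaluation at a point as a linear functional on the graph of the weak derivative. -/
noncomputable def pointValueLinear (hΩ : IsOpen Ω) (hord : Ω.OrdConnected) {x : ℝ} (hx : x ∈ Ω) :
    weakDerivGraph Ω (1 : ℝ) →ₗ[ℂ] ℂ where
  toFun p := pointValue Ω p.1.1 x
  map_add' p q := by
    obtain ⟨hp, hp', -⟩ := (mem_weakDerivGraph_iff.1 p.2).pointValue_spec hΩ hord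
    obtain ⟨hq, hq', -⟩ := (mem_weakDerivGraph_iff.1 q.2).pointValue_spec hΩ hord
    exact pointValue_eq hΩ (hp.add hq) ((Lp.coeFn_add p.1.1 q.1.1).trans (hp'.add hq')) hx
  map_smul' c p := by
    obtain ⟨hp, hp', -⟩ := (mem_weakDerivGraph_iff.1 p.2).pointValue_spec hΩ hord
    exact pointValue_eq hΩ (hp.const_smul c) ((Lp.coeFn_smul c p.1.1).trans (hp'.const_smul c)) hx

theorem exists_pointValue_functional (hΩ : IsOpen Ω) (hord : Ω.OrdConnected) {x : ℝ} (hx : x ∈ Ω) :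
    ∃ T : L2 Ω × L2 Ω →L[ℂ] ℂ, ∀ u g : L2 Ω, HasWeakDeriv Ω 1 u g →
      T (u, g) = pointValue Ω u x := by
  obtain ⟨r, hr, hball⟩ := Metric.isOpen_iff.1 hΩ x hx
  rw [Real.ball_eq_Ioo] at hball
  have hbound (p : weakDerivGraph Ω (1 : ℝ)) : ‖pointValueLinear hΩ hord hx p‖ ≤
      ((√(x + r - (x - r)))⁻¹ + √(x + r - (x - r))) * ‖p‖ := by
    refine ((mem_weakDerivGraph_iff.1 p.2).norm_pointValue_le hΩ hord (by linarith) hball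
      ⟨by linarith, by linarith⟩).trans ?_
    rw [add_mul]
    gcongr
    exacts [norm_fst_le p.1, norm_snd_le p.1]
  obtain ⟨T, hT, -⟩ :=
    exists_extension_norm_eq _ ((pointValueLinear hΩ hord hx).mkContinuous _ hbound)
  exact ⟨T, fun u g h => hT ⟨(u, g), mem_weakDerivGraph_iff.2 h⟩⟩

end PointValue

section LimitOperator

variable {Ω : Set ℝ} {V : ℝ → ℝ} {γ : ℝ} {f u v : LimitSpace Ω} {g k : L2 Ω}

theorem limitForm_eq (hΩ : IsOpen Ω) (hV : MemLp V ⊤ (volume.restrict Ω))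
    (hu : HasWeakDeriv Ω 1 u.fst g) (hv : HasWeakDeriv Ω 1 v.fst k) :
    limitForm Ω V γ u v = inner ℂ k g + inner ℂ v.fst (mulLp hV u.fst) +
      γ * pointValue Ω u.fst 0 * conj (pointValue Ω v.fst 0) := by
  have hae := mulLp_mul_conj_ae_eq hV u.fst v.fst
  rw [limitForm, hu.weakDeriv_eq hΩ, hv.weakDeriv_eq hΩ, integral_add (integrable_mul_conj g k)
    ((integrable_mul_conj (mulLp hV u.fst) v.fst).congr hae), ← integral_congr_ae hae,
    integral_mul_conj, integral_mul_conj]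

theorem inner_eq_of_mem_limitGraph (hΩ : IsOpen Ω) (hV : MemLp V ⊤ (volume.restrict Ω))
    (h : (u, f) ∈ limitGraph Ω V γ) (hu : HasWeakDeriv Ω 1 u.fst g)
    (hv : HasWeakDeriv Ω 1 v.fst k) :
    inner ℂ v f = inner ℂ k g + inner ℂ v.fst (mulLp hV u.fst) +
      γ * pointValue Ω u.fst 0 * conj (pointValue Ω v.fst 0) :=
  (h.2 v (mem_H1_line_iff.2 ⟨k, hv⟩)).trans (limitForm_eq hΩ hV hu hv)

theorem norm_le_of_mem_limitGraph (hΩ : IsOpen Ω) (hV : MemLp V ⊤ (volume.restrict Ω))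
    (hV0 : 0 ≤ᵐ[volume.restrict Ω] V) (hγ : 0 ≤ γ) (h : (u, f - u) ∈ limitGraph Ω V γ)
    (hu : HasWeakDeriv Ω 1 u.fst g) : ‖u‖ ≤ ‖f‖ ∧ ‖g‖ ≤ ‖f‖ := by
  have heq := congrArg Complex.re (inner_eq_of_mem_limitGraph hΩ hV h hu hu)
  rw [← inner_mulLp_sqrt hV hV0, mul_assoc, Complex.mul_conj, ← Complex.ofReal_mul,
    Complex.add_re, Complex.add_re, re_inner_self, re_inner_self, Complex.ofReal_re] at heq
  refine norm_le_of_norm_sq_le_re_inner_sub ?_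
  rw [heq, add_assoc]
  have := Complex.normSq_nonneg (pointValue Ω u.fst 0)
  exact le_add_of_nonneg_right (by positivity)

theorem exists_isFormFactorization_limitForm (hΩ : IsOpen Ω) (hord : Ω.OrdConnected)
    (h0 : (0 : ℝ) ∈ Ω) (hV : MemLp V ⊤ (volume.restrict Ω)) (hV0 : 0 ≤ᵐ[volume.restrict Ω] V)
    (hγ : 0 ≤ γ) :
    ∃ S : Submodule ℂ (LimitSpace Ω × WithLp 2 (WithLp 2 (L2 Ω × L2 Ω) × ℂ)),
      IsFormFactorization (limitDomain Ω) (limitForm Ω V γ) S := by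
  obtain ⟨T, hT⟩ := exists_pointValue_functional hΩ hord h0
  have hschrodinger := (isFormFactorization_weakDerivGraph hΩ (1 : ℝ)).add_bounded
    (b := fun u v => inner ℂ v (mulLp hV u))
    (mulLp (memLp_top_sqrt hV) ∘L ContinuousLinearMap.fst ℂ _ _)
    fun p _ q _ => (inner_mulLp_sqrt hV hV0 p.1 q.1).symm
  have hdelta := hschrodinger.add_bounded
    (b := fun u v => γ * pointValue Ω u 0 * conj (pointValue Ω v 0))
    (((√γ : ℝ) : ℂ) • T ∘L (ContinuousLinearMap.id ℂ _).prodMap (WithLp.fstL 2 ℂ _ _))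
    fun p hp q hq => by
      have hTp : T (p.1, p.2.fst) = pointValue Ω p.1 0 := hT _ _ (mem_weakDerivGraph_iff.1 hp.1)
      have hTq : T (q.1, q.2.fst) = pointValue Ω q.1 0 := hT _ _ (mem_weakDerivGraph_iff.1 hq.1)
      change _ = inner ℂ ((√γ : ℂ) * T (q.1, q.2.fst)) ((√γ : ℂ) * T (p.1, p.2.fst))
      have hsqrt : (√γ : ℂ) * √γ = γ := by rw [← Complex.ofReal_mul, Real.mul_self_sqrt hγ]
      rw [hTp, hTq, RCLike.inner_apply, map_mul, Complex.conj_ofReal, ← hsqrt]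
      ring
  have hdom : limitDomain Ω = WithLp.fstL 2 ℂ (L2 Ω) ℂ ⁻¹' {u | ∃ g, HasWeakDeriv Ω 1 u g} :=
    Set.ext fun u => mem_H1_line_iff
  rw [hdom]
  refine ⟨_, (hdelta.comap (WithLp.fstL 2 ℂ (L2 Ω) ℂ)).congr fun u hu v hv => ?_⟩
  exact limitForm_eq hΩ hV (hasWeakDeriv_weakDeriv hu) (hasWeakDeriv_weakDeriv hv)

theorem isResolvent_limitGraph (hΩ : IsOpen Ω) (hord : Ω.OrdConnected)
    (h0 : (0 : ℝ) ∈ Ω) (hV : MemLp V ⊤ (volume.restrict Ω)) (hV0 : 0 ≤ᵐ[volume.restrict Ω] V)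
    (hγ : 0 ≤ γ) : IsResolvent (limitGraph Ω V γ) (formResolvent (limitGraph Ω V γ)) :=
  have ⟨_, hS⟩ := exists_isFormFactorization_limitForm hΩ hord h0 hV hV0 hγ
  hS.isResolvent_formResolvent

theorem isSelfAdjoint_formResolvent_limitGraph (hΩ : IsOpen Ω) (hord : Ω.OrdConnected)
    (h0 : (0 : ℝ) ∈ Ω) (hV : MemLp V ⊤ (volume.restrict Ω)) (hV0 : 0 ≤ᵐ[volume.restrict Ω] V)
    (hγ : 0 ≤ γ) : IsSelfAdjoint (formResolvent (limitGraph Ω V γ)) :=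
  have ⟨_, hS⟩ := exists_isFormFactorization_limitForm hΩ hord h0 hV hV0 hγ
  hS.isSelfAdjoint_formResolvent

end LimitOperator

section TestFunctionAsVector

variable {E : Type*} [NormedAddCommGroup E] [NormedSpace ℝ E] [MeasureSpace E] [BorelSpace E]
  {U : Set E} {φ : E → ℝ}

/-- A test function as an element of the complex Hilbert space `L2 U`. -/
noncomputable def IsTestFunction.toL2 [IsFiniteMeasureOnCompacts (volume : Measure E)]
    (h : IsTestFunction U φ) : L2 U :=
  (h.memLp U).ofReal.toLp

theorem IsTestFunction.coeFn_toL2 [IsFiniteMeasureOnCompacts (volume : Measure E)]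
    (h : IsTestFunction U φ) : h.toL2 =ᵐ[volume.restrict U] fun x => (φ x : ℂ) :=
  (h.memLp U).ofReal.coeFn_toLp

theorem IsTestFunction.inner_toL2 [IsFiniteMeasureOnCompacts (volume : Measure E)]
    (h : IsTestFunction U φ) (u : L2 U) : inner ℂ h.toL2 u = ∫ x in U, φ x • u x :=
  integralSMul_apply (h.memLp U) u

theorem IsTestFunction.hasWeakDeriv_toL2 [FiniteDimensional ℝ E]
    [(volume : Measure E).IsAddHaarMeasure] (h : IsTestFunction U φ) (v : E) :
    HasWeakDeriv U v h.toL2 (h.fderiv_apply v).toL2 := by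
  rw [hasWeakDeriv_iff]
  intro χ hχ
  have hcoe {ψ : E → ℝ} (η : E → ℝ) (hψ : IsTestFunction U ψ) (hη : IsTestFunction U η) :
      ∫ x in U, η x • hψ.toL2 x = ((∫ x, η x * ψ x : ℝ) : ℂ) := by
    calc
      ∫ x in U, η x • hψ.toL2 x = ∫ x in U, ((η x * ψ x : ℝ) : ℂ) := by
        refine integral_congr_ae ?_
        filter_upwards [hψ.coeFn_toL2] with x hx
        rw [hx, Complex.real_smul, Complex.ofReal_mul]
      _ = ∫ x, ((η x * ψ x : ℝ) : ℂ) := setIntegral_eq_integral_of_forall_compl_eq_zero fun x hx =>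
        by rw [hη.eq_zero hx, zero_mul, Complex.ofReal_zero]
      _ = _ := integral_complex_ofReal
  have hint {ψ η : E → ℝ} (hψ : IsTestFunction U ψ) (hη : IsTestFunction U η) :
      Integrable fun x => η x * ψ x :=
    hη.integrable_smul (hψ.contDiff.continuous.locallyIntegrable.locallyIntegrableOn U)
  rw [hcoe _ h (hχ.fderiv_apply v), hcoe _ (h.fderiv_apply v) hχ,
    integral_mul_fderiv_eq_neg_fderiv_mul_of_integrable (hint h (hχ.fderiv_apply v))
      (hint (h.fderiv_apply v) hχ) (hint h hχ) (fun x _ => hχ.differentiableAt x)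
      fun x _ => h.differentiableAt x, Complex.ofReal_neg, neg_neg]

end TestFunctionAsVector

section LimitRegularity

variable {Ω A : Set ℝ} {V : ℝ → ℝ} {γ : ℝ} {f g : LimitSpace Ω} {g' : L2 Ω}

/-- Away from the origin the point interaction is invisible to the test functions, so that the
solution of the limit problem has a second weak derivative there. -/
theorem isWeakDeriv_of_mem_limitGraph (hΩ : IsOpen Ω) (h0 : (0 : ℝ) ∈ Ω) (hAΩ : A ⊆ Ω)
    (h0A : (0 : ℝ) ∉ A) (hV : MemLp V ⊤ (volume.restrict Ω)) (hg : (g, f - g) ∈ limitGraph Ω V γ)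
    (hg' : HasWeakDeriv Ω 1 g.fst g') :
    IsWeakDeriv A g' (g.fst + mulLp hV g.fst - f.fst : L2 Ω) := by
  intro φ hφ
  have hφΩ := hφ.mono hAΩ
  have hpoint : pointValue Ω hφΩ.toL2 0 = 0 := by
    rw [pointValue_eq hΩ (Complex.continuous_ofReal.comp hφ.contDiff.continuous).continuousOn
      hφΩ.coeFn_toL2 h0, Function.comp_apply, hφ.eq_zero h0A, Complex.ofReal_zero]
  have heq : inner ℂ hφΩ.toL2 (f.fst - g.fst) + inner ℂ (0 : ℂ) (f.snd - g.snd) =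
      inner ℂ (hφΩ.fderiv_apply 1).toL2 g' + inner ℂ hφΩ.toL2 (mulLp hV g.fst) +
        γ * pointValue Ω g.fst 0 * conj (pointValue Ω hφΩ.toL2 0) :=
    inner_eq_of_mem_limitGraph (v := WithLp.toLp 2 (hφΩ.toL2, 0)) hΩ hV hg hg'
      (hφΩ.hasWeakDeriv_toL2 1)
  rw [hpoint, inner_zero_left, map_zero, mul_zero, add_zero, add_zero, inner_sub_right] at heq
  rw [hφ.deriv.setIntegral_smul, ← hφΩ.deriv.setIntegral_smul, hφ.setIntegral_smul,
    ← hφΩ.setIntegral_smul, ← hφΩ.inner_toL2, inner_sub_right, inner_add_right]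
  simp only [← fderiv_apply_one_eq_deriv]
  rw [← (hφΩ.fderiv_apply 1).inner_toL2]
  linear_combination -heq

theorem IsWeakDeriv.norm_ae_le {u k : L2 Ω} {a b : ℝ} (h : IsWeakDeriv (Ioo a b) u k)
    (hab : a < b) (hI : Ioo a b ⊆ Ω) :
    ∀ᵐ x ∂(volume.restrict (Ioo a b)), ‖u x‖ ≤ (√(b - a))⁻¹ * ‖u‖ + √(b - a) * ‖k‖ := by
  have hloc (w : L2 Ω) : LocallyIntegrableOn w (Ioo a b) :=
    locallyIntegrableOn_of_memLp one_le_two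
      ((Lp.memLp w).mono_measure (Measure.restrict_mono hI le_rfl))
  obtain ⟨f, -, huf, hf⟩ := h.exists_isPrimitiveOn isOpen_Ioo ordConnected_Ioo (hloc u) (hloc k)
  rw [← Real.volume_real_Ioo_of_le hab.le]
  filter_upwards [huf, ae_restrict_mem measurableSet_Ioo] with x hx hxI
  rw [hx]
  exact hf.norm_le ordConnected_Ioo measure_Ioo_lt_top.ne (volume_Ioo_ne_zero hab)
    measurableSet_Ioo hI huf hxI

theorem inv_sqrt_le {K r : ℝ} (hK : 1 ≤ K) (hr : K⁻¹ ≤ r) : (√r)⁻¹ ≤ K := by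
  have hK0 : 0 < K := zero_lt_one.trans_le hK
  rw [inv_le_comm₀ (Real.sqrt_pos.2 ((inv_pos.2 hK0).trans_le hr)) hK0]
  exact Real.le_sqrt_of_sq_le
    ((pow_le_of_le_one (inv_nonneg.2 hK0.le) (inv_le_one_of_one_le₀ hK) two_ne_zero).trans hr)

variable {K N ρ : ℝ}

theorem norm_mulLp_le (hV : MemLp V ⊤ (volume.restrict Ω)) (hK : 0 ≤ K)
    (hVK : eLpNorm V ⊤ (volume.restrict Ω) ≤ ENNReal.ofReal K) (u : L2 Ω) :
    ‖mulLp hV u‖ ≤ K * ‖u‖ :=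
  (norm_mulLp_apply_le hV u).trans <|
    mul_le_mul_of_nonneg_right (ENNReal.toReal_le_of_le_ofReal hK hVK) (norm_nonneg u)

theorem ae_norm_deriv_le_of_mem_limitGraph (hΩ : IsOpen Ω) (hK : 1 ≤ K) (hρK : K⁻¹ ≤ ρ)
    (hρ1 : ρ ≤ 1) (hI : Ioo (-ρ) ρ ⊆ Ω) (hV : MemLp V ⊤ (volume.restrict Ω))
    (hVK : eLpNorm V ⊤ (volume.restrict Ω) ≤ ENNReal.ofReal K)
    (hg : (g, f - g) ∈ limitGraph Ω V γ) (hg' : HasWeakDeriv Ω 1 g.fst g')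
    (hfN : ‖f.fst‖ ≤ N) (hgN : ‖g.fst‖ ≤ N) (hg'N : ‖g'‖ ≤ N) :
    ∀ᵐ x ∂(volume.restrict (Ioo (-ρ) ρ)), ‖g' x‖ ≤ (2 * K + 2) * N := by
  have hK0 : 0 < K := zero_lt_one.trans_le hK
  have hρ : 0 < ρ := (inv_pos.2 hK0).trans_le hρK
  have hsecond : ‖g.fst + mulLp hV g.fst - f.fst‖ ≤ (2 + K) * N := calc
    ‖g.fst + mulLp hV g.fst - f.fst‖ ≤ ‖g.fst‖ + ‖mulLp hV g.fst‖ + ‖f.fst‖ :=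
      (norm_sub_le _ _).trans (add_le_add_left (norm_add_le _ _) _)
    _ ≤ N + K * N + N := by
      gcongr
      exact (norm_mulLp_le hV hK0.le hVK _).trans (mul_le_mul_of_nonneg_left hgN hK0.le)
    _ = (2 + K) * N := by ring
  have hhalf {a b : ℝ} (hab : a < b) (hlen : b - a = ρ) (hsub : Ioo a b ⊆ Ioo (-ρ) ρ)
      (h0 : (0 : ℝ) ∉ Ioo a b) :
      ∀ᵐ x ∂(volume.restrict (Ioo a b)), ‖g' x‖ ≤ (2 * K + 2) * N := by
    have hweak := isWeakDeriv_of_mem_limitGraph hΩ (hI ⟨neg_lt_zero.2 hρ, hρ⟩) (hsub.trans hI) h0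
      hV hg hg'
    filter_upwards [hweak.norm_ae_le hab (hsub.trans hI)] with x hx
    calc
      ‖g' x‖ ≤ (√ρ)⁻¹ * ‖g'‖ + √ρ * ‖g.fst + mulLp hV g.fst - f.fst‖ := hlen ▸ hx
      _ ≤ K * N + 1 * ((2 + K) * N) := by
        gcongr
        exacts [inv_sqrt_le hK hρK, Real.sqrt_le_one.2 hρ1]
      _ = (2 * K + 2) * N := by ring
  have hleft := hhalf (neg_lt_zero.2 hρ) (by ring) (Ioo_subset_Ioo_right hρ.le) (by simp)
  have hright := hhalf hρ (sub_zero ρ) (Ioo_subset_Ioo_left (neg_lt_zero.2 hρ).le) (by simp)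
  rw [ae_restrict_iff' measurableSet_Ioo] at hleft hright ⊢
  filter_upwards [hleft, hright, Measure.ae_ne volume 0] with x hxl hxr hx0 hx
  exact hx0.lt_or_gt.elim (fun h => hxl ⟨hx.1, h⟩) fun h => hxr ⟨h, hx.2⟩

theorem HasWeakDeriv.norm_pointValue_le_of_le (hΩ : IsOpen Ω) (hord : Ω.OrdConnected)
    {u : L2 Ω} (h : HasWeakDeriv Ω 1 u g') (hK : 1 ≤ K) (hρK : K⁻¹ ≤ ρ) (hρ1 : ρ ≤ 1)
    (hI : Ioo (-ρ) ρ ⊆ Ω) (huN : ‖u‖ ≤ N) (hg'N : ‖g'‖ ≤ N) {x : ℝ} (hx : x ∈ Ioo (-ρ) ρ) :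
    ‖pointValue Ω u x‖ ≤ (2 * K + 2) * N := by
  have hN : 0 ≤ N := (norm_nonneg _).trans huN
  have hK0 : 0 < K := zero_lt_one.trans_le hK
  have hρ : 0 < ρ := (inv_pos.2 hK0).trans_le hρK
  calc
    ‖pointValue Ω u x‖ ≤ (√(ρ - -ρ))⁻¹ * ‖u‖ + √(ρ - -ρ) * ‖g'‖ :=
      h.norm_pointValue_le hΩ hord (by linarith) hI hx
    _ ≤ K * N + 2 * N := by
      gcongr
      · exact inv_sqrt_le hK (by linarith)
      · exact (Real.sqrt_le_left two_pos.le).2 (by linarith)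
    _ ≤ (2 * K + 2) * N := by nlinarith

theorem HasWeakDeriv.norm_pointValue_sub_le (hΩ : IsOpen Ω) (hord : Ω.OrdConnected) {u : L2 Ω}
    (h : HasWeakDeriv Ω 1 u g') {I : Set ℝ} (hI : I ⊆ Ω) (hIord : I.OrdConnected) {C : ℝ}
    (hImeas : MeasurableSet I) (hC : ∀ᵐ x ∂(volume.restrict I), ‖g' x‖ ≤ C) {x y : ℝ} (hx : x ∈ I)
    (hy : y ∈ I) : ‖pointValue Ω u y - pointValue Ω u x‖ ≤ C * |y - x| := by
  rw [(h.pointValue_spec hΩ hord).2.2 x (hI hx) y (hI hy)]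
  rw [ae_restrict_iff' hImeas] at hC
  refine intervalIntegral.norm_integral_le_of_norm_le_const_ae ?_
  filter_upwards [hC] with t ht htx
  exact ht (hIord.uIcc_subset hx hy (uIoc_subset_uIcc htx))

end LimitRegularity

/-! ### Weak derivatives from sections -/

section Line

variable {I A : Set ℝ} {F G : ℝ → ℂ}

theorem IsTestFunction.integral_deriv_eq_zero {φ : ℝ → ℝ} (h : IsTestFunction I φ) :
    ∫ x, _root_.deriv φ x = 0 :=
  integral_eq_zero_of_hasDerivAt_of_integrable (fun x => (h.differentiableAt x).hasDerivAt)
    h.deriv.integrable h.integrable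

theorem IsWeakDeriv.mono (h : IsWeakDeriv I F G) (hA : A ⊆ I) : IsWeakDeriv A F G := by
  intro φ hφ
  rw [hφ.deriv.setIntegral_smul, hφ.setIntegral_smul]
  simpa only [(hφ.mono hA).deriv.setIntegral_smul, (hφ.mono hA).setIntegral_smul] using
    h φ (hφ.mono hA)

theorem isWeakDeriv_const (C : ℂ) : IsWeakDeriv I (fun _ => C) 0 := by
  intro φ hφ
  rw [hφ.deriv.setIntegral_smul, integral_smul_const, hφ.integral_deriv_eq_zero]
  simp

theorem IsWeakDeriv.const_mul_add_const (h : IsWeakDeriv I F G) (hF : LocallyIntegrableOn F I)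
    (c C : ℂ) : IsWeakDeriv I (fun x => c * F x + C) fun x => c * G x := by
  intro φ hφ
  simp only [smul_add, ← mul_smul_comm]
  rw [integral_add ((hφ.deriv.integrable_smul hF).const_mul c).integrableOn
    (hφ.deriv.integrable.smul_const C).integrableOn, integral_const_mul, integral_const_mul,
    h φ hφ, isWeakDeriv_const C φ hφ]
  simp

end Line

section Sections

variable {Ω : Set (ℝ × ℝ)} {φ : ℝ × ℝ → ℝ} {u g : L2 Ω} {U G : ℝ × ℝ → ℂ}

theorem IsTestFunction.section_fst (h : IsTestFunction Ω φ) (x : ℝ) :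
    IsTestFunction {y | (x, y) ∈ Ω} fun y => φ (x, y) := by
  have hsupp : tsupport (fun y => φ (x, y)) ⊆ {y | (x, y) ∈ tsupport φ} :=
    closure_minimal (fun y hy => subset_tsupport φ hy)
      ((isClosed_tsupport φ).preimage (Continuous.prodMk_right x))
  refine ⟨h.contDiff.comp (contDiff_prodMk_right x), ?_, fun y hy => h.tsupport_subset (hsupp hy)⟩
  exact (h.hasCompactSupport.isCompact.image continuous_snd).of_isClosed_subset
    (isClosed_tsupport _) fun y hy => ⟨(x, y), hsupp hy, rfl⟩

theorem IsTestFunction.section_snd (h : IsTestFunction Ω φ) (y : ℝ) :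
    IsTestFunction {x | (x, y) ∈ Ω} fun x => φ (x, y) := by
  have hsupp : tsupport (fun x => φ (x, y)) ⊆ {x | (x, y) ∈ tsupport φ} :=
    closure_minimal (fun x hx => subset_tsupport φ hx)
      ((isClosed_tsupport φ).preimage (Continuous.prodMk_left y))
  refine ⟨h.contDiff.comp (contDiff_prodMk_left y), ?_, fun x hx => h.tsupport_subset (hsupp hx)⟩
  exact (h.hasCompactSupport.isCompact.image continuous_fst).of_isClosed_subset
    (isClosed_tsupport _) fun x hx => ⟨(x, y), hsupp hx, rfl⟩

theorem IsTestFunction.deriv_section_fst (h : IsTestFunction Ω φ) (x y : ℝ) :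
    _root_.deriv (fun y => φ (x, y)) y = fderiv ℝ φ (x, y) (0, 1) :=
  ((h.differentiableAt (x, y)).hasFDerivAt.comp_hasDerivAt y
    ((hasDerivAt_const y x).prodMk (hasDerivAt_id y))).deriv

theorem IsTestFunction.deriv_section_snd (h : IsTestFunction Ω φ) (x y : ℝ) :
    _root_.deriv (fun x => φ (x, y)) x = fderiv ℝ φ (x, y) (1, 0) :=
  ((h.differentiableAt (x, y)).hasFDerivAt.comp_hasDerivAt x
    ((hasDerivAt_id x).prodMk (hasDerivAt_const x y))).deriv

theorem IsTestFunction.integrable_smul_of_ae_eq (h : IsTestFunction Ω φ)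
    (hu : u =ᵐ[volume.restrict Ω] U) : Integrable fun p => φ p • U p :=
  h.integrable_smul (locallyIntegrableOn_of_memLp one_le_two ((memLp_congr_ae hu).1 (Lp.memLp u)))

theorem IsTestFunction.setIntegral_smul_of_ae_eq (h : IsTestFunction Ω φ)
    (hu : u =ᵐ[volume.restrict Ω] U) : ∫ p in Ω, φ p • u p = ∫ p, φ p • U p := by
  rw [← h.setIntegral_smul U]
  refine integral_congr_ae ?_
  filter_upwards [hu] with p hp
  rw [hp]

theorem hasWeakDeriv_snd_of_sections (hu : u =ᵐ[volume.restrict Ω] U)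
    (hg : g =ᵐ[volume.restrict Ω] G)
    (h : ∀ x, IsWeakDeriv {y | (x, y) ∈ Ω} (fun y => U (x, y)) fun y => G (x, y)) :
    HasWeakDeriv Ω (0, 1) u g := by
  rw [hasWeakDeriv_iff]
  intro φ hφ
  have hφ' := hφ.fderiv_apply (0, 1)
  have hint' := hφ'.integrable_smul_of_ae_eq hu
  have hint := hφ.integrable_smul_of_ae_eq hg
  rw [hφ'.setIntegral_smul_of_ae_eq hu, hφ.setIntegral_smul_of_ae_eq hg]
  rw [Measure.volume_eq_prod] at hint hint' ⊢
  rw [integral_prod _ hint, integral_prod _ hint', ← integral_neg]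
  refine integral_congr_ae (ae_of_all _ fun x => ?_)
  have hsec := hφ.section_fst x
  have hx := h x _ hsec
  rw [hsec.deriv.setIntegral_smul, hsec.setIntegral_smul] at hx
  simpa only [hφ.deriv_section_fst] using hx

theorem hasWeakDeriv_fst_of_sections (hu : u =ᵐ[volume.restrict Ω] U)
    (hg : g =ᵐ[volume.restrict Ω] G)
    (h : ∀ y, IsWeakDeriv {x | (x, y) ∈ Ω} (fun x => U (x, y)) fun x => G (x, y)) :
    HasWeakDeriv Ω (1, 0) u g := by
  rw [hasWeakDeriv_iff]
  intro φ hφ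
  have hφ' := hφ.fderiv_apply (1, 0)
  have hint' := hφ'.integrable_smul_of_ae_eq hu
  have hint := hφ.integrable_smul_of_ae_eq hg
  rw [hφ'.setIntegral_smul_of_ae_eq hu, hφ.setIntegral_smul_of_ae_eq hg]
  rw [Measure.volume_eq_prod] at hint hint' ⊢
  rw [integral_prod_symm _ hint, integral_prod_symm _ hint', ← integral_neg]
  refine integral_congr_ae (ae_of_all _ fun y => ?_)
  have hsec := hφ.section_snd y
  have hy := h y _ hsec
  rw [hsec.deriv.setIntegral_smul, hsec.setIntegral_smul] at hy
  simpa only [hφ.deriv_section_snd] using hy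

end Sections

section Ramp

variable {h y : ℝ}

/-- The continuous cut-off function which is `1` on `(-∞, 0]`, vanishes on `[h, ∞)` and is affine in
between; it interpolates between the strip and the room along the passage. -/
noncomputable def ramp (h y : ℝ) : ℝ := max 0 (min 1 (1 - y / h))

theorem continuous_ramp (h : ℝ) : Continuous (ramp h) := by
  unfold ramp
  fun_prop

theorem ramp_nonneg (h y : ℝ) : 0 ≤ ramp h y := le_max_left _ _

theorem ramp_le_one (h y : ℝ) : ramp h y ≤ 1 := max_le zero_le_one (min_le_left _ _)

theorem ramp_of_nonpos (hh : 0 < h) (hy : y ≤ 0) : ramp h y = 1 := by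
  have hyh : y / h ≤ 0 := div_nonpos_of_nonpos_of_nonneg hy hh.le
  rw [ramp, min_eq_left (by linarith), max_eq_right zero_le_one]

theorem ramp_of_mem_Icc (hh : 0 < h) (hy : y ∈ Icc 0 h) : ramp h y = 1 - y / h := by
  have hy0 : 0 ≤ y / h := div_nonneg hy.1 hh.le
  have hy1 : y / h ≤ 1 := (div_le_one hh).2 hy.2
  rw [ramp, min_eq_right (by linarith), max_eq_right (by linarith)]

theorem ramp_of_ge (hh : 0 < h) (hy : h ≤ y) : ramp h y = 0 := by
  have hyh : 1 ≤ y / h := (one_le_div hh).2 hy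
  rw [ramp, min_eq_right (by linarith), max_eq_left (by linarith)]

theorem intervalIntegral_indicator_eq_ramp (hh : 0 < h) (y : ℝ) :
    ∫ t in h..y, (Ioc 0 h).indicator (fun _ => -(h : ℂ)⁻¹) t = ramp h y := by
  have hhC : (h : ℂ) ≠ 0 := Complex.ofReal_ne_zero.2 hh.ne'
  rcases le_total h y with hy | hy
  · rw [ramp_of_ge hh hy, intervalIntegral.integral_of_le hy,
      setIntegral_indicator measurableSet_Ioc, Ioc_inter_Ioc]
    simp [hh.le]
  · rw [intervalIntegral.integral_of_ge hy, setIntegral_indicator measurableSet_Ioc, Ioc_inter_Ioc]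
    rcases le_total y 0 with hy0 | hy0
    · simp [ramp_of_nonpos hh hy0, hy0, hh.le, hhC]
    · simp [ramp_of_mem_Icc hh ⟨hy0, hy⟩, hy0, hy, sub_mul, hhC, div_eq_mul_inv]

theorem isWeakDeriv_ramp (hh : 0 < h) :
    IsWeakDeriv univ (fun y => (ramp h y : ℂ)) ((Ioc 0 h).indicator fun _ => -(h : ℂ)⁻¹) := by
  have hint : LocallyIntegrableOn ((Ioc 0 h).indicator fun _ => -(h : ℂ)⁻¹) univ :=
    ((integrableOn_const (by simp)).integrable_indicator
      measurableSet_Ioc).locallyIntegrable.locallyIntegrableOn _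
  simpa only [intervalIntegral_indicator_eq_ramp hh] using
    isWeakDeriv_primitive isOpen_univ ordConnected_univ hint (mem_univ h)

end Ramp

/-! ### The waveguide and the identification operators -/

section Geometry

variable {lm lp : EReal} {ε d h b : ℝ}

theorem ordConnected_interval (lm lp : EReal) : (interval lm lp).OrdConnected :=
  ⟨fun _ hx _ hy _ hz => ⟨hx.1.trans_le (EReal.coe_le_coe_iff.2 hz.1),
    (EReal.coe_le_coe_iff.2 hz.2).trans_lt hy.2⟩⟩

theorem isOpen_waveguide (lm lp : EReal) (ε d h b : ℝ) : IsOpen (waveguide lm lp ε d h b) :=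
  isOpen_interior

theorem passage_subset (lm lp : EReal) (ε d h b : ℝ) :
    passage d h ⊆ waveguide lm lp ε d h b := fun _ hx =>
  union_subset_waveguide lm lp ε d h b (Or.inl (Or.inr hx))

theorem convex_strip (lm lp : EReal) (ε : ℝ) : Convex ℝ (strip lm lp ε) :=
  (ordConnected_interval lm lp).convex.prod (convex_Ioo _ _)

theorem convex_passage (d h : ℝ) : Convex ℝ (passage d h) := by
  rw [passage_eq_prod]
  exact (convex_Ioo _ _).prod (convex_Ioo _ _)

theorem convex_room (h b : ℝ) : Convex ℝ (room h b) := by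
  rw [room_eq_prod]
  exact (convex_Ioo _ _).prod (convex_Ioo _ _)

theorem ae_mem_union_of_mem_waveguide (lm lp : EReal) (ε d h b : ℝ) :
    ∀ᵐ x ∂(volume.restrict (waveguide lm lp ε d h b)),
      x ∈ strip lm lp ε ∪ passage d h ∪ room h b := by
  have hclosure {s : Set (ℝ × ℝ)} (hs : Convex ℝ s) : ∀ᵐ x, x ∈ closure s ↔ x ∈ s :=
    (closure_ae_eq_of_null_frontier (hs.addHaar_frontier volume)).mem_iff
  rw [ae_restrict_iff' (isOpen_waveguide lm lp ε d h b).measurableSet]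
  filter_upwards [hclosure (convex_strip lm lp ε), hclosure (convex_passage d h),
    hclosure (convex_room h b)] with x hS hP hR hx
  have hcl := interior_subset hx
  rwa [closure_union, closure_union, mem_union, mem_union, hS, hP, hR] at hcl

theorem prod_Ioo_subset_waveguide (hd : 0 < d) (hh : 0 < h) (hdb : d ≤ b)
    (hdI : Ioo (-(d / 2)) (d / 2) ⊆ interval lm lp) :
    Ioo (-(d / 2)) (d / 2) ×ˢ Ioo (-ε) (h + b) ⊆ waveguide lm lp ε d h b := by
  refine interior_maximal ?_ (isOpen_Ioo.prod isOpen_Ioo)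
  have hclosure : Icc (-(d / 2)) (d / 2) ×ˢ Icc 0 h ⊆ closure (passage d h) := by
    rw [passage_eq_prod, closure_prod_eq, closure_Ioo (by linarith), closure_Ioo (by linarith)]
  rintro ⟨x, y⟩ ⟨hx, hy⟩
  rcases lt_or_ge y 0 with hy0 | hy0
  · exact subset_closure (Or.inl (Or.inl ⟨hdI hx, hy.1, hy0⟩))
  rcases le_or_gt y h with hyh | hyh
  · exact closure_mono (subset_union_right.trans subset_union_left)
      (hclosure ⟨Ioo_subset_Icc_self hx, hy0, hyh⟩)
  · refine subset_closure (Or.inr ?_)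
    rw [room_eq_prod]
    exact ⟨⟨by linarith [hx.1], by linarith [hx.2]⟩, hyh, hy.2⟩

theorem fst_mem_interval_of_mem_waveguide (hdI : Ioo (-(d / 2)) (d / 2) ⊆ interval lm lp)
    {x : ℝ × ℝ} (hx : x ∈ waveguide lm lp ε d h b) (hxh : x.2 < h) : x.1 ∈ interval lm lp := by
  have hclosure : Prod.fst '' (waveguide lm lp ε d h b ∩ {y | y.2 < h}) ⊆
      closure (interval lm lp) := by
    rintro _ ⟨y, ⟨hy, hyh⟩, rfl⟩
    have hcl := interior_subset hy
    rw [closure_union, closure_union, strip, passage_eq_prod, room_eq_prod, closure_prod_eq,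
      closure_prod_eq, closure_prod_eq] at hcl
    rcases hcl with (hS | hP) | hR
    · exact hS.1
    · exact closure_mono hdI hP.1
    · exact absurd (closure_minimal Ioo_subset_Icc_self isClosed_Icc hR.2).1 (not_le.2 hyh)
  have hopen : IsOpen (Prod.fst '' (waveguide lm lp ε d h b ∩ {y | y.2 < h})) :=
    isOpenMap_fst _ ((isOpen_waveguide lm lp ε d h b).inter
      (isOpen_lt continuous_snd continuous_const))
  have hmem := interior_maximal hclosure hopen ⟨x, ⟨hx, hxh⟩, rfl⟩
  have hint := (isOpen_interval lm lp).interior_eq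
  have hne : (interior (interval lm lp)).Nonempty := by
    rw [hint, ← closure_nonempty_iff]
    exact ⟨_, interior_subset hmem⟩
  have hconvex : Convex ℝ (interval lm lp) := (ordConnected_interval lm lp).convex
  rwa [hconvex.interior_closure_eq_interior_of_nonempty_interior hne, hint] at hmem

theorem memLp_potential (d h b : ℝ) {V₀ : ℝ → ℝ}
    (hV : MemLp V₀ ⊤ (volume.restrict (interval lm lp))) :
    MemLp (potential lm lp ε V₀) ⊤ (volume.restrict (waveguide lm lp ε d h b)) := by
  have hindicator : potential lm lp ε V₀ = (strip lm lp ε).indicator fun x => V₀ x.1 := by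
    ext x
    by_cases hx : x ∈ strip lm lp ε <;> simp [potential, hx]
  rw [hindicator, memLp_indicator_iff_restrict (isOpen_strip lm lp ε).measurableSet,
    Measure.restrict_restrict_of_subset (strip_subset lm lp ε d h b), restrict_strip]
  exact hV.comp_fst _

theorem ae_mem_strip_imp {p : ℝ → Prop} (ε : ℝ)
    (hp : ∀ᵐ x ∂(volume.restrict (interval lm lp)), p x) :
    ∀ᵐ x : ℝ × ℝ, x ∈ strip lm lp ε → p x.1 := by
  rw [← ae_restrict_iff' (isOpen_strip lm lp ε).measurableSet, restrict_strip]
  exact Measure.quasiMeasurePreserving_fst.ae hp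

theorem ae_potential_nonneg (ε d h b : ℝ) {V₀ : ℝ → ℝ}
    (hV0 : 0 ≤ᵐ[volume.restrict (interval lm lp)] V₀) :
    0 ≤ᵐ[volume.restrict (waveguide lm lp ε d h b)] potential lm lp ε V₀ := by
  filter_upwards [ae_restrict_of_ae (ae_mem_strip_imp ε hV0)] with x hx
  by_cases hxS : x ∈ strip lm lp ε
  · simpa [potential, hxS] using hx hxS
  · simp [potential, hxS]

end Geometry

section Identification

variable (lm lp : EReal) (ε d h b : ℝ)

theorem liftStrip_ae_eq (f : L2 (interval lm lp)) :
    liftStrip lm lp ε d h b f =ᵐ[volume.restrict (waveguide lm lp ε d h b)]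
      (strip lm lp ε).indicator fun x => ((ε ^ (-(1 / 2) : ℝ) : ℝ) : ℂ) * f x.1 :=
  MemLp.coeFn_toLp (memLp_liftFun lm lp ε d h b (Lp.memLp f))

theorem averageStrip_ae_eq (u : L2 (waveguide lm lp ε d h b)) :
    averageStrip lm lp ε d h b u =ᵐ[volume.restrict (interval lm lp)] fun x =>
      ((ε ^ (-(1 / 2) : ℝ) : ℝ) : ℂ) * ∫ y in Ioo (-ε) 0, u (x, y) :=
  MemLp.coeFn_toLp (memLp_sectionFun lm lp ε d h b u)

theorem liftRoom_ae_eq (c : ℂ) :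
    liftRoom lm lp ε d h b c =ᵐ[volume.restrict (waveguide lm lp ε d h b)]
      (room h b).indicator fun _ => ((b⁻¹ : ℝ) : ℂ) * c := by
  have hJ := J_apply_ae lm lp ε d h b (WithLp.toLp 2 (0, c))
  have hzero := Lp.coeFn_zero ℂ 2 (volume.restrict (interval lm lp))
  have hJc : J lm lp ε d h b (WithLp.toLp 2 (0, c)) = liftRoom lm lp ε d h b c := by
    simp [J]
  rw [hJc] at hJ
  filter_upwards [hJ, ae_restrict_of_ae (ae_mem_strip_imp ε hzero)] with x hx hx0
  rw [hx]
  refine add_eq_right.2 (indicator_apply_eq_zero.2 fun hxS => ?_)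
  change _ * (0 : L2 (interval lm lp)) x.1 = 0
  rw [hx0 hxS, Pi.zero_apply, mul_zero]

variable {lm lp ε d h b}

theorem inner_eq_setIntegral {X : Type*} [MeasurableSpace X] {μ : Measure X} {Ω S : Set X}
    (hS : MeasurableSet S) (hSΩ : S ⊆ Ω) {p : Lp ℂ 2 (μ.restrict Ω)} {F : X → ℂ}
    (hp : p =ᵐ[μ.restrict Ω] S.indicator F) (u : Lp ℂ 2 (μ.restrict Ω)) :
    IntegrableOn (fun x => u x * conj (F x)) S μ ∧ inner ℂ p u = ∫ x in S, u x * conj (F x) ∂μ := by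
  have hae : (fun x => u x * conj (p x)) =ᵐ[μ.restrict Ω]
      S.indicator fun x => u x * conj (F x) := by
    filter_upwards [hp] with x hx
    rw [hx]
    by_cases hxS : x ∈ S <;> simp [hxS]
  have hint := integrable_mul_conj u p
  rw [integrable_congr hae, integrable_indicator_iff hS, IntegrableOn,
    Measure.restrict_restrict_of_subset hSΩ] at hint
  rw [← integral_mul_conj, integral_congr_ae hae, integral_indicator hS,
    Measure.restrict_restrict_of_subset hSΩ]
  exact ⟨hint, rfl⟩

theorem inner_liftStrip (f : L2 (interval lm lp)) (u : L2 (waveguide lm lp ε d h b)) :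
    inner ℂ (liftStrip lm lp ε d h b f) u = inner ℂ f (averageStrip lm lp ε d h b u) := by
  obtain ⟨hint, heq⟩ := inner_eq_setIntegral (isOpen_strip lm lp ε).measurableSet
    (strip_subset lm lp ε d h b) (liftStrip_ae_eq lm lp ε d h b f) u
  rw [IntegrableOn, restrict_strip] at hint
  rw [heq, restrict_strip, integral_prod _ hint, ← integral_mul_conj]
  refine integral_congr_ae ?_
  filter_upwards [averageStrip_ae_eq lm lp ε d h b u] with x hx
  rw [hx, integral_mul_const, map_mul, Complex.conj_ofReal]
  ring

theorem inner_liftRoom (c : ℂ) (u : L2 (waveguide lm lp ε d h b)) :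
    inner ℂ (liftRoom lm lp ε d h b c) u = inner ℂ c (averageRoom lm lp ε d h b u) := by
  rw [(inner_eq_setIntegral (isOpen_room h b).measurableSet (room_subset lm lp ε d h b)
    (liftRoom_ae_eq lm lp ε d h b c) u).2, RCLike.inner_apply, integral_mul_const, map_mul,
    Complex.conj_ofReal]
  change _ = ((b⁻¹ : ℝ) : ℂ) * (∫ x in room h b, u x) * conj c
  ring

theorem J_apply (f : LimitSpace (interval lm lp)) :
    J lm lp ε d h b f = liftStrip lm lp ε d h b f.fst + liftRoom lm lp ε d h b f.snd := rfl

theorem inner_J_left (f : LimitSpace (interval lm lp)) (u : L2 (waveguide lm lp ε d h b)) :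
    inner ℂ (J lm lp ε d h b f) u = inner ℂ f (JTilde lm lp ε d h b u) := by
  rw [J_apply, inner_add_left, inner_liftStrip, inner_liftRoom, WithLp.prod_inner_apply]
  rfl

theorem adjoint_J : (J lm lp ε d h b).adjoint = JTilde lm lp ε d h b :=
  (ContinuousLinearMap.eq_adjoint_iff _ _).2
    (fun u f => by rw [← inner_conj_symm, ← inner_J_left, inner_conj_symm]) |>.symm

theorem norm_resolvent_difference_eq
    {A : L2 (waveguide lm lp ε d h b) →L[ℂ] L2 (waveguide lm lp ε d h b)}
    {B : LimitSpace (interval lm lp) →L[ℂ] LimitSpace (interval lm lp)}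
    (hA : IsSelfAdjoint A) (hB : IsSelfAdjoint B) :
    ‖A ∘L J lm lp ε d h b - J lm lp ε d h b ∘L B‖ =
      ‖JTilde lm lp ε d h b ∘L A - B ∘L JTilde lm lp ε d h b‖ := by
  rw [← LinearIsometryEquiv.norm_map ContinuousLinearMap.adjoint (A ∘L J lm lp ε d h b - _),
    map_sub, ContinuousLinearMap.adjoint_comp, ContinuousLinearMap.adjoint_comp, adjoint_J,
    ContinuousLinearMap.isSelfAdjoint_iff'.1 hA, ContinuousLinearMap.isSelfAdjoint_iff'.1 hB]

theorem integral_smul_averageStrip (χ : ℝ → ℝ) (u : L2 (waveguide lm lp ε d h b)) :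
    ∫ x in interval lm lp, χ x • averageStrip lm lp ε d h b u x =
      ((ε ^ (-(1 / 2) : ℝ) : ℝ) : ℂ) *
        ∫ x in interval lm lp, χ x • ∫ y in Ioo (-ε) 0, u (x, y) := by
  rw [← integral_const_mul]
  refine integral_congr_ae ?_
  filter_upwards [averageStrip_ae_eq lm lp ε d h b u] with x hx
  rw [hx, mul_smul_comm]

theorem hasWeakDeriv_averageStrip {u g : L2 (waveguide lm lp ε d h b)}
    (hg : HasWeakDeriv (waveguide lm lp ε d h b) (1, 0) u g) :
    HasWeakDeriv (interval lm lp) 1 (averageStrip lm lp ε d h b u)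
      (averageStrip lm lp ε d h b g) := by
  rw [hasWeakDeriv_line_iff]
  intro φ hφ
  rw [integral_smul_averageStrip, integral_smul_averageStrip,
    hg.isWeakDeriv_integral_snd isOpen_Ioo (strip_subset lm lp ε d h b) φ hφ, mul_neg]

end Identification

/-! ### Gluing across the passage -/

section Bridge

variable {lm lp : EReal} {ε d h b : ℝ}

/-- The transition from the profile `G` of the strip to the constant `C` of the room, linear in the
height along the passage `0 < x₂ < h`. -/
noncomputable def bridge (h : ℝ) (G : ℝ → ℂ) (C : ℂ) (x : ℝ × ℝ) : ℂ :=
  ramp h x.2 * (G x.1 - C) + C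

/-- The horizontal derivative of `bridge h G C`, where `G'` is the derivative of `G`. -/
noncomputable def bridgeDerivFst (h : ℝ) (G' : ℝ → ℂ) (x : ℝ × ℝ) : ℂ :=
  ramp h x.2 * G' x.1

/-- The vertical derivative of `bridge h G C`. -/
noncomputable def bridgeDerivSnd (h : ℝ) (G : ℝ → ℂ) (C : ℂ) (x : ℝ × ℝ) : ℂ :=
  (G x.1 - C) * (Ioc 0 h).indicator (fun _ => -(h : ℂ)⁻¹) x.2

theorem liftStrip_add_liftRoom_ae_eq (hh : 0 < h) (g : L2 (interval lm lp)) (c : ℂ)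
    {p : L2 (waveguide lm lp ε d h b)} {U : ℝ × ℝ → ℂ}
    (hp : p =ᵐ[volume.restrict (waveguide lm lp ε d h b)] (passage d h).indicator U)
    (hstrip : ∀ x ∈ strip lm lp ε, U x = ((ε ^ (-(1 / 2) : ℝ) : ℝ) : ℂ) * g x.1)
    (hroom : ∀ x ∈ room h b, U x = ((b⁻¹ : ℝ) : ℂ) * c) :
    (liftStrip lm lp ε d h b g + p + liftRoom lm lp ε d h b c : L2 (waveguide lm lp ε d h b))
      =ᵐ[volume.restrict (waveguide lm lp ε d h b)] U := by
  filter_upwards [Lp.coeFn_add (liftStrip lm lp ε d h b g + p) (liftRoom lm lp ε d h b c),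
    Lp.coeFn_add (liftStrip lm lp ε d h b g) p, hp, liftStrip_ae_eq lm lp ε d h b g,
    liftRoom_ae_eq lm lp ε d h b c, ae_mem_union_of_mem_waveguide lm lp ε d h b]
    with x hadd hadd' hp hS hR hx
  rw [hadd, Pi.add_apply, hadd', Pi.add_apply, hp, hS, hR]
  rcases hx with (hxS | hxP) | hxR
  · have hP : x ∉ passage d h := fun hx => hx.2.1.not_gt hxS.2.2
    have hR : x ∉ room h b := fun hx => (hh.trans hx.2.1).not_gt hxS.2.2
    simp [hxS, hP, hR, hstrip x hxS]
  · have hS : x ∉ strip lm lp ε := fun hx => hxP.2.1.not_gt hx.2.2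
    have hR : x ∉ room h b := fun hx => hx.2.1.not_gt hxP.2.2
    simp [hxP, hS, hR]
  · have hS : x ∉ strip lm lp ε := fun hx => (hh.trans hxR.2.1).not_gt hx.2.2
    have hP : x ∉ passage d h := fun hx => hxR.2.1.not_gt hx.2.2
    simp [hxR, hS, hP, hroom x hxR]

theorem ae_eq_bridge (hh : 0 < h) (g : L2 (interval lm lp)) (c : ℂ)
    {p : L2 (waveguide lm lp ε d h b)}
    (hp : p =ᵐ[volume.restrict (waveguide lm lp ε d h b)] (passage d h).indicator
      (bridge h (fun t => ((ε ^ (-(1 / 2) : ℝ) : ℝ) : ℂ) * g t) (((b⁻¹ : ℝ) : ℂ) * c))) :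
    (liftStrip lm lp ε d h b g + p + liftRoom lm lp ε d h b c : L2 (waveguide lm lp ε d h b))
      =ᵐ[volume.restrict (waveguide lm lp ε d h b)]
        bridge h (fun t => ((ε ^ (-(1 / 2) : ℝ) : ℝ) : ℂ) * g t) (((b⁻¹ : ℝ) : ℂ) * c) :=
  liftStrip_add_liftRoom_ae_eq hh g c hp
    (fun x hx => by simp [bridge, ramp_of_nonpos hh hx.2.2.le])
    (fun x hx => by simp [bridge, ramp_of_ge hh hx.2.1.le])

theorem ae_eq_bridgeDerivFst (hh : 0 < h) (g' : L2 (interval lm lp))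
    {p : L2 (waveguide lm lp ε d h b)}
    (hp : p =ᵐ[volume.restrict (waveguide lm lp ε d h b)] (passage d h).indicator
      (bridgeDerivFst h fun t => ((ε ^ (-(1 / 2) : ℝ) : ℝ) : ℂ) * g' t)) :
    (liftStrip lm lp ε d h b g' + p : L2 (waveguide lm lp ε d h b))
      =ᵐ[volume.restrict (waveguide lm lp ε d h b)]
        bridgeDerivFst h fun t => ((ε ^ (-(1 / 2) : ℝ) : ℝ) : ℂ) * g' t := by
  simpa only [map_zero, add_zero] using liftStrip_add_liftRoom_ae_eq hh g' 0 hp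
    (fun x hx => by simp [bridgeDerivFst, ramp_of_nonpos hh hx.2.2.le])
    (fun x hx => by simp [bridgeDerivFst, ramp_of_ge hh hx.2.1.le])

theorem ae_eq_bridgeDerivSnd {G : ℝ → ℂ} {C : ℂ} {p : L2 (waveguide lm lp ε d h b)}
    (hp : p =ᵐ[volume.restrict (waveguide lm lp ε d h b)]
      (passage d h).indicator (bridgeDerivSnd h G C)) :
    p =ᵐ[volume.restrict (waveguide lm lp ε d h b)] bridgeDerivSnd h G C := by
  filter_upwards [hp, ae_mem_union_of_mem_waveguide lm lp ε d h b] with x hpx hx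
  rw [hpx]
  refine indicator_apply_eq_self.2 fun hxP => ?_
  suffices x.2 ∉ Ioc 0 h by simp [bridgeDerivSnd, this]
  rcases hx with (hxS | hxP') | hxR
  · exact fun hx => hx.1.not_gt hxS.2.2
  · exact absurd hxP' hxP
  · exact fun hx => hx.2.not_gt hxR.2.1

theorem hasWeakDeriv_snd_bridge (hh : 0 < h) {G : ℝ → ℂ} {C : ℂ} {Ω : Set (ℝ × ℝ)} {u p : L2 Ω}
    (hu : u =ᵐ[volume.restrict Ω] bridge h G C)
    (hp : p =ᵐ[volume.restrict Ω] bridgeDerivSnd h G C) : HasWeakDeriv Ω (0, 1) u p := by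
  refine hasWeakDeriv_snd_of_sections hu hp fun x => ?_
  have hloc : Continuous fun y => (ramp h y : ℂ) :=
    Complex.continuous_ofReal.comp (continuous_ramp h)
  simpa only [bridge, bridgeDerivSnd, mul_comm (ramp h _ : ℂ)] using
    ((isWeakDeriv_ramp hh).mono (subset_univ _)).const_mul_add_const
      (hloc.locallyIntegrable.locallyIntegrableOn _) (G x - C) C

theorem hasWeakDeriv_fst_bridge (hh : 0 < h) {I : Set ℝ} {G G' : ℝ → ℂ} {C : ℂ}
    {Ω : Set (ℝ × ℝ)} {u p : L2 Ω} (hG : IsWeakDeriv I G G') (hGI : LocallyIntegrableOn G I)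
    (hΩ : ∀ x ∈ Ω, x.2 < h → x.1 ∈ I) (hu : u =ᵐ[volume.restrict Ω] bridge h G C)
    (hp : p =ᵐ[volume.restrict Ω] bridgeDerivFst h G') : HasWeakDeriv Ω (1, 0) u p := by
  refine hasWeakDeriv_fst_of_sections hu hp fun y => ?_
  rcases lt_or_ge y h with hy | hy
  · have hsection : {x | (x, y) ∈ Ω} ⊆ I := fun x hx => hΩ (x, y) hx hy
    have hbridge : ∀ x, bridge h G C (x, y) = ramp h y * G x + (C - ramp h y * C) := fun x => by
      rw [bridge]
      ring
    simpa only [hbridge, bridgeDerivFst] using (hG.mono hsection).const_mul_add_const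
      (hGI.mono_set hsection) (ramp h y) (C - ramp h y * C)
  · simpa [bridge, bridgeDerivFst, ramp_of_ge hh hy, Pi.zero_def] using isWeakDeriv_const C

theorem hasWeakDeriv_fst_add_liftRoom (hh : 0 < h)
    (hdI : Ioo (-(d / 2)) (d / 2) ⊆ interval lm lp) {g g' : L2 (interval lm lp)}
    (hg : HasWeakDeriv (interval lm lp) 1 g g') (c : ℂ) {p₀ p₁ : L2 (waveguide lm lp ε d h b)}
    (hp₀ : p₀ =ᵐ[volume.restrict (waveguide lm lp ε d h b)] (passage d h).indicator
      (bridge h (fun t => ((ε ^ (-(1 / 2) : ℝ) : ℝ) : ℂ) * g t) (((b⁻¹ : ℝ) : ℂ) * c)))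
    (hp₁ : p₁ =ᵐ[volume.restrict (waveguide lm lp ε d h b)] (passage d h).indicator
      (bridgeDerivFst h fun t => ((ε ^ (-(1 / 2) : ℝ) : ℝ) : ℂ) * g' t)) :
    HasWeakDeriv (waveguide lm lp ε d h b) (1, 0)
      (liftStrip lm lp ε d h b g + p₀ + liftRoom lm lp ε d h b c)
      (liftStrip lm lp ε d h b g' + p₁) := by
  have hloc := locallyIntegrableOn_of_memLp one_le_two (Lp.memLp g)
  have hmul : IsWeakDeriv (interval lm lp) (fun t => ((ε ^ (-(1 / 2) : ℝ) : ℝ) : ℂ) * g t)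
      fun t => ((ε ^ (-(1 / 2) : ℝ) : ℝ) : ℂ) * g' t := by
    simpa only [add_zero] using
      (hasWeakDeriv_line_iff.1 hg).const_mul_add_const hloc ((ε ^ (-(1 / 2) : ℝ) : ℝ) : ℂ) 0
  exact hasWeakDeriv_fst_bridge hh hmul
    (locallyIntegrableOn_of_memLp one_le_two ((Lp.memLp g).const_mul _))
    (fun x hx hxh => fst_mem_interval_of_mem_waveguide hdI hx hxh)
    (ae_eq_bridge hh g c hp₀) (ae_eq_bridgeDerivFst hh g' hp₁)

theorem hasWeakDeriv_snd_add_liftRoom (hh : 0 < h) (g : L2 (interval lm lp)) (c : ℂ)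
    {p₀ p₂ : L2 (waveguide lm lp ε d h b)}
    (hp₀ : p₀ =ᵐ[volume.restrict (waveguide lm lp ε d h b)] (passage d h).indicator
      (bridge h (fun t => ((ε ^ (-(1 / 2) : ℝ) : ℝ) : ℂ) * g t) (((b⁻¹ : ℝ) : ℂ) * c)))
    (hp₂ : p₂ =ᵐ[volume.restrict (waveguide lm lp ε d h b)] (passage d h).indicator
      (bridgeDerivSnd h (fun t => ((ε ^ (-(1 / 2) : ℝ) : ℝ) : ℂ) * g t) (((b⁻¹ : ℝ) : ℂ) * c))) :
    HasWeakDeriv (waveguide lm lp ε d h b) (0, 1)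
      (liftStrip lm lp ε d h b g + p₀ + liftRoom lm lp ε d h b c) p₂ :=
  hasWeakDeriv_snd_bridge hh (ae_eq_bridge hh g c hp₀) (ae_eq_bridgeDerivSnd hp₂)

end Bridge

/-! ### The passage components -/

theorem exists_Lp_two_ae_eq_indicator {X : Type*} [MeasurableSpace X] {μ : Measure X} {Ω S : Set X}
    (hS : MeasurableSet S) (hSΩ : S ⊆ Ω) [IsFiniteMeasure (μ.restrict S)] {F : X → ℂ}
    (hF : AEStronglyMeasurable F (μ.restrict S)) {M : ℝ} (hM0 : 0 ≤ M)
    (hM : ∀ᵐ x ∂(μ.restrict S), ‖F x‖ ≤ M) :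
    ∃ q : Lp ℂ 2 (μ.restrict Ω),
      q =ᵐ[μ.restrict Ω] S.indicator F ∧ ‖q‖ ≤ M * √(μ.real S) := by
  have hFS : MemLp F 2 (μ.restrict S) := MemLp.of_bound hF M hM
  have hrestrict : (μ.restrict Ω).restrict S = μ.restrict S :=
    Measure.restrict_restrict_of_subset hSΩ
  have hindicator : MemLp (S.indicator F) 2 (μ.restrict Ω) := by
    rwa [memLp_indicator_iff_restrict hS, hrestrict]
  refine ⟨hindicator.toLp, hindicator.coeFn_toLp, ?_⟩
  have hbound : ∀ᵐ x ∂(μ.restrict S), ‖hFS.toLp F x‖ ≤ M := by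
    filter_upwards [hFS.coeFn_toLp, hM] with x hx hxM
    rwa [hx]
  have hnorm := Lp.norm_le_of_ae_bound hM0 hbound
  rw [Lp.norm_toLp] at hnorm ⊢
  rw [eLpNorm_indicator_eq_eLpNorm_restrict hS, hrestrict]
  convert hnorm using 1
  rw [mul_comm, Real.sqrt_eq_rpow]
  simp [measureUnivNNReal, Measure.real, ENNReal.coe_toNNReal_eq_toReal]

section Passage

variable {lm lp : EReal} {ε d h b : ℝ} {I : Set ℝ}

theorem restrict_passage (d h : ℝ) : volume.restrict (passage d h) =
    (volume.restrict (Ioo (-(d / 2)) (d / 2))).prod (volume.restrict (Ioo 0 h)) := by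
  rw [passage_eq_prod, Measure.volume_eq_prod, Measure.prod_restrict]

theorem volume_real_passage (hd : 0 ≤ d) (hh : 0 ≤ h) : volume.real (passage d h) = d * h := by
  rw [passage_eq_prod, Measure.volume_eq_prod, measureReal_prod_prod, Real.volume_real_Ioo_of_le,
    Real.volume_real_Ioo_of_le hh] <;> linarith

instance isFiniteMeasure_passage : IsFiniteMeasure (volume.restrict (passage d h)) := by
  rw [restrict_passage]
  infer_instance

theorem ae_passage_of_ae {p : ℝ → Prop}
    (hp : ∀ᵐ x ∂(volume.restrict (Ioo (-(d / 2)) (d / 2))), p x) :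
    ∀ᵐ x ∂(volume.restrict (passage d h)), p x.1 := by
  rw [restrict_passage]
  exact Measure.quasiMeasurePreserving_fst.ae hp

theorem aestronglyMeasurable_passage (hI : Ioo (-(d / 2)) (d / 2) ⊆ I) {G : ℝ → ℂ}
    (hG : AEStronglyMeasurable G (volume.restrict I)) :
    AEStronglyMeasurable (fun x => G x.1) (volume.restrict (passage d h)) := by
  rw [restrict_passage]
  exact (hG.mono_measure (Measure.restrict_mono hI le_rfl)).comp_fst

theorem exists_ae_eq_indicator_passage {lm lp : EReal} {ε b : ℝ} (hd : 0 ≤ d) (hh : 0 ≤ h)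
    {F : ℝ × ℝ → ℂ} (hF : AEStronglyMeasurable F (volume.restrict (passage d h))) {M : ℝ}
    (hM0 : 0 ≤ M) (hM : ∀ᵐ x ∂(volume.restrict (passage d h)), ‖F x‖ ≤ M) :
    ∃ p : L2 (waveguide lm lp ε d h b),
      p =ᵐ[volume.restrict (waveguide lm lp ε d h b)] (passage d h).indicator F ∧
        ‖p‖ ≤ M * √(d * h) := by
  rw [← volume_real_passage hd hh]
  exact exists_Lp_two_ae_eq_indicator (isOpen_passage d h).measurableSet
    (passage_subset lm lp ε d h b) hF hM0 hM

theorem norm_ramp_mul_le (h y : ℝ) (z : ℂ) : ‖(ramp h y : ℂ) * z‖ ≤ ‖z‖ := by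
  rw [norm_mul, Complex.norm_real, Real.norm_of_nonneg (ramp_nonneg h y)]
  exact mul_le_of_le_one_left (norm_nonneg _) (ramp_le_one h y)

theorem aestronglyMeasurable_ramp_mul {μ : Measure (ℝ × ℝ)} {F : ℝ × ℝ → ℂ}
    (hF : AEStronglyMeasurable F μ) :
    AEStronglyMeasurable (fun x => (ramp h x.2 : ℂ) * F x) μ :=
  (Complex.continuous_ofReal.comp
    ((continuous_ramp h).comp continuous_snd)).aestronglyMeasurable.mul hF

theorem exists_ae_eq_bridge (hd : 0 ≤ d) (hh : 0 ≤ h) (hI : Ioo (-(d / 2)) (d / 2) ⊆ I)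
    {G : ℝ → ℂ} (hG : AEStronglyMeasurable G (volume.restrict I)) {C : ℂ} {M N : ℝ} (hM : 0 ≤ M)
    (hGM : ∀ᵐ x ∂(volume.restrict (Ioo (-(d / 2)) (d / 2))), ‖G x‖ ≤ M) (hCN : ‖C‖ ≤ N) :
    ∃ p : L2 (waveguide lm lp ε d h b),
      p =ᵐ[volume.restrict (waveguide lm lp ε d h b)] (passage d h).indicator (bridge h G C) ∧
        ‖p‖ ≤ (M + 2 * N) * √(d * h) := by
  have hN := (norm_nonneg C).trans hCN
  refine exists_ae_eq_indicator_passage hd hh ((aestronglyMeasurable_ramp_mul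
    ((aestronglyMeasurable_passage hI hG).sub aestronglyMeasurable_const)).add
      aestronglyMeasurable_const) (by positivity) ?_
  filter_upwards [ae_passage_of_ae hGM] with x hx
  calc ‖bridge h G C x‖ ≤ ‖(ramp h x.2 : ℂ) * (G x.1 - C)‖ + ‖C‖ := norm_add_le _ _
    _ ≤ ‖G x.1 - C‖ + ‖C‖ := add_le_add_left (norm_ramp_mul_le _ _ _) _
    _ ≤ ‖G x.1‖ + ‖C‖ + ‖C‖ := add_le_add_left (norm_sub_le _ _) _
    _ ≤ M + 2 * N := by linarith

theorem exists_ae_eq_bridgeDerivFst (hd : 0 ≤ d) (hh : 0 ≤ h)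
    (hI : Ioo (-(d / 2)) (d / 2) ⊆ I) {G' : ℝ → ℂ}
    (hG : AEStronglyMeasurable G' (volume.restrict I)) {M : ℝ} (hM : 0 ≤ M)
    (hGM : ∀ᵐ x ∂(volume.restrict (Ioo (-(d / 2)) (d / 2))), ‖G' x‖ ≤ M) :
    ∃ p : L2 (waveguide lm lp ε d h b),
      p =ᵐ[volume.restrict (waveguide lm lp ε d h b)]
        (passage d h).indicator (bridgeDerivFst h G') ∧ ‖p‖ ≤ M * √(d * h) := by
  refine exists_ae_eq_indicator_passage hd hh
    (aestronglyMeasurable_ramp_mul (aestronglyMeasurable_passage hI hG)) hM ?_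
  filter_upwards [ae_passage_of_ae hGM] with x hx
  exact (norm_ramp_mul_le _ _ _).trans hx

theorem bridgeDerivSnd_of_mem_passage {G : ℝ → ℂ} {C : ℂ} {x : ℝ × ℝ} (hx : x ∈ passage d h) :
    bridgeDerivSnd h G C x = -(h : ℂ)⁻¹ * (G x.1 - C) := by
  have hmem : x.2 ∈ Ioc 0 h := ⟨hx.2.1, hx.2.2.le⟩
  rw [bridgeDerivSnd, indicator_of_mem hmem, mul_comm]

/-- As `G` is close to its value `a` at the centre, the vertical derivative of the bridge is
`-a / h` up to a small remainder; only the constant has to be compared with the flux through the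
passage. -/
theorem exists_ae_eq_bridgeDerivSnd (hd : 0 ≤ d) (hh : 0 ≤ h)
    (hI : Ioo (-(d / 2)) (d / 2) ⊆ I) {G : ℝ → ℂ}
    (hG : AEStronglyMeasurable G (volume.restrict I)) {a C : ℂ} {L N : ℝ} (hL : 0 ≤ L)
    (hGa : ∀ᵐ x ∂(volume.restrict (Ioo (-(d / 2)) (d / 2))), ‖G x - a‖ ≤ L) (hCN : ‖C‖ ≤ N) :
    ∃ p r : L2 (waveguide lm lp ε d h b),
      p =ᵐ[volume.restrict (waveguide lm lp ε d h b)]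
        (passage d h).indicator (bridgeDerivSnd h G C) ∧
      (∀ k : L2 (waveguide lm lp ε d h b),
        inner ℂ k p = inner ℂ k r - (h : ℂ)⁻¹ * a * conj (∫ x in passage d h, k x)) ∧
      ‖r‖ ≤ h⁻¹ * (L + N) * √(d * h) := by
  have hN := (norm_nonneg C).trans hCN
  obtain ⟨q, hq, -⟩ := exists_ae_eq_indicator_passage (lm := lm) (lp := lp) (ε := ε) (b := b)
    hd hh (F := fun _ => 1) aestronglyMeasurable_const zero_le_one (by simp)
  obtain ⟨r, hr, hrn⟩ := exists_ae_eq_indicator_passage (lm := lm) (lp := lp) (ε := ε) (b := b)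
    hd hh (F := fun x => -(h : ℂ)⁻¹ * (G x.1 - a - C)) (M := h⁻¹ * (L + N))
    ((((aestronglyMeasurable_passage hI hG).sub aestronglyMeasurable_const).sub
      aestronglyMeasurable_const).const_mul _) (by positivity) (by
        filter_upwards [ae_passage_of_ae hGa] with x hx
        rw [norm_mul, norm_neg, norm_inv, Complex.norm_real, Real.norm_of_nonneg hh]
        gcongr
        exact (norm_sub_le _ _).trans (add_le_add hx hCN))
  refine ⟨(-(h : ℂ)⁻¹ * a) • q + r, r, ?_, fun k => ?_, hrn⟩
  · filter_upwards [Lp.coeFn_add ((-(h : ℂ)⁻¹ * a) • q) r, Lp.coeFn_smul (-(h : ℂ)⁻¹ * a) q,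
      hq, hr] with x hadd hsmul hq hr
    rw [hadd, Pi.add_apply, hsmul, Pi.smul_apply, hq, hr]
    by_cases hx : x ∈ passage d h
    · simp only [indicator_of_mem hx, bridgeDerivSnd_of_mem_passage hx, smul_eq_mul]
      ring
    · simp [hx]
  · have hqk : inner ℂ q k = ∫ x in passage d h, k x := by
      simpa using (inner_eq_setIntegral (isOpen_passage d h).measurableSet
        (passage_subset lm lp ε d h b) hq k).2
    rw [inner_add_right, inner_smul_right, ← hqk, inner_conj_symm]
    ring

end Passage

/-! ### The difference of the resolvents -/

theorem inner_comp_sub_comp_apply {H H₀ : Type*} [NormedAddCommGroup H] [InnerProductSpace ℂ H]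
    [CompleteSpace H] [NormedAddCommGroup H₀] [InnerProductSpace ℂ H₀] [CompleteSpace H₀]
    {A : H →L[ℂ] H} (hA : IsSelfAdjoint A) (J : H₀ →L[ℂ] H) (B : H₀ →L[ℂ] H₀) (f : H₀) (w p : H) :
    inner ℂ w ((A ∘L J - J ∘L B) f) =
      inner ℂ (J.adjoint (A w)) (f - B f) - inner ℂ (w - A w) (J (B f) + p) +
        inner ℂ (w - A w) p := by
  have hswap : inner ℂ w (A (J f)) = inner ℂ (J.adjoint (A w)) f := by
    rw [J.adjoint_inner_left, ← A.adjoint_inner_left, ContinuousLinearMap.isSelfAdjoint_iff'.1 hA]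
  rw [sub_apply, ContinuousLinearMap.comp_apply, ContinuousLinearMap.comp_apply,
    inner_sub_right, hswap, inner_sub_right, inner_add_right, inner_sub_left w (A w) (J (B f)),
    ← J.adjoint_inner_left (B f) (A w)]
  ring

section Difference

variable {lm lp : EReal} {ε d h b : ℝ}

theorem HasWeakDeriv.exists_isPrimitiveOn_averageStrip {u k : L2 (waveguide lm lp ε d h b)}
    (hk : HasWeakDeriv (waveguide lm lp ε d h b) (1, 0) u k) :
    ∃ f : ℝ → ℂ, IsPrimitiveOn (interval lm lp) f (fun x => ∫ y in Ioo (-ε) 0, k (x, y)) ∧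
      (fun x => ∫ y in Ioo (-ε) 0, u (x, y)) =ᵐ[volume.restrict (interval lm lp)] f ∧
      ∀ x ∈ interval lm lp, pointValue (interval lm lp) (averageStrip lm lp ε d h b u) x =
        ((ε ^ (-(1 / 2) : ℝ) : ℝ) : ℂ) * f x := by
  have hΩ := isOpen_interval lm lp
  have hsub := strip_subset lm lp ε d h b
  have hloc (v : L2 (waveguide lm lp ε d h b)) :
      LocallyIntegrableOn (fun x => ∫ y in Ioo (-ε) 0, v (x, y)) (interval lm lp) :=
    locallyIntegrableOn_of_memLp one_le_two (memLp_integral_section (memLp_prod_of_subset hsub v))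
  obtain ⟨f, hf, huf, hprim⟩ := (hk.isWeakDeriv_integral_snd isOpen_Ioo hsub).exists_isPrimitiveOn
    hΩ (ordConnected_interval lm lp) (hloc u) (hloc k)
  refine ⟨f, hprim, huf, fun x hx => pointValue_eq (f := fun x => _ * f x) hΩ
    (continuousOn_const.mul hf) ?_ hx⟩
  filter_upwards [averageStrip_ae_eq lm lp ε d h b u, huf] with x hux hfx
  rw [hux, hfx]

/-- With `d = γ ε h` the δ-interaction balances the flux through the passage. -/
theorem norm_pointValue_add_flux_le {u k₁ k₂ : L2 (waveguide lm lp ε d h b)} {γ N : ℝ} {n : ℕ}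
    (h₁ : HasWeakDeriv (waveguide lm lp ε d h b) (1, 0) u k₁)
    (h₂ : HasWeakDeriv (waveguide lm lp ε d h b) (0, 1) u k₂)
    (hN : ‖u‖ ≤ N) (hN₁ : ‖k₁‖ ≤ N) (hN₂ : ‖k₂‖ ≤ N) (hd : 0 < d) (hdh : d ≤ h) (hdε : d ≤ ε)
    (hdb : d ≤ b) (hbn : b ≤ 2 ^ n * d) (hεn : ε ≤ 2 ^ n * d) (hdγ : d = γ * ε * h)
    (hγ : 0 ≤ γ) (hεI : Ioo (-(ε / 2)) (ε / 2) ⊆ interval lm lp) :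
    ‖(γ : ℂ) * pointValue (interval lm lp) (averageStrip lm lp ε d h b u) 0 +
        (h : ℂ)⁻¹ * ((ε ^ (-(1 / 2) : ℝ) : ℝ) : ℂ) * ∫ x in passage d h, k₂ x‖ ≤
      ε ^ (-(1 / 2) : ℝ) * γ * ε * ((5 + 10 * n + b⁻¹) * N) := by
  have hε : 0 < ε := hd.trans_le hdε
  have hh : 0 < h := hd.trans_le hdh
  have hdI : Ioo (-(d / 2)) (d / 2) ⊆ interval lm lp :=
    (Ioo_subset_Ioo (by linarith) (by linarith)).trans hεI
  obtain ⟨f, hf, huf, hpoint⟩ := h₁.exists_isPrimitiveOn_averageStrip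
  have hsq : room (-ε) ε ⊆ waveguide lm lp ε d h b := by
    rw [room_eq_prod, neg_add_cancel]
    exact (prod_mono_left hεI).trans (strip_subset lm lp ε d h b)
  have hflux := norm_flux_add_le h₁ h₂ hN hN₁ hN₂ hd hdh hdε hdb hbn hεn
    (prod_Ioo_subset_waveguide hd hh hdb hdI) (room_subset lm lp ε d h b) hsq (hf.mono hεI)
    (ae_restrict_of_ae_restrict_of_subset hεI huf)
  have hscale : (γ : ℂ) * pointValue (interval lm lp) (averageStrip lm lp ε d h b u) 0 +
      (h : ℂ)⁻¹ * ((ε ^ (-(1 / 2) : ℝ) : ℝ) : ℂ) * ∫ x in passage d h, k₂ x =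
        (ε ^ (-(1 / 2) : ℝ) * γ * ε) • (d⁻¹ • (∫ x in passage d h, k₂ x) + ε⁻¹ • f 0) := by
    have hεC : (ε : ℂ) ≠ 0 := Complex.ofReal_ne_zero.2 hε.ne'
    have hγC : (γ : ℂ) ≠ 0 := Complex.ofReal_ne_zero.2 fun hγ0 => by simp [hdγ, hγ0] at hd
    have hdC : (d : ℂ) ≠ 0 := Complex.ofReal_ne_zero.2 hd.ne'
    have hdγC : (d : ℂ) = γ * ε * h := mod_cast hdγ
    have hh_inv : (h : ℂ)⁻¹ = γ * ε * (d : ℂ)⁻¹ := by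
      rw [inv_eq_iff_eq_inv, mul_inv, inv_inv, hdγC, inv_mul_cancel_left₀ (mul_ne_zero hγC hεC)]
    rw [hpoint 0 (hεI ⟨by linarith, by linarith⟩), hh_inv]
    simp only [Complex.real_smul]
    push_cast
    field_simp
    ring
  rw [hscale, norm_smul, Real.norm_of_nonneg (by positivity)]
  gcongr

theorem mulLp_potential_J_add (hh : 0 < h) {V₀ : ℝ → ℝ}
    (hV : MemLp V₀ ⊤ (volume.restrict (interval lm lp))) (g : LimitSpace (interval lm lp))
    {p : L2 (waveguide lm lp ε d h b)} {F : ℝ × ℝ → ℂ}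
    (hp : p =ᵐ[volume.restrict (waveguide lm lp ε d h b)] (passage d h).indicator F) :
    mulLp (memLp_potential (ε := ε) d h b hV) (J lm lp ε d h b g + p) =
      liftStrip lm lp ε d h b (mulLp hV g.fst) := by
  refine Lp.ext ?_
  filter_upwards [coeFn_mulLp (memLp_potential (ε := ε) d h b hV) (J lm lp ε d h b g + p),
    Lp.coeFn_add (J lm lp ε d h b g) p, J_apply_ae lm lp ε d h b g, hp,
    liftStrip_ae_eq lm lp ε d h b (mulLp hV g.fst),
    ae_restrict_of_ae (ae_mem_strip_imp ε (coeFn_mulLp hV g.fst))]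
    with x hmul hadd hJ hp hlift hmul₀
  rw [hmul, hadd, Pi.add_apply, hJ, hp, hlift]
  by_cases hx : x ∈ strip lm lp ε
  · have hP : x ∉ passage d h := fun hx' => hx'.2.1.not_gt hx.2.2
    have hR : x ∉ room h b := fun hx' => (hh.trans hx'.2.1).not_gt hx.2.2
    simp only [potential, hx, hP, hR, indicator_of_mem, indicator_of_notMem, not_false_eq_true,
      if_true, hmul₀ hx]
    ring
  · simp [potential, hx]

theorem inner_JTilde_sub_inner_J_add_eq {V₀ : ℝ → ℝ} {γ : ℝ} (hh : 0 < h)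
    (hV : MemLp V₀ ⊤ (volume.restrict (interval lm lp)))
    {u w k₁ k₂ p₀ p₁ p₂ : L2 (waveguide lm lp ε d h b)} {f g : LimitSpace (interval lm lp)}
    {g' : L2 (interval lm lp)} {F : ℝ × ℝ → ℂ}
    (hu : (u, w) ∈ neumannGraph (waveguide lm lp ε d h b) (potential lm lp ε V₀))
    (hk₁ : HasWeakDeriv (waveguide lm lp ε d h b) (1, 0) u k₁)
    (hk₂ : HasWeakDeriv (waveguide lm lp ε d h b) (0, 1) u k₂)
    (hg : (g, f) ∈ limitGraph (interval lm lp) V₀ γ)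
    (hg' : HasWeakDeriv (interval lm lp) 1 g.fst g')
    (hp₀ : p₀ =ᵐ[volume.restrict (waveguide lm lp ε d h b)] (passage d h).indicator F)
    (hj₁ : HasWeakDeriv (waveguide lm lp ε d h b) (1, 0) (J lm lp ε d h b g + p₀)
      (liftStrip lm lp ε d h b g' + p₁))
    (hj₂ : HasWeakDeriv (waveguide lm lp ε d h b) (0, 1) (J lm lp ε d h b g + p₀) p₂) :
    inner ℂ (JTilde lm lp ε d h b u) f - inner ℂ w (J lm lp ε d h b g + p₀) =
      γ * pointValue (interval lm lp) g.fst 0 *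
          conj (pointValue (interval lm lp) (averageStrip lm lp ε d h b u) 0) -
        inner ℂ k₁ p₁ - inner ℂ k₂ p₂ := by
  have hΩ := isOpen_waveguide lm lp ε d h b
  have hlift (x : L2 (interval lm lp)) (y : L2 (waveguide lm lp ε d h b)) :
      inner ℂ y (liftStrip lm lp ε d h b x) = inner ℂ (averageStrip lm lp ε d h b y) x := by
    rw [← inner_conj_symm, inner_liftStrip, inner_conj_symm]
  have hlimit : inner ℂ (JTilde lm lp ε d h b u) f =
      inner ℂ (averageStrip lm lp ε d h b k₁) g' +
        inner ℂ (averageStrip lm lp ε d h b u) (mulLp hV g.fst) +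
          γ * pointValue (interval lm lp) g.fst 0 *
            conj (pointValue (interval lm lp) (averageStrip lm lp ε d h b u) 0) :=
    inner_eq_of_mem_limitGraph (v := JTilde lm lp ε d h b u) (isOpen_interval lm lp) hV hg hg'
      (hasWeakDeriv_averageStrip hk₁)
  have hneumann : inner ℂ w (J lm lp ε d h b g + p₀) =
      inner ℂ k₁ (liftStrip lm lp ε d h b g' + p₁) + inner ℂ k₂ p₂ +
        inner ℂ u (liftStrip lm lp ε d h b (mulLp hV g.fst)) := by
    rw [← inner_conj_symm, inner_eq_of_mem_neumannGraph hΩ (memLp_potential d h b hV) hu hk₁ hk₂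
      hj₁ hj₂, ← inner_mulLp_left, mulLp_potential_J_add hh hV g hp₀]
    simp only [map_add, inner_conj_symm]
  rw [hlimit, hneumann, inner_add_right, hlift, hlift]
  ring

end Difference

section DifferenceEstimate

variable {lm lp : EReal} {ε d h b : ℝ}

/-- Connecting `J g` across the passage: adding `p₀`, which lives on the passage, gives an `H¹`
function with partial derivatives `liftStrip g' + p₁` and `p₂`. On the passage `p₂` is the constant
`-e a / h` up to the remainder `r`; this is recorded as an identity for inner products. -/
structure IsPassageExtension (g : LimitSpace (interval lm lp)) (g' : L2 (interval lm lp)) (e : ℝ)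
    (a : ℂ) (p₀ p₁ p₂ r : L2 (waveguide lm lp ε d h b)) : Prop where
  exists_ae_eq_indicator : ∃ F : ℝ × ℝ → ℂ,
    p₀ =ᵐ[volume.restrict (waveguide lm lp ε d h b)] (passage d h).indicator F
  hasWeakDeriv_fst : HasWeakDeriv (waveguide lm lp ε d h b) (1, 0) (J lm lp ε d h b g + p₀)
    (liftStrip lm lp ε d h b g' + p₁)
  hasWeakDeriv_snd : HasWeakDeriv (waveguide lm lp ε d h b) (0, 1) (J lm lp ε d h b g + p₀) p₂
  inner_eq : ∀ k : L2 (waveguide lm lp ε d h b),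
    inner ℂ k p₂ = inner ℂ k r - (h : ℂ)⁻¹ * (e * a) * conj (∫ x in passage d h, k x)

theorem exists_isPassageExtension (hd : 0 < d) (hh : 0 < h) (hb : 0 < b)
    (hdI : Ioo (-(d / 2)) (d / 2) ⊆ interval lm lp) {g : LimitSpace (interval lm lp)}
    {g' : L2 (interval lm lp)} (hg' : HasWeakDeriv (interval lm lp) 1 g.fst g') {a : ℂ} {M : ℝ}
    (hM : 0 ≤ M) (hgM : ∀ᵐ x ∂(volume.restrict (Ioo (-(d / 2)) (d / 2))), ‖g.fst x‖ ≤ M)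
    (hg'M : ∀ᵐ x ∂(volume.restrict (Ioo (-(d / 2)) (d / 2))), ‖g' x‖ ≤ M)
    (hga : ∀ᵐ x ∂(volume.restrict (Ioo (-(d / 2)) (d / 2))), ‖g.fst x - a‖ ≤ M * d)
    (hcM : ‖g.snd‖ ≤ M) {e : ℝ} (he : e = ε ^ (-(1 / 2) : ℝ)) (he0 : 0 ≤ e) :
    ∃ p₀ p₁ p₂ r : L2 (waveguide lm lp ε d h b), IsPassageExtension g g' e a p₀ p₁ p₂ r ∧
      ‖p₀‖ ≤ (e * M + 2 * (b⁻¹ * M)) * √(d * h) ∧ ‖p₁‖ ≤ e * M * √(d * h) ∧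
      ‖r‖ ≤ h⁻¹ * (e * (M * d) + b⁻¹ * M) * √(d * h) := by
  have hmeas (v : L2 (interval lm lp)) :
      AEStronglyMeasurable (fun t => (e : ℂ) * v t) (volume.restrict (interval lm lp)) :=
    (Lp.aestronglyMeasurable v).const_mul _
  have hscale {z : ℂ} {s N : ℝ} (hs : 0 ≤ s) (hz : ‖z‖ ≤ N) : ‖(s : ℂ) * z‖ ≤ s * N := by
    rw [norm_mul, Complex.norm_real, Real.norm_of_nonneg hs]
    gcongr
  have hc := hscale (inv_pos.2 hb).le hcM
  obtain ⟨p₀, hp₀, hp₀n⟩ := exists_ae_eq_bridge (lm := lm) (lp := lp) (ε := ε) (b := b)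
    hd.le hh.le hdI (hmeas g.fst) (by positivity) (hgM.mono fun _ => hscale he0) hc
  obtain ⟨p₁, hp₁, hp₁n⟩ := exists_ae_eq_bridgeDerivFst (lm := lm) (lp := lp) (ε := ε) (b := b)
    hd.le hh.le hdI (hmeas g') (by positivity) (hg'M.mono fun _ => hscale he0)
  obtain ⟨p₂, r, hp₂, hinner, hrn⟩ := exists_ae_eq_bridgeDerivSnd (lm := lm) (lp := lp) (ε := ε)
    (b := b) (a := e * a) (L := e * (M * d)) hd.le hh.le hdI (hmeas g.fst) (by positivity)
    (hga.mono fun x hx => by simpa only [mul_sub] using hscale he0 hx) hc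
  have hJ : J lm lp ε d h b g + p₀ =
      liftStrip lm lp ε d h b g.fst + p₀ + liftRoom lm lp ε d h b g.snd := by
    rw [J_apply]
    abel
  subst he
  refine ⟨p₀, p₁, p₂, r, ⟨⟨_, hp₀⟩, ?_, ?_, hinner⟩, hp₀n, hp₁n, hrn⟩ <;> rw [hJ]
  · exact hasWeakDeriv_fst_add_liftRoom hh hdI hg' g.snd hp₀ hp₁
  · exact hasWeakDeriv_snd_add_liftRoom hh g.fst g.snd hp₀ hp₂

theorem norm_near_zero_le_of_mem_limitGraph {γ K ρ : ℝ} {V₀ : ℝ → ℝ} (hK : 1 ≤ K) (hρK : K⁻¹ ≤ ρ)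
    (hρ1 : ρ ≤ 1) (hI : Ioo (-ρ) ρ ⊆ interval lm lp)
    (hV : MemLp V₀ ⊤ (volume.restrict (interval lm lp)))
    (hV0 : 0 ≤ᵐ[volume.restrict (interval lm lp)] V₀)
    (hVK : eLpNorm V₀ ⊤ (volume.restrict (interval lm lp)) ≤ ENNReal.ofReal K) (hγ : 0 ≤ γ)
    {f g : LimitSpace (interval lm lp)} {g' : L2 (interval lm lp)}
    (hg : (g, f - g) ∈ limitGraph (interval lm lp) V₀ γ)
    (hg' : HasWeakDeriv (interval lm lp) 1 g.fst g') :
    ‖pointValue (interval lm lp) g.fst 0‖ ≤ (2 * K + 2) * ‖f‖ ∧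
      ∀ᵐ x ∂(volume.restrict (Ioo (-ρ) ρ)), ‖g.fst x‖ ≤ (2 * K + 2) * ‖f‖ ∧
        ‖g' x‖ ≤ (2 * K + 2) * ‖f‖ ∧
        ‖g.fst x - pointValue (interval lm lp) g.fst 0‖ ≤ (2 * K + 2) * ‖f‖ * |x| := by
  have hρ : 0 < ρ := (inv_pos.2 (zero_lt_one.trans_le hK)).trans_le hρK
  have h0 : (0 : ℝ) ∈ Ioo (-ρ) ρ := ⟨neg_lt_zero.2 hρ, hρ⟩
  have hΩ := isOpen_interval lm lp
  have hord := ordConnected_interval lm lp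
  obtain ⟨hgn, hg'n⟩ := norm_le_of_mem_limitGraph hΩ hV hV0 hγ hg hg'
  have hg₁n := (WithLp.norm_fst_le _ g).trans hgn
  have hderiv := ae_norm_deriv_le_of_mem_limitGraph hΩ hK hρK hρ1 hI hV hVK hg hg'
    (WithLp.norm_fst_le _ f) hg₁n hg'n
  have hvalue {x : ℝ} (hx : x ∈ Ioo (-ρ) ρ) :
      ‖pointValue (interval lm lp) g.fst x‖ ≤ (2 * K + 2) * ‖f‖ :=
    hg'.norm_pointValue_le_of_le hΩ hord hK hρK hρ1 hI hg₁n hg'n hx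
  refine ⟨hvalue h0, ?_⟩
  filter_upwards [hderiv, ae_restrict_mem measurableSet_Ioo,
    ae_restrict_of_ae_restrict_of_subset hI (hg'.pointValue_spec hΩ hord).2.1] with x hg'x hx hgx
  rw [hgx]
  refine ⟨hvalue hx, hg'x, ?_⟩
  simpa using
    hg'.norm_pointValue_sub_le hΩ hord hI ordConnected_Ioo measurableSet_Ioo hderiv h0 hx

theorem exists_isPassageExtension_of_mem_limitGraph {γ K ρ : ℝ} {V₀ : ℝ → ℝ} (hd : 0 < d)
    (hh : 0 < h) (hb : 0 < b) (hdρ : d ≤ ρ) (hK : 1 ≤ K) (hρK : K⁻¹ ≤ ρ) (hρ1 : ρ ≤ 1)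
    (hI : Ioo (-ρ) ρ ⊆ interval lm lp) (hV : MemLp V₀ ⊤ (volume.restrict (interval lm lp)))
    (hV0 : 0 ≤ᵐ[volume.restrict (interval lm lp)] V₀)
    (hVK : eLpNorm V₀ ⊤ (volume.restrict (interval lm lp)) ≤ ENNReal.ofReal K) (hγ : 0 ≤ γ)
    {f g : LimitSpace (interval lm lp)} {g' : L2 (interval lm lp)}
    (hg : (g, f - g) ∈ limitGraph (interval lm lp) V₀ γ)
    (hg' : HasWeakDeriv (interval lm lp) 1 g.fst g') {e M : ℝ} (he : e = ε ^ (-(1 / 2) : ℝ))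
    (he0 : 0 ≤ e) (hfM : (2 * K + 2) * ‖f‖ ≤ M) :
    ‖pointValue (interval lm lp) g.fst 0‖ ≤ M ∧ ∃ p₀ p₁ p₂ r : L2 (waveguide lm lp ε d h b),
      IsPassageExtension g g' e (pointValue (interval lm lp) g.fst 0) p₀ p₁ p₂ r ∧
      ‖p₀‖ ≤ (e * M + 2 * (b⁻¹ * M)) * √(d * h) ∧ ‖p₁‖ ≤ e * M * √(d * h) ∧
      ‖r‖ ≤ h⁻¹ * (e * (M * d) + b⁻¹ * M) * √(d * h) := by
  have hdI : Ioo (-(d / 2)) (d / 2) ⊆ Ioo (-ρ) ρ := Ioo_subset_Ioo (by linarith) (by linarith)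
  have hM : 0 ≤ M := le_trans (by positivity) hfM
  have hcM : ‖g.snd‖ ≤ M := calc
    ‖g.snd‖ ≤ ‖f‖ := (WithLp.norm_snd_le _ g).trans
      (norm_le_of_mem_limitGraph (isOpen_interval lm lp) hV hV0 hγ hg hg').1
    _ ≤ (2 * K + 2) * ‖f‖ := le_mul_of_one_le_left (norm_nonneg _) (by linarith)
    _ ≤ M := hfM
  obtain ⟨ha, hnear⟩ := norm_near_zero_le_of_mem_limitGraph hK hρK hρ1 hI hV hV0 hVK hγ hg hg'
  replace hnear := ae_restrict_of_ae_restrict_of_subset hdI hnear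
  refine ⟨ha.trans hfM, exists_isPassageExtension hd hh hb (hdI.trans hI) hg' hM
    (hnear.mono fun x hx => hx.1.trans hfM) (hnear.mono fun x hx => hx.2.1.trans hfM) ?_ hcM
    he he0⟩
  filter_upwards [hnear, ae_restrict_mem measurableSet_Ioo] with x hx hxd
  refine hx.2.2.trans ?_
  gcongr
  exact abs_le.2 ⟨by linarith [hxd.1], by linarith [hxd.2]⟩

theorem norm_mul_conj_sub_inner_le {H : Type*} [NormedAddCommGroup H] [InnerProductSpace ℂ H]
    {a z : ℂ} {x₁ y₁ x₂ y₂ x₃ y₃ : H} {M Z X₁ Y₁ X₂ Y₂ X₃ Y₃ : ℝ} (ha : ‖a‖ ≤ M) (hz : ‖z‖ ≤ Z)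
    (hx₁ : ‖x₁‖ ≤ X₁) (hy₁ : ‖y₁‖ ≤ Y₁) (hx₂ : ‖x₂‖ ≤ X₂) (hy₂ : ‖y₂‖ ≤ Y₂) (hx₃ : ‖x₃‖ ≤ X₃)
    (hy₃ : ‖y₃‖ ≤ Y₃) :
    ‖a * conj z - inner ℂ x₁ y₁ - inner ℂ x₂ y₂ + inner ℂ x₃ y₃‖ ≤
      M * Z + X₁ * Y₁ + X₂ * Y₂ + X₃ * Y₃ := by
  have hinner {x y : H} {X Y : ℝ} (hx : ‖x‖ ≤ X) (hy : ‖y‖ ≤ Y) : ‖inner ℂ x y‖ ≤ X * Y :=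
    (norm_inner_le_norm _ _).trans
      (mul_le_mul hx hy (norm_nonneg _) ((norm_nonneg _).trans hx))
  have haz : ‖a * conj z‖ ≤ M * Z := by
    rw [norm_mul, RCLike.norm_conj]
    exact mul_le_mul ha hz (norm_nonneg _) ((norm_nonneg _).trans ha)
  exact norm_add_le_of_le (norm_sub_le_of_le (norm_sub_le_of_le haz (hinner hx₁ hy₁))
    (hinner hx₂ hy₂)) (hinner hx₃ hy₃)

theorem inner_resolvent_difference_eq {γ : ℝ} {V₀ : ℝ → ℝ} (hh : 0 < h)
    (hV : MemLp V₀ ⊤ (volume.restrict (interval lm lp)))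
    (hV0 : 0 ≤ᵐ[volume.restrict (interval lm lp)] V₀)
    {u w k₁ k₂ p₀ p₁ p₂ r : L2 (waveguide lm lp ε d h b)} {f g : LimitSpace (interval lm lp)}
    {g' : L2 (interval lm lp)} {e : ℝ}
    (hu : formResolvent (neumannGraph (waveguide lm lp ε d h b) (potential lm lp ε V₀)) w = u)
    (huw : (u, w - u) ∈ neumannGraph (waveguide lm lp ε d h b) (potential lm lp ε V₀))
    (hk₁ : HasWeakDeriv (waveguide lm lp ε d h b) (1, 0) u k₁)
    (hk₂ : HasWeakDeriv (waveguide lm lp ε d h b) (0, 1) u k₂)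
    (hg : formResolvent (limitGraph (interval lm lp) V₀ γ) f = g)
    (hgf : (g, f - g) ∈ limitGraph (interval lm lp) V₀ γ)
    (hg' : HasWeakDeriv (interval lm lp) 1 g.fst g')
    (hp : IsPassageExtension g g' e (pointValue (interval lm lp) g.fst 0) p₀ p₁ p₂ r) :
    inner ℂ w ((formResolvent (neumannGraph (waveguide lm lp ε d h b) (potential lm lp ε V₀)) ∘L
        J lm lp ε d h b - J lm lp ε d h b ∘L formResolvent (limitGraph (interval lm lp) V₀ γ)) f) =
      pointValue (interval lm lp) g.fst 0 *
          conj (γ * pointValue (interval lm lp) (averageStrip lm lp ε d h b u) 0 +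
            (h : ℂ)⁻¹ * e * ∫ x in passage d h, k₂ x) -
        inner ℂ k₁ p₁ - inner ℂ k₂ r + inner ℂ (w - u) p₀ := by
  have hself := isSelfAdjoint_formResolvent_neumannGraph (isOpen_waveguide lm lp ε d h b)
    (memLp_potential d h b hV) (ae_potential_nonneg ε d h b hV0)
  obtain ⟨F, hF⟩ := hp.exists_ae_eq_indicator
  rw [inner_comp_sub_comp_apply hself _ _ f w p₀, hu, hg, adjoint_J,
    inner_JTilde_sub_inner_J_add_eq hh hV huw hk₁ hk₂ hgf hg' hF hp.hasWeakDeriv_fst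
      hp.hasWeakDeriv_snd, hp.inner_eq]
  simp only [map_add, map_mul, map_inv₀, Complex.conj_ofReal]
  ring

theorem norm_resolvent_difference_le {γ K ρ : ℝ} {V₀ : ℝ → ℝ} {n : ℕ} (hd : 0 < d)
    (hdh : d ≤ h) (hdε : d ≤ ε) (hdb : d ≤ b) (hdγ : d = γ * ε * h) (hγ : 0 ≤ γ)
    (hbn : b ≤ 2 ^ n * d) (hεn : ε ≤ 2 ^ n * d) (hK : 1 ≤ K) (hρK : K⁻¹ ≤ ρ) (hρ1 : ρ ≤ 1)
    (hρε : ε ≤ ρ) (hI : Ioo (-ρ) ρ ⊆ interval lm lp)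
    (hV : MemLp V₀ ⊤ (volume.restrict (interval lm lp)))
    (hV0 : 0 ≤ᵐ[volume.restrict (interval lm lp)] V₀)
    (hVK : eLpNorm V₀ ⊤ (volume.restrict (interval lm lp)) ≤ ENNReal.ofReal K)
    {e : ℝ} (he : e = ε ^ (-(1 / 2) : ℝ)) :
    ‖formResolvent (neumannGraph (waveguide lm lp ε d h b) (potential lm lp ε V₀)) ∘L
        J lm lp ε d h b - J lm lp ε d h b ∘L formResolvent (limitGraph (interval lm lp) V₀ γ)‖ ≤
      (2 * K + 2) * (e * γ * ε * (5 + 10 * n + b⁻¹) + e * √(d * h) +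
        h⁻¹ * (e * d + b⁻¹) * √(d * h) + 2 * (e + 2 * b⁻¹) * √(d * h)) := by
  have hε : 0 < ε := hd.trans_le hdε
  have hh : 0 < h := hd.trans_le hdh
  have hb : 0 < b := hd.trans_le hdb
  have he0 : 0 ≤ e := by rw [he]; positivity
  have hΩ := isOpen_waveguide lm lp ε d h b
  have hΩ₀ := isOpen_interval lm lp
  have hVε := memLp_potential (ε := ε) d h b hV
  have hVε0 := ae_potential_nonneg ε d h b hV0
  refine ContinuousLinearMap.opNorm_le_of_re_inner_le (by positivity) fun f w hf hw => ?_
  rw [← inner_conj_symm, RCLike.conj_re]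
  refine (RCLike.re_le_norm _).trans ?_
  have huw := (isResolvent_neumannGraph hΩ hVε hVε0 w _).1 rfl
  have hgf := (isResolvent_limitGraph hΩ₀ (ordConnected_interval lm lp)
    (hI ⟨by linarith, by linarith⟩) hV hV0 hγ f _).1 rfl
  obtain ⟨k₁, k₂, hk₁, hk₂⟩ := mem_H1_planar_iff.1 huw.1
  obtain ⟨g', hg'⟩ := mem_H1_line_iff.1 hgf.1
  obtain ⟨hun, hk₁n, hk₂n⟩ := norm_le_of_mem_neumannGraph hΩ hVε hVε0 huw hk₁ hk₂
  rw [hw] at hun hk₁n hk₂n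
  obtain ⟨ha, p₀, p₁, p₂, r, hp, hp₀, hp₁, hr⟩ :=
    exists_isPassageExtension_of_mem_limitGraph hd hh hb (hdε.trans hρε) hK hρK hρ1 hI hV hV0 hVK
      hγ hgf hg' he he0 (M := 2 * K + 2) (by rw [hf, mul_one])
  have hflux := norm_pointValue_add_flux_le hk₁ hk₂ hun hk₁n hk₂n hd hdh hdε hdb hbn hεn hdγ hγ
    ((Ioo_subset_Ioo (by linarith) (by linarith)).trans hI)
  rw [← he] at hflux
  rw [inner_resolvent_difference_eq hh hV hV0 rfl huw hk₁ hk₂ rfl hgf hg' hp]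
  refine (norm_mul_conj_sub_inner_le ha hflux hk₁n hp₁ hk₂n hr ((norm_sub_le _ _).trans
    (add_le_add hw.le hun)) hp₀).trans (le_of_eq ?_)
  ring

end DifferenceEstimate

/-! ### Orders of magnitude -/

section Scales

variable {K α β γ ε : ℝ}

theorem exists_nat_one_le_two_pow_mul {d L : ℝ} (hd : 0 < d) (hL : 0 ≤ L)
    (hdL : Real.log d⁻¹ ≤ L) : ∃ n : ℕ, 1 ≤ 2 ^ n * d ∧ (n : ℝ) ≤ 2 * L + 1 := by
  refine ⟨⌈2 * L⌉₊, ?_, (Nat.ceil_lt_add_one (by positivity)).le⟩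
  have hlog : Real.log d⁻¹ ≤ Real.log (2 ^ ⌈2 * L⌉₊) := calc
    Real.log d⁻¹ ≤ 2 * L * (1 / 2) := by linarith
    _ ≤ ⌈2 * L⌉₊ * Real.log 2 := by
      gcongr
      · exact Nat.le_ceil _
      · linarith [Real.log_two_gt_d9]
    _ = Real.log (2 ^ ⌈2 * L⌉₊) := (Real.log_pow _ _).symm
  rw [Real.log_le_log_iff (inv_pos.2 hd) (by positivity)] at hlog
  exact (inv_le_iff_one_le_mul₀ hd).1 hlog

theorem log_inv_mul_rpow_le (hα : 0 < α) (hαK : α ≤ K) (hβ : 0 < β) (hβK : β⁻¹ ≤ K) (hε : 0 < ε)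
    (hε1 : ε ≤ 1) (hεγ : ε ≤ γ) :
    Real.log (γ * ε ^ (α + 1))⁻¹ ≤ (K + 2) * (K * ε ^ (-β)) := by
  have hlog : Real.log ε⁻¹ ≤ K * ε ^ (-β) := by
    refine (Real.log_le_rpow_div (inv_pos.2 hε).le hβ).trans ?_
    rw [Real.inv_rpow hε.le, ← Real.rpow_neg hε.le, div_eq_inv_mul]
    gcongr
  have hpow : ε ^ (α + 2) ≤ γ * ε ^ (α + 1) := by
    rw [show α + 2 = 1 + (α + 1) by ring, Real.rpow_add hε, Real.rpow_one]
    gcongr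
  calc Real.log (γ * ε ^ (α + 1))⁻¹ ≤ Real.log (ε ^ (α + 2))⁻¹ := by
        apply Real.log_le_log
        · have := hε.trans_le hεγ
          positivity
        · gcongr
    _ = (α + 2) * Real.log ε⁻¹ := by rw [Real.log_inv, Real.log_inv, Real.log_rpow hε, mul_neg]
    _ ≤ (K + 2) * (K * ε ^ (-β)) := by
        refine mul_le_mul (by linarith) hlog (Real.log_nonneg ((one_le_inv₀ hε).2 hε1)) ?_
        linarith

theorem rpow_mul_sqrt_le (hε : 0 < ε) (hε1 : ε ≤ 1) (hγ : 0 ≤ γ) (hγK : √γ ≤ K) {s θ : ℝ}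
    (hθ : θ ≤ s + (α + 1 / 2)) : ε ^ s * √(γ * ε ^ (α + 1) * ε ^ α) ≤ K * ε ^ θ := by
  have hsquare : γ * ε ^ (α + 1) * ε ^ α = γ * (ε ^ (α + 1 / 2) * ε ^ (α + 1 / 2)) := by
    rw [mul_assoc, ← Real.rpow_add hε, ← Real.rpow_add hε]
    ring_nf
  rw [hsquare, Real.sqrt_mul hγ, Real.sqrt_mul_self (Real.rpow_nonneg hε.le _), mul_left_comm,
    ← Real.rpow_add hε]
  exact mul_le_mul hγK (Real.rpow_le_rpow_of_exponent_ge hε hε1 hθ) (by positivity)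
    ((Real.sqrt_nonneg _).trans hγK)

theorem flux_error_le {n : ℕ} (hK : 0 ≤ K) (hβ : 0 ≤ β) (hγK : γ ≤ K) (hε : 0 < ε) (hε1 : ε ≤ 1)
    (hn : (n : ℝ) ≤ 2 * ((K + 2) * (K * ε ^ (-β))) + 1) :
    ε ^ (-(1 / 2) : ℝ) * γ * ε * (5 + 10 * n + (ε ^ β)⁻¹) ≤
      K * (16 + 20 * (K + 2) * K) * ε ^ (1 / 2 - β) := by
  have hβ1 : 1 ≤ ε ^ (-β) := Real.one_le_rpow_of_pos_of_le_one_of_nonpos hε hε1 (by linarith)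
  have hhalf : ε ^ (-(1 / 2) : ℝ) * ε = ε ^ (1 / 2 : ℝ) := by
    rw [← Real.rpow_add_one hε.ne']
    norm_num
  calc ε ^ (-(1 / 2) : ℝ) * γ * ε * (5 + 10 * n + (ε ^ β)⁻¹)
      = γ * ε ^ (1 / 2 : ℝ) * (5 + 10 * n + ε ^ (-β)) := by
        rw [← hhalf, Real.rpow_neg hε.le β]
        ring
    _ ≤ K * ε ^ (1 / 2 : ℝ) * ((16 + 20 * (K + 2) * K) * ε ^ (-β)) := by
        gcongr
        linarith
    _ = K * (16 + 20 * (K + 2) * K) * ε ^ (1 / 2 - β) := by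
        rw [sub_eq_add_neg, Real.rpow_add hε]
        ring

theorem error_terms_le {n : ℕ} (hK : 1 ≤ K) (hβ : 0 ≤ β) (hβ2 : β ≤ 1 / 2) (hγ : 0 ≤ γ)
    (hγK : γ ≤ K) (hε : 0 < ε) (hε1 : ε ≤ 1)
    (hn : (n : ℝ) ≤ 2 * ((K + 2) * (K * ε ^ (-β))) + 1) {e d h b : ℝ}
    (he : e = ε ^ (-(1 / 2) : ℝ)) (hd : d = γ * ε ^ (α + 1)) (hh : h = ε ^ α) (hb : b = ε ^ β) :
    e * γ * ε * (5 + 10 * n + b⁻¹) + e * √(d * h) + h⁻¹ * (e * d + b⁻¹) * √(d * h) +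
        2 * (e + 2 * b⁻¹) * √(d * h) ≤
      (K * (16 + 20 * (K + 2) * K) + 8 * K + K * K) * ε ^ min α (1 / 2 - β) := by
  have hγK' : √γ ≤ K := Real.sqrt_le_left (zero_le_one.trans hK) |>.2 (by nlinarith)
  have hminα := min_le_left α (1 / 2 - β)
  have hminβ := min_le_right α (1 / 2 - β)
  set θ := min α (1 / 2 - β)
  have hsqrt {s : ℝ} (hs : θ ≤ s + (α + 1 / 2)) : ε ^ s * √(d * h) ≤ K * ε ^ θ := by
    rw [hd, hh]
    exact rpow_mul_sqrt_le hε hε1 hγ hγK' hs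
  have hflux : e * γ * ε * (5 + 10 * n + b⁻¹) ≤ K * (16 + 20 * (K + 2) * K) * ε ^ θ := by
    rw [he, hb]
    refine (flux_error_le (by linarith) hβ hγK hε hε1 hn).trans ?_
    gcongr ?_ * ?_
    exact Real.rpow_le_rpow_of_exponent_ge hε hε1 hminβ
  have hstrip : e * √(d * h) ≤ K * ε ^ θ := he ▸ hsqrt (by linarith)
  have hb_inv : b⁻¹ = ε ^ (-β) := by rw [hb, Real.rpow_neg hε.le]
  have hroom : b⁻¹ * √(d * h) ≤ K * ε ^ θ := hb_inv ▸ hsqrt (by linarith)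
  have hh_inv : h⁻¹ = ε ^ (-α) := by rw [hh, Real.rpow_neg hε.le]
  have hslope : h⁻¹ * b⁻¹ * √(d * h) ≤ K * ε ^ θ := by
    rw [hh_inv, hb_inv, ← Real.rpow_add hε]
    exact hsqrt (by linarith)
  have hd_div : h⁻¹ * d = γ * ε := by
    rw [hh_inv, hd, mul_left_comm, ← Real.rpow_add hε, neg_add_cancel_left, Real.rpow_one]
  have hvariation : h⁻¹ * d * (e * √(d * h)) ≤ K * (K * ε ^ θ) := by
    have hhd : h⁻¹ * d ≤ K := hd_div ▸ (mul_le_of_le_one_right hγ hε1).trans hγK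
    have he0 : 0 ≤ e := he ▸ Real.rpow_nonneg hε.le _
    exact mul_le_mul hhd hstrip (by positivity) (by linarith)
  linarith

theorem lt_one_of_lt_min_inv (h : ε < min γ γ⁻¹) : ε < 1 := by
  rcases le_total γ 1 with hγ1 | hγ1
  · exact (h.trans_le (min_le_left _ _)).trans_le hγ1
  · exact (h.trans_le (min_le_right _ _)).trans_le (inv_le_one_of_one_le₀ hγ1)

theorem mul_rpow_le_of_lt_rpow (hα : 0 < α) (hγ : 0 < γ) (hε : 0 < ε)
    (h : ε < (2 * γ) ^ (-1 / α)) : γ * ε ^ (α + 1) ≤ ε := by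
  have hpow : ε ^ α ≤ (2 * γ)⁻¹ := calc
    ε ^ α ≤ ((2 * γ) ^ (-1 / α)) ^ α := by gcongr
    _ = (2 * γ)⁻¹ := by
      rw [← Real.rpow_mul (by positivity), div_mul_cancel₀ _ hα.ne', Real.rpow_neg_one]
  rw [Real.rpow_add_one hε.ne', ← mul_assoc]
  refine mul_le_of_le_one_left hε.le ?_
  calc γ * ε ^ α ≤ γ * (2 * γ)⁻¹ := by gcongr
    _ ≤ 1 := by
      field_simp
      norm_num

theorem Ioo_neg_max_subset_interval {lm lp : EReal} {s t : ℝ} (hs : lm ≤ ((-s : ℝ) : EReal))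
    (hs' : (s : EReal) ≤ lp) (ht : lm ≤ ((-t : ℝ) : EReal)) (ht' : (t : EReal) ≤ lp) :
    Ioo (-max s t) (max s t) ⊆ interval lm lp := by
  intro x hx
  have hmem {r : ℝ} (hr : lm ≤ ((-r : ℝ) : EReal)) (hr' : (r : EReal) ≤ lp)
      (hx : x ∈ Ioo (-r) r) : x ∈ interval lm lp :=
    ⟨hr.trans_lt (EReal.coe_lt_coe_iff.2 hx.1), (EReal.coe_lt_coe_iff.2 hx.2).trans_le hr'⟩
  rcases max_choice s t with hst | hst <;> rw [hst] at hx
  exacts [hmem hs hs' hx, hmem ht ht' hx]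

end Scales

theorem norm_resolvent_difference_le_mul_rpow {lm lp : EReal} {K α β γ ε d h b : ℝ} {V₀ : ℝ → ℝ}
    (hK : 1 ≤ K) (hα : 0 < α) (hβ : 0 < β) (hβ2 : β ≤ 1 / 2) (hγ : 0 < γ)
    (hV : MemLp V₀ ⊤ (volume.restrict (interval lm lp)))
    (hV0 : 0 ≤ᵐ[volume.restrict (interval lm lp)] V₀) (hαK : α ≤ K) (hβK : β⁻¹ ≤ K) (hγK : γ ≤ K)
    (hlmK : lm ≤ ((-K⁻¹ : ℝ) : EReal)) (hlpK : ((K⁻¹ : ℝ) : EReal) ≤ lp)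
    (hVK : eLpNorm V₀ ⊤ (volume.restrict (interval lm lp)) ≤ ENNReal.ofReal K)
    (hεα : ε < (2 * γ) ^ (-1 / α)) (hlmε : lm ≤ ((-ε : ℝ) : EReal)) (hlpε : (ε : EReal) ≤ lp)
    (hεγ : ε < min γ γ⁻¹) (hε : 0 < ε) (hd : d = γ * ε ^ (α + 1)) (hh : h = ε ^ α)
    (hb : b = ε ^ β) :
    ‖formResolvent (neumannGraph (waveguide lm lp ε d h b) (potential lm lp ε V₀)) ∘L
        J lm lp ε d h b - J lm lp ε d h b ∘L formResolvent (limitGraph (interval lm lp) V₀ γ)‖ ≤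
      (2 * K + 2) * ((K * (16 + 20 * (K + 2) * K) + 8 * K + K * K) * ε ^ min α (1 / 2 - β)) := by
  have hε1 := (lt_one_of_lt_min_inv hεγ).le
  have hd0 : 0 < d := by rw [hd]; positivity
  have hh0 : 0 < h := by rw [hh]; positivity
  have hdγ : d = γ * ε * h := by rw [hd, hh, Real.rpow_add_one hε.ne']; ring
  have hdh : d ≤ h := by
    rw [hdγ]
    refine mul_le_of_le_one_left hh0.le ?_
    exact (le_inv_mul_iff₀ hγ).1 (by simpa using (hεγ.trans_le (min_le_right _ _)).le)
  have hdε : d ≤ ε := hd ▸ mul_rpow_le_of_lt_rpow hα hγ hε hεα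
  have hεb : ε ≤ b := hb ▸ Real.self_le_rpow_of_le_one hε.le hε1 (by linarith)
  have hb1 : b ≤ 1 := hb ▸ Real.rpow_le_one hε.le hε1 hβ.le
  obtain ⟨n, hn1, hn⟩ := exists_nat_one_le_two_pow_mul (L := (K + 2) * (K * ε ^ (-β))) hd0
    (by positivity)
    (hd ▸ log_inv_mul_rpow_le hα hαK hβ hβK hε hε1 (hεγ.trans_le (min_le_left _ _)).le)
  refine (norm_resolvent_difference_le hd0 hdh hdε (hdε.trans hεb) hdγ hγ.le (hb1.trans hn1)
    (hε1.trans hn1) hK (le_max_right ε K⁻¹) (max_le hε1 (inv_le_one_of_one_le₀ hK))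
    (le_max_left _ _) (Ioo_neg_max_subset_interval hlmε hlpε hlmK hlpK) hV hV0 hVK rfl).trans ?_
  gcongr
  exact error_terms_le hK hβ.le hβ2 hγ.le hγK hε hε1 hn rfl hd hh hb

end RoomPassage

theorem theorem2p1 (K : ℝ) :
    ∃ C : ℝ, 0 < C ∧
      ∀ (lm lp : EReal) (α β γ : ℝ) (V₀ : ℝ → ℝ) (ε₀ ε d h b : ℝ),
        lm < 0 → 0 < lp →
        0 < α → 0 < β → β < 1 / 2 → 0 < γ →
        MemLp V₀ ⊤ (volume.restrict (interval lm lp)) →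
        (∀ᵐ x ∂(volume.restrict (interval lm lp)), 0 ≤ V₀ x) →
        -- the parameters on whose upper bounds the constant may depend
        α ≤ K → β⁻¹ ≤ K → γ ≤ K →
        lm ≤ ((-K⁻¹ : ℝ) : EReal) → ((K⁻¹ : ℝ) : EReal) ≤ lp →
        eLpNorm V₀ ⊤ (volume.restrict (interval lm lp)) ≤ ENNReal.ofReal K →
        -- smallness of `ε₀`
        ε₀ < (2 * γ) ^ (-1 / α) → lm < ((-ε₀ : ℝ) : EReal) → (ε₀ : EReal) < lp →
        ε₀ < γ ^ (-1 / (α + 1 - β)) → ε₀ < min γ γ⁻¹ →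
        0 < ε → ε ≤ ε₀ →
        d = γ * ε ^ (α + 1) → h = ε ^ α → b = ε ^ β →
        IsResolvent (neumannGraph (waveguide lm lp ε d h b) (potential lm lp ε V₀))
          (formResolvent (neumannGraph (waveguide lm lp ε d h b) (potential lm lp ε V₀))) ∧
        IsResolvent (limitGraph (interval lm lp) V₀ γ)
          (formResolvent (limitGraph (interval lm lp) V₀ γ)) ∧
        ‖formResolvent (neumannGraph (waveguide lm lp ε d h b) (potential lm lp ε V₀)) ∘L
              J lm lp ε d h b -
            J lm lp ε d h b ∘L formResolvent (limitGraph (interval lm lp) V₀ γ)‖ =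
          ‖JTilde lm lp ε d h b ∘L
              formResolvent (neumannGraph (waveguide lm lp ε d h b) (potential lm lp ε V₀)) -
            formResolvent (limitGraph (interval lm lp) V₀ γ) ∘L JTilde lm lp ε d h b‖ ∧
        ‖formResolvent (neumannGraph (waveguide lm lp ε d h b) (potential lm lp ε V₀)) ∘L
              J lm lp ε d h b -
            J lm lp ε d h b ∘L formResolvent (limitGraph (interval lm lp) V₀ γ)‖ ≤
          C * ε ^ min α (1 / 2 - β) := by
  rcases le_or_gt K 2 with hK2 | hK2
  · refine ⟨1, one_pos, fun lm lp α β γ V₀ ε₀ ε d h b _ _ _ hβ hβ2 _ _ _ _ hβK => ?_⟩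
    have : 2 < β⁻¹ := (lt_inv_comm₀ two_pos hβ).2 (by simpa using hβ2)
    linarith
  refine ⟨(2 * K + 2) * (K * (16 + 20 * (K + 2) * K) + 8 * K + K * K), by positivity, ?_⟩
  intro lm lp α β γ V₀ ε₀ ε d h b hlm hlp hα hβ hβ2 hγ hV hV0 hαK hβK hγK hlmK hlpK hVK hε₀α hlmε₀
    hlpε₀ _ hε₀γ hε hεε₀ hd hh hb
  have hΩ := isOpen_waveguide lm lp ε d h b
  have hVε := memLp_potential (ε := ε) d h b hV
  have hVε0 := ae_potential_nonneg ε d h b hV0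
  have hΩ₀ := isOpen_interval lm lp
  have hord := ordConnected_interval lm lp
  refine ⟨isResolvent_neumannGraph hΩ hVε hVε0,
    isResolvent_limitGraph hΩ₀ hord ⟨hlm, hlp⟩ hV hV0 hγ.le,
    norm_resolvent_difference_eq (isSelfAdjoint_formResolvent_neumannGraph hΩ hVε hVε0)
      (isSelfAdjoint_formResolvent_limitGraph hΩ₀ hord ⟨hlm, hlp⟩ hV hV0 hγ.le), ?_⟩
  rw [mul_assoc]
  exact norm_resolvent_difference_le_mul_rpow (by linarith) hα hβ hβ2.le hγ hV hV0 hαK hβK hγK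
    hlmK hlpK hVK (hεε₀.trans_lt hε₀α)
    (hlmε₀.le.trans (EReal.coe_le_coe_iff.2 (neg_le_neg hεε₀)))
    ((EReal.coe_le_coe_iff.2 hεε₀).trans hlpε₀.le) (hεε₀.trans_lt hε₀γ) hε hd hh hb
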